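/- Let $G$ be a unimodular, locally compact, Hausdorff topological group with Haar measure $\mu$, and let $K\subseteq G$ be a compact subgroup. Let $\lambda$ be the left regular representation of $G$ on $L^2(G)$, and let $C^*_r(G)$ be the reduced group $C^*$-algebra, i.e. the $C^*$-algebra of operators on $L^2(G)$ generated by the operators $\lambda(f)=\int_G f(g)\lambda(g)\,d\mu(g)$, $f\in C_c(G)$. The spectrum $\widehat A$ of a $C^*$-algebra $A$ is the set of unitary equivalence classes of its (nonzero) irreducible $*$-representations on Hilbert spaces, with the hull-kernel topology, whose closed sets are the sets of classes that vanish on a given two-sided ideal; the reduced dual of $G$ is $\widehat{C^*_r(G)}$. For a finite-dimensional unitary representation $V$ of $K$ put $L^2(G/K;V)=[L^2(G)\otimes V]^K$, where $K$ acts on $L^2(G)$ by right translation; $C^*_r(G)$ acts on this space through the first tensor factor. The compact ideal $C^*_{\mathrm{cpt}}(G)\triangleleft C^*_r(G)$ consists of all $a\in C^*_r(G)$ that act as a compact operator on $L^2(G/K;V)$ for every finite-dimensional unitary representation $V$ of $K$. An irreducible unitary (strongly continuous) representation $\pi$ of $G$ is $K$-admissible if every irreducible unitary representation $V$ of $K$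 occurs in $\pi|_K$ with finite multiplicity, i.e. $\dim \mathrm{Hom}_K(V,H_\pi)<\infty$. It is a topological discrete series representation if it integrates to an irreducible representation $\rho$ of $C^*_r(G)$, meaning $\rho(\lambda(f))=\int_G f(g)\pi(g)\,d\mu(g)$ for all $f\in C_c(G)$, and the singleton $\{[\rho]\}$ is open and closed in the reduced dual. Say that an irreducible representation $\sigma$ of $C^*_{\mathrm{cpt}}(G)$ corresponds to an irreducible unitary representation $\pi$ of $G$ if, up to unitary equivalence, $\sigma$ extends to an irreducible representation of $C^*_r(G)$ that is the integrated form of $\pi$. Theorem. This correspondence defines an injective map from the spectrum of $C^*_{\mathrm{cpt}}(G)$ to the set of unitary equivalence classes of irreducible unitary representations of $G$, and its image consists exactly of the classes of those $\pi$ such that (i) $\pi$ is a topological discrete series representation, and (ii) $\pi$ is $K$-admissible. -/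

import Mathlib

open MeasureTheory
open scoped TensorProduct CompactlySupported ENNReal

universe u

set_option linter.unusedSectionVars false

noncomputable section

/-! ### Unitary representations of topological groups -/

/-- A (strongly continuous) unitary representation of the topological group `G` on `H`. -/
structure UnitaryRep (G : Type*) [Group G] [TopologicalSpace G]
    (H : Type*) [NormedAddCommGroup H] [InnerProductSpace ℂ H] where
  toHom : G →* (H ≃ₗᵢ[ℂ] H)
  strongly_continuous : ∀ ξ : H, Continuous fun g => toHom g ξ

namespace UnitaryRep

variable {G : Type*} [Group G] [TopologicalSpace G]
variable {H : Type*} [NormedAddCommGroup H] [InnerProductSpace ℂ H]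
variable {H' : Type*} [NormedAddCommGroup H'] [InnerProductSpace ℂ H']

/-- Topological irreducibility: `H ≠ 0`, and the only closed invariant subspaces are `0` and `H`. -/
def IsIrreducible (π : UnitaryRep G H) : Prop :=
  Nontrivial H ∧ ∀ W : Submodule ℂ H, IsClosed (W : Set H) →
    (∀ g, ∀ ξ ∈ W, π.toHom g ξ ∈ W) → W = ⊥ ∨ W = ⊤

/-- Restriction to a subgroup. -/
def restrict (π : UnitaryRep G H) (K : Subgroup G) : UnitaryRep K H where
  toHom := π.toHom.comp K.subtype
  strongly_continuous ξ := (π.strongly_continuous ξ).comp continuous_subtype_val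

/-- The space of bounded intertwining operators from `τ` to `π`. -/
def intertwiners (τ : UnitaryRep G H) (π : UnitaryRep G H') : Submodule ℂ (H →L[ℂ] H') where
  carrier := {T | ∀ g ξ, T (τ.toHom g ξ) = π.toHom g (T ξ)}
  add_mem' {S T} hS hT g ξ := by simp [hS g ξ, hT g ξ]
  zero_mem' g ξ := by simp
  smul_mem' c T hT g ξ := by simp [hT g ξ]

/-- `K`-admissibility: each irreducible unitary representation `V` of `K` has finite multiplicity
`dim Hom_K(V, H)` in `H`. -/
def IsAdmissible {G : Type u} [Group G] [TopologicalSpace G]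
    {H : Type u} [NormedAddCommGroup H] [InnerProductSpace ℂ H]
    (K : Subgroup G) (π : UnitaryRep G H) : Prop :=
  ∀ (V : Type u) [NormedAddCommGroup V] [InnerProductSpace ℂ V] [CompleteSpace V]
    (τ : UnitaryRep K V), τ.IsIrreducible →
      FiniteDimensional ℂ (τ.intertwiners (π.restrict K))

variable [MeasurableSpace G] [BorelSpace G]

theorem integrable_smul (μ : Measure G) [IsFiniteMeasureOnCompacts μ] (π : UnitaryRep G H)
    (f : C_c(G, ℂ)) (ξ : H) : Integrable (fun g => f g • π.toHom g ξ) μ :=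
  (f.continuous.smul (π.strongly_continuous ξ)).integrable_of_hasCompactSupport
    f.hasCompactSupport.smul_right

/-- The integrated form `π(f) ξ = ∫ f(g) π(g) ξ dg`, for `f` continuous with compact support. -/
def integrated [CompleteSpace H] (μ : Measure G) [IsFiniteMeasureOnCompacts μ]
    (π : UnitaryRep G H) (f : C_c(G, ℂ)) : H →L[ℂ] H :=
  LinearMap.mkContinuous
    { toFun := fun ξ => ∫ g, f g • π.toHom g ξ ∂μ
      map_add' := fun ξ η => by
        simp only [map_add, smul_add]
        exact integral_add (π.integrable_smul μ f ξ) (π.integrable_smul μ f η)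
      map_smul' := fun c ξ => by
        simp only [map_smul, RingHom.id_apply, ← integral_smul, smul_comm c] }
    (∫ g, ‖f g‖ ∂μ) (fun ξ => by
      refine (norm_integral_le_integral_norm _).trans (le_of_eq ?_)
      simp only [norm_smul, LinearIsometryEquiv.norm_map]
      exact integral_mul_const _ _)

end UnitaryRep

/-- An irreducible unitary representation of `G` on a Hilbert space. -/
structure IrrUnitaryRep (G : Type u) [Group G] [TopologicalSpace G] where
  H : Type u
  [normed : NormedAddCommGroup H]
  [innerProduct : InnerProductSpace ℂ H]
  [complete : CompleteSpace H]
  rep : UnitaryRep G H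
  irreducible : rep.IsIrreducible

attribute [instance] IrrUnitaryRep.normed IrrUnitaryRep.innerProduct IrrUnitaryRep.complete

/-- Unitary equivalence. -/
instance IrrUnitaryRep.setoid (G : Type u) [Group G] [TopologicalSpace G] :
    Setoid (IrrUnitaryRep G) where
  r π π' := ∃ U : π.H ≃ₗᵢ[ℂ] π'.H, ∀ g ξ, U (π.rep.toHom g ξ) = π'.rep.toHom g (U ξ)
  iseqv :=
    { refl := fun π => ⟨LinearIsometryEquiv.refl ℂ π.H, fun _ _ => rfl⟩
      symm := by
        rintro π π' ⟨U, hU⟩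
        refine ⟨U.symm, fun g ξ => ?_⟩
        rw [LinearIsometryEquiv.symm_apply_eq, hU, LinearIsometryEquiv.apply_symm_apply]
      trans := by
        rintro π π' π'' ⟨U, hU⟩ ⟨W, hW⟩
        exact ⟨U.trans W, fun g ξ => by simp [hU, hW]⟩ }

/-- The unitary dual of `G`. -/
abbrev UnitaryDual (G : Type u) [Group G] [TopologicalSpace G] : Type (u + 1) :=
  Quotient (IrrUnitaryRep.setoid G)

/-! ### The spectrum of a C*-algebra -/

/-- An irreducible `*`-representation of `A` on a Hilbert space: it is not the zero representation
and the only closed invariant subspaces are `0` and `H`. -/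
structure IrrRep (A : Type u) [NonUnitalRing A] [StarRing A] [Module ℂ A] where
  H : Type u
  [normed : NormedAddCommGroup H]
  [innerProduct : InnerProductSpace ℂ H]
  [complete : CompleteSpace H]
  rep : A →⋆ₙₐ[ℂ] (H →L[ℂ] H)
  ne_zero : ∃ a, rep a ≠ 0
  irreducible : ∀ W : Submodule ℂ H, IsClosed (W : Set H) →
    (∀ a, ∀ ξ ∈ W, rep a ξ ∈ W) → W = ⊥ ∨ W = ⊤

attribute [instance] IrrRep.normed IrrRep.innerProduct IrrRep.complete

section Spectrum

variable {A : Type u} [NonUnitalRing A] [StarRing A] [Module ℂ A]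

/-- Unitary equivalence. -/
instance IrrRep.setoid (A : Type u) [NonUnitalRing A] [StarRing A] [Module ℂ A] :
    Setoid (IrrRep A) where
  r ρ ρ' := ∃ U : ρ.H ≃ₗᵢ[ℂ] ρ'.H, ∀ a ξ, U (ρ.rep a ξ) = ρ'.rep a (U ξ)
  iseqv :=
    { refl := fun ρ => ⟨LinearIsometryEquiv.refl ℂ ρ.H, fun _ _ => rfl⟩
      symm := by
        rintro ρ ρ' ⟨U, hU⟩
        refine ⟨U.symm, fun g ξ => ?_⟩
        rw [LinearIsometryEquiv.symm_apply_eq, hU, LinearIsometryEquiv.apply_symm_apply]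
      trans := by
        rintro ρ ρ' ρ'' ⟨U, hU⟩ ⟨W, hW⟩
        exact ⟨U.trans W, fun g ξ => by simp [hU, hW]⟩ }

/-- The spectrum `Â`: the set of unitary equivalence classes of irreducible representations. -/
def CStarDual (A : Type u) [NonUnitalRing A] [StarRing A] [Module ℂ A] : Type (u + 1) :=
  Quotient (IrrRep.setoid A)

/-- The class of an irreducible representation in the spectrum. -/
def IrrRep.toDual (ρ : IrrRep A) : CStarDual A := Quotient.mk _ ρ

/-- The kernel of an irreducible representation, a two-sided ideal. -/
def IrrRep.ker (ρ : IrrRep A) : TwoSidedIdeal A := TwoSidedIdeal.ker ρ.rep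

/-- The (primitive) ideal attached to a point of the spectrum. -/
def CStarDual.ker (x : CStarDual A) : TwoSidedIdeal A :=
  Quotient.lift IrrRep.ker (by
    rintro ρ ρ' ⟨U, hU⟩
    ext a
    simp only [IrrRep.ker, TwoSidedIdeal.mem_ker]
    constructor
    · intro h
      ext ξ
      have := hU a (U.symm ξ)
      simpa [h] using this.symm
    · intro h
      ext ξ
      have := hU a ξ
      simpa [h] using this) x

/-- Kernels of irreducible representations are prime ideals. -/
theorem IrrRep.ker_prime (ρ : IrrRep A) (I J : TwoSidedIdeal A) (h : I ⊓ J ≤ ρ.ker) :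
    I ≤ ρ.ker ∨ J ≤ ρ.ker := by
  by_contra! hc
  obtain ⟨hI, hJ⟩ := hc
  obtain ⟨a, haI, ha⟩ := Set.not_subset.1 hI
  obtain ⟨b, hbJ, hb⟩ := Set.not_subset.1 hJ
  have ha' : ρ.rep a ≠ 0 := fun h0 => ha ((TwoSidedIdeal.mem_ker _).2 h0)
  have hb' : ρ.rep b ≠ 0 := fun h0 => hb ((TwoSidedIdeal.mem_ker _).2 h0)
  obtain ⟨ξ, hξ⟩ : ∃ ξ, ρ.rep b ξ ≠ 0 := by
    by_contra! h0
    exact hb' (ContinuousLinearMap.ext h0)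
  have key : ∀ c, ρ.rep a (ρ.rep c (ρ.rep b ξ)) = 0 := by
    intro c
    have hm : a * c * b ∈ I ⊓ J :=
      (TwoSidedIdeal.mem_inf _).2 ⟨I.mul_mem_right _ _ (I.mul_mem_right _ _ haI),
        J.mul_mem_left _ _ hbJ⟩
    have h1 : ρ.rep (a * c * b) = 0 := (TwoSidedIdeal.mem_ker _).1 (h hm)
    have h2 := congrArg (fun T : ρ.H →L[ℂ] ρ.H => T ξ) h1
    simpa [map_mul] using h2
  let W : Submodule ℂ ρ.H :=
    { carrier := {η | ∀ c, ρ.rep a (ρ.rep c η) = 0}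
      add_mem' := fun {x y} hx hy c => by simp [hx c, hy c]
      zero_mem' := fun c => by simp
      smul_mem' := fun r x hx c => by simp [hx c] }
  have hWc : IsClosed (W : Set ρ.H) := by
    have : (W : Set ρ.H) = ⋂ c, {η | ρ.rep a (ρ.rep c η) = 0} := by
      ext η; simp [W]
    rw [this]
    exact isClosed_iInter fun c => isClosed_eq (by fun_prop) continuous_const
  have hWi : ∀ c, ∀ η ∈ W, ρ.rep c η ∈ W := fun c η hη d => by
    have := hη (d * c)
    simpa [map_mul] using this
  rcases ρ.irreducible W hWc hWi with hW | hW
  · have : ρ.rep b ξ ∈ W := key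
    rw [hW] at this
    exact hξ (by simpa using this)
  · let Z : Submodule ℂ ρ.H :=
      { carrier := {η | ∀ c, ρ.rep c η = 0}
        add_mem' := fun {x y} hx hy c => by simp [hx c, hy c]
        zero_mem' := fun c => by simp
        smul_mem' := fun r x hx c => by simp [hx c] }
    have hZc : IsClosed (Z : Set ρ.H) := by
      have : (Z : Set ρ.H) = ⋂ c, {η | ρ.rep c η = 0} := by
        ext η; simp [Z]
      rw [this]
      exact isClosed_iInter fun c => isClosed_eq (by fun_prop) continuous_const
    have hZi : ∀ c, ∀ η ∈ Z, ρ.rep c η ∈ Z := fun c η hη d => by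
      rw [hη c]; simp
    rcases ρ.irreducible Z hZc hZi with hZ | hZ
    · apply ha'
      have hs : ρ.rep (star a) = 0 := by
        ext η
        have hmem : ρ.rep (star a) η ∈ Z := by
          intro c
          have hperp : ∀ ζ, inner ℂ (ρ.rep c (ρ.rep (star a) η)) ζ = 0 := by
            intro ζ
            have hζ : ζ ∈ W := by rw [hW]; trivial
            have h3 := hζ (star c)
            rw [map_star, ContinuousLinearMap.star_eq_adjoint] at h3
            rw [map_star, ContinuousLinearMap.star_eq_adjoint,
              ← ContinuousLinearMap.adjoint_inner_right,
              ContinuousLinearMap.adjoint_inner_left, h3, inner_zero_right]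
          exact inner_self_eq_zero.1 (hperp _)
        rw [hZ] at hmem
        simpa using hmem
      rw [map_star, star_eq_zero] at hs
      exact hs
    · obtain ⟨c, hc⟩ := ρ.ne_zero
      apply hc
      ext η
      have : η ∈ Z := by rw [hZ]; trivial
      exact this c

/-- The hull-kernel topology of the spectrum: the closed sets are the hulls
`{x | x vanishes on I}` of two-sided ideals `I`. (An ideal and its closure have the same hull.) -/
instance CStarDual.topology : TopologicalSpace (CStarDual A) :=
  TopologicalSpace.ofClosed {S | ∃ I : TwoSidedIdeal A, S = {x | I ≤ x.ker}}
    (by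
      refine ⟨⊤, ?_⟩
      ext x
      simp only [Set.mem_empty_iff_false, Set.mem_ofPred_eq, false_iff]
      induction x using Quotient.inductionOn with
      | h ρ =>
        intro h
        obtain ⟨a, ha⟩ := ρ.ne_zero
        exact ha ((TwoSidedIdeal.mem_ker _).1 (h (TwoSidedIdeal.mem_top (x := a)))))
    (by
      intro F hF
      refine ⟨sSup {I | ∃ S ∈ F, S = {x | I ≤ x.ker}}, ?_⟩
      ext x
      simp only [Set.mem_sInter, Set.mem_ofPred_eq, sSup_le_iff]
      constructor
      · rintro h I ⟨S, hS, rfl⟩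
        exact h _ hS
      · intro h S hS
        obtain ⟨I, rfl⟩ := hF hS
        exact h I ⟨_, hS, rfl⟩)
    (by
      rintro _ ⟨I, rfl⟩ _ ⟨J, rfl⟩
      refine ⟨I ⊓ J, ?_⟩
      ext x
      simp only [Set.mem_union, Set.mem_ofPred_eq]
      constructor
      · rintro (h | h)
        · exact inf_le_left.trans h
        · exact inf_le_right.trans h
      · induction x using Quotient.inductionOn with
        | h ρ => exact ρ.ker_prime I J)

end Spectrum

/-! ### The regular representation and the reduced group C*-algebra -/

section Reduced

variable {G : Type u} [Group G] [TopologicalSpace G] [IsTopologicalGroup G]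
  [MeasurableSpace G] [BorelSpace G]
variable (μ : Measure G)

/-- The operator `(λ(g) ξ)(x) = ξ(g⁻¹ x)` on `L²(G)`. -/
def leftTranslation [μ.IsMulLeftInvariant] (g : G) : Lp ℂ 2 μ →ₗᵢ[ℂ] Lp ℂ 2 μ :=
  Lp.compMeasurePreservingₗᵢ ℂ (fun x => g⁻¹ * x) (measurePreserving_mul_left μ g⁻¹)

/-- The operator `(r(g) ξ)(x) = ξ(x g)` on `L²(G)`. -/
def rightTranslation [μ.IsMulRightInvariant] (g : G) : Lp ℂ 2 μ →ₗᵢ[ℂ] Lp ℂ 2 μ :=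
  Lp.compMeasurePreservingₗᵢ ℂ (fun x => x * g) (measurePreserving_mul_right μ g)

theorem leftTranslation_one [μ.IsMulLeftInvariant] (ξ : Lp ℂ 2 μ) :
    leftTranslation μ 1 ξ = ξ := by
  apply Lp.ext
  filter_upwards [Lp.coeFn_compMeasurePreserving ξ (measurePreserving_mul_left μ (1 : G)⁻¹)]
    with x hx
  refine hx.trans ?_
  simp

theorem leftTranslation_mul [μ.IsMulLeftInvariant] (g h : G) (ξ : Lp ℂ 2 μ) :
    leftTranslation μ (g * h) ξ = leftTranslation μ g (leftTranslation μ h ξ) := by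
  apply Lp.ext
  have h1 := Lp.coeFn_compMeasurePreserving ξ (measurePreserving_mul_left μ (g * h)⁻¹)
  have h2 := Lp.coeFn_compMeasurePreserving (leftTranslation μ h ξ)
    (measurePreserving_mul_left μ g⁻¹)
  have h3 := (measurePreserving_mul_left μ g⁻¹).quasiMeasurePreserving.ae_eq_comp
    (Lp.coeFn_compMeasurePreserving ξ (measurePreserving_mul_left μ h⁻¹))
  filter_upwards [h1, h2, h3] with x hx1 hx2 hx3
  refine hx1.trans (Eq.trans ?_ hx2.symm)
  refine Eq.trans ?_ hx3.symm
  simp [mul_assoc]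

theorem leftTranslation_right [μ.IsMulLeftInvariant] [μ.IsMulRightInvariant] (g h : G)
    (ξ : Lp ℂ 2 μ) :
    leftTranslation μ g (rightTranslation μ h ξ) = rightTranslation μ h (leftTranslation μ g ξ) := by
  apply Lp.ext
  have h1 := Lp.coeFn_compMeasurePreserving (rightTranslation μ h ξ)
    (measurePreserving_mul_left μ g⁻¹)
  have h2 := (measurePreserving_mul_left μ g⁻¹).quasiMeasurePreserving.ae_eq_comp
    (Lp.coeFn_compMeasurePreserving ξ (measurePreserving_mul_right μ h))
  have h3 := Lp.coeFn_compMeasurePreserving (leftTranslation μ g ξ)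
    (measurePreserving_mul_right μ h)
  have h4 := (measurePreserving_mul_right μ h).quasiMeasurePreserving.ae_eq_comp
    (Lp.coeFn_compMeasurePreserving ξ (measurePreserving_mul_left μ g⁻¹))
  filter_upwards [h1, h2, h3, h4] with x hx1 hx2 hx3 hx4
  refine (hx1.trans hx2).trans (Eq.trans ?_ (hx3.trans hx4).symm)
  simp [mul_assoc]

theorem rightTranslation_inv [μ.IsMulRightInvariant] (g : G) (ξ : Lp ℂ 2 μ) :
    rightTranslation μ g (rightTranslation μ g⁻¹ ξ) = ξ := by
  apply Lp.ext
  have h1 := Lp.coeFn_compMeasurePreserving (rightTranslation μ g⁻¹ ξ)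
    (measurePreserving_mul_right μ g)
  have h2 := (measurePreserving_mul_right μ g).quasiMeasurePreserving.ae_eq_comp
    (Lp.coeFn_compMeasurePreserving ξ (measurePreserving_mul_right μ g⁻¹))
  filter_upwards [h1, h2] with x hx1 hx2
  refine (hx1.trans hx2).trans ?_
  simp

variable [LocallyCompactSpace G]

/-- The left regular representation of `G` on `L²(G)`. -/
def leftRegular [μ.IsHaarMeasure] [μ.Regular] : UnitaryRep G (Lp ℂ 2 μ) where
  toHom :=
    { toFun := fun g =>
        { (leftTranslation μ g).toLinearMap with
          invFun := leftTranslation μ g⁻¹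
          left_inv := fun ξ => by
            change leftTranslation μ g⁻¹ (leftTranslation μ g ξ) = ξ
            rw [← leftTranslation_mul, inv_mul_cancel, leftTranslation_one]
          right_inv := fun ξ => by
            change leftTranslation μ g (leftTranslation μ g⁻¹ ξ) = ξ
            rw [← leftTranslation_mul, mul_inv_cancel, leftTranslation_one]
          norm_map' := (leftTranslation μ g).norm_map }
      map_one' := by
        ext1 ξ
        exact leftTranslation_one μ ξ
      map_mul' := fun g h => by
        ext1 ξ
        exact leftTranslation_mul μ g h ξ }
  strongly_continuous ξ := by
    have : Fact ((2 : ℝ≥0∞) ≠ ∞) := ⟨by simp⟩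
    have h : Continuous fun g : G => DomMulAct.mk g⁻¹ • ξ :=
      (DomMulAct.continuous_mk.comp continuous_inv).smul continuous_const
    exact h

/-- The reduced group C*-algebra `C*_r(G)`: the C*-algebra of operators on `L²(G)` generated by the
left convolution operators `λ(f)`, `f` continuous with compact support. -/
def reducedCStar [μ.IsHaarMeasure] [μ.Regular] :
    NonUnitalStarSubalgebra ℂ (Lp ℂ 2 μ →L[ℂ] Lp ℂ 2 μ) :=
  (NonUnitalStarAlgebra.adjoin ℂ (Set.range ((leftRegular μ).integrated μ))).topologicalClosure

/-- The left convolution operator `λ(f)`, as an element of `C*_r(G)`. -/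
def leftConv [μ.IsHaarMeasure] [μ.Regular] (f : C_c(G, ℂ)) : reducedCStar μ :=
  ⟨(leftRegular μ).integrated μ f, NonUnitalStarSubalgebra.le_topologicalClosure _
    (NonUnitalStarAlgebra.subset_adjoin ℂ _ ⟨f, rfl⟩)⟩

/-- `ρ` is (unitarily equivalent to) the representation of `C*_r(G)` obtained by integrating the
irreducible unitary representation `π` of `G`. -/
def IsIntegratedForm [μ.IsHaarMeasure] [μ.Regular]
    (ρ : IrrRep (reducedCStar μ)) (π : IrrUnitaryRep G) : Prop :=
  ∃ U : π.H ≃ₗᵢ[ℂ] ρ.H, ∀ (f : C_c(G, ℂ)) (ξ : π.H),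
    U (π.rep.integrated μ f ξ) = ρ.rep (leftConv μ f) (U ξ)

/-- `π` is a topological discrete series representation: it is a point of the reduced dual (the
spectrum of `C*_r(G)`) and the corresponding singleton is open and closed there. -/
def IsTopologicalDiscreteSeries [μ.IsHaarMeasure] [μ.Regular] (π : IrrUnitaryRep G) : Prop :=
  ∃ ρ : IrrRep (reducedCStar μ), IsIntegratedForm μ ρ π ∧ IsClopen {ρ.toDual}

end Reduced

/-! ### Sections of homogeneous bundles and the compact ideal -/

section Tensor

variable {E V : Type*} [NormedAddCommGroup E] [InnerProductSpace ℂ E]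
  [NormedAddCommGroup V] [InnerProductSpace ℂ V] [FiniteDimensional ℂ V]

theorem tensor_complete [CompleteSpace E] : CompleteSpace (E ⊗[ℂ] V) := by
  let b := stdOrthonormalBasis ℂ V
  let p : ∀ i, E ⊗[ℂ] V →L[ℂ] E := fun i =>
    (TensorProduct.ridIsometry ℂ E).toContinuousLinearEquiv.toContinuousLinearMap.comp
      ((innerSL ℂ (b i)).lTensor E)
  let e : (E ⊗[ℂ] V) ≃L[ℂ] (Fin (Module.finrank ℂ V) → E) :=
    { toFun := fun x i => p i x
      invFun := fun y => ∑ i, y i ⊗ₜ[ℂ] b i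
      map_add' := fun x y => by ext i; simp
      map_smul' := fun c x => by ext i; simp
      left_inv := fun x => by
        induction x using TensorProduct.induction_on with
        | zero => simp
        | add x y hx hy =>
          simp only [map_add, TensorProduct.add_tmul, Finset.sum_add_distrib] at hx hy ⊢
          rw [hx, hy]
        | tmul x v =>
          conv_rhs => rw [← b.sum_repr v]
          simp [p, TensorProduct.tmul_sum, TensorProduct.smul_tmul, b.repr_apply_apply]
      right_inv := fun y => by
        ext i
        simp [p, orthonormal_iff_ite.1 b.orthonormal]
      continuous_toFun := by
        change Continuous fun x i => p i x
        fun_prop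
      continuous_invFun := by
        change Continuous fun y : Fin (Module.finrank ℂ V) → E => ∑ i, y i ⊗ₜ[ℂ] b i
        fun_prop }
  exact (completeSpace_congr (e := e.toEquiv) e.isUniformEmbedding).2 inferInstance

/-- If `S` is a formal adjoint of a compact operator, then `S` is compact. -/
theorem compact_of_adjoint {F : Type*} [NormedAddCommGroup F] [InnerProductSpace ℂ F]
    [CompleteSpace F] (S T : F →L[ℂ] F) (h : ∀ x y, inner ℂ (T x) y = inner ℂ x (S y))
    (hT : IsCompactOperator T) : IsCompactOperator S := by
  have hTS : IsCompactOperator (T ∘L S) := hT.comp_clm S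
  have htb : TotallyBounded ((T ∘L S) '' Metric.closedBall 0 1) :=
    ((hTS.isCompact_closure_image_closedBall (𝕜₁ := ℂ) (f := (T ∘L S).toLinearMap) 1
      ).totallyBounded).subset subset_closure
  refine (isCompactOperator_iff_isCompact_closure_image_closedBall (𝕜₁ := ℂ) S.toLinearMap
    zero_lt_one).2 ?_
  refine TotallyBounded.isCompact_of_isClosed (TotallyBounded.closure ?_) isClosed_closure
  refine Metric.totallyBounded_iff.2 fun ε hε => ?_
  obtain ⟨t, hts, htf, hcov⟩ := Metric.finite_approx_of_totallyBounded htb (ε ^ 2 / 4) (by positivity)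
  lift t to Finset F using htf
  classical
  obtain ⟨u, hu, rfl⟩ := Finset.subset_set_image_iff.1 hts
  refine ⟨S '' (u : Set F), u.finite_toSet.image _, ?_⟩
  rintro _ ⟨x, hx, rfl⟩
  obtain ⟨_, hy, hxy⟩ := Set.mem_iUnion₂.1 (hcov ⟨x, hx, rfl⟩)
  obtain ⟨z, hz, rfl⟩ := Finset.mem_image.1 (Finset.mem_coe.1 hy)
  refine Set.mem_iUnion₂.2 ⟨S z, ⟨z, hz, rfl⟩, ?_⟩
  have hz1 : ‖z‖ ≤ 1 := by simpa using hu hz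
  have hx1 : ‖x‖ ≤ 1 := by simpa using hx
  have hd : ‖x - z‖ ≤ 2 := (norm_sub_le _ _).trans (by linarith)
  rw [mem_ball_iff_norm] at hxy ⊢
  have h1 : ‖T (S (x - z))‖ < ε ^ 2 / 4 := by simpa using hxy
  have h2 : ‖S (x - z)‖ ^ 2 ≤ ‖T (S (x - z))‖ * ‖x - z‖ := by
    have h3 := norm_inner_le_norm (𝕜 := ℂ) (T (S (x - z))) (x - z)
    rw [h, inner_self_eq_norm_sq_to_K, norm_pow] at h3
    simpa using h3
  have h4 : ‖S (x - z)‖ < ε := by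
    nlinarith [norm_nonneg (T (S (x - z))), norm_nonneg (S (x - z))]
  simpa using h4

end Tensor

section CompactIdeal

variable {G : Type u} [Group G] [TopologicalSpace G] [IsTopologicalGroup G]
  [LocallyCompactSpace G] [MeasurableSpace G] [BorelSpace G]
variable (μ : Measure G) [μ.IsHaarMeasure] [μ.Regular] [μ.IsMulRightInvariant]
variable {K : Subgroup G} {V : Type*} [NormedAddCommGroup V] [InnerProductSpace ℂ V]

/-- Elements of `C*_r(G)` commute with right translations. -/
theorem reducedCStar_commute (a : reducedCStar μ) (k : G) (ξ : Lp ℂ 2 μ) :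
    (a : Lp ℂ 2 μ →L[ℂ] Lp ℂ 2 μ) (rightTranslation μ k ξ)
      = rightTranslation μ k ((a : Lp ℂ 2 μ →L[ℂ] Lp ℂ 2 μ) ξ) := by
  obtain ⟨T, hT⟩ := a
  change T (rightTranslation μ k ξ) = rightTranslation μ k (T ξ)
  have hcl : IsClosed {T : Lp ℂ 2 μ →L[ℂ] Lp ℂ 2 μ |
      ∀ ξ, T (rightTranslation μ k ξ) = rightTranslation μ k (T ξ)} := by
    have hi : {T : Lp ℂ 2 μ →L[ℂ] Lp ℂ 2 μ |
        ∀ ξ, T (rightTranslation μ k ξ) = rightTranslation μ k (T ξ)}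
        = ⋂ ξ, {T | T (rightTranslation μ k ξ) = rightTranslation μ k (T ξ)} := by
      ext T
      rw [Set.mem_iInter]
      exact Iff.rfl
    rw [hi]
    refine isClosed_iInter fun ξ => isClosed_eq (by fun_prop) ?_
    exact (rightTranslation μ k).continuous.comp (by fun_prop)
  refine closure_minimal (fun T hT => ?_) hcl hT ξ
  change ∀ ξ, T (rightTranslation μ k ξ) = rightTranslation μ k (T ξ)
  induction hT using NonUnitalStarAlgebra.adjoin_induction with
  | mem T hT =>
    obtain ⟨f, rfl⟩ := hT
    intro ξ
    change ∫ g, f g • leftTranslation μ g (rightTranslation μ k ξ) ∂μ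
      = rightTranslation μ k (∫ g, f g • leftTranslation μ g ξ ∂μ)
    have h := (rightTranslation μ k).toContinuousLinearMap.integral_comp_comm
      ((leftRegular μ).integrable_smul μ f ξ)
    refine Eq.trans ?_ h
    refine integral_congr_ae (Filter.Eventually.of_forall fun g => ?_)
    change f g • leftTranslation μ g (rightTranslation μ k ξ)
      = rightTranslation μ k (f g • leftTranslation μ g ξ)
    rw [map_smul, leftTranslation_right]
  | add S T _ _ hS hT => intro ξ; simp [hS ξ, hT ξ]
  | zero => intro ξ; simp
  | mul S T _ _ hS hT => intro ξ; simp [hS, hT ξ]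
  | smul c T _ hT => intro ξ; simp [hT ξ]
  | star T _ hT =>
    intro ξ
    refine ext_inner_right ℂ fun ζ => ?_
    rw [← rightTranslation_inv μ k ζ, ContinuousLinearMap.star_eq_adjoint,
      ContinuousLinearMap.adjoint_inner_left, hT, LinearIsometry.inner_map_map,
      LinearIsometry.inner_map_map, ContinuousLinearMap.adjoint_inner_left]

/-- `L²(G/K; V) = [L²(G) ⊗ V]^K`, where `K` acts on `L²(G)` by right translation. As `V` will be
finite-dimensional, the algebraic tensor product with its Hilbert norm is the Hilbert tensor
product. -/
def bundleL2 (τ : UnitaryRep K V) : Submodule ℂ (Lp ℂ 2 μ ⊗[ℂ] V) where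
  carrier := {x | ∀ k : K,
    TensorProduct.map (rightTranslation μ (k : G)).toLinearMap
      (τ.toHom k).toLinearEquiv.toLinearMap x = x}
  add_mem' {x y} hx hy k := by rw [map_add, hx k, hy k]
  zero_mem' k := map_zero _
  smul_mem' c x hx k := by rw [map_smul, hx k]

/-- The action of `C*_r(G)` on `L²(G/K; V)`, by `a ⊗ 1`. -/
def bundleAction (τ : UnitaryRep K V) (a : reducedCStar μ) :
    bundleL2 μ τ →L[ℂ] bundleL2 μ τ :=
  (((a : Lp ℂ 2 μ →L[ℂ] Lp ℂ 2 μ).rTensor V).comp (bundleL2 μ τ).subtypeL).codRestrict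
    (bundleL2 μ τ) (fun x k => by
      have hx := x.2 k
      conv_rhs => rw [ContinuousLinearMap.comp_apply, Submodule.subtypeL_apply, ← hx]
      rw [ContinuousLinearMap.comp_apply, Submodule.subtypeL_apply,
        ContinuousLinearMap.rTensor_apply, ContinuousLinearMap.rTensor_apply]
      rw [LinearMap.rTensor, ← LinearMap.comp_apply, ← LinearMap.comp_apply,
        ← TensorProduct.map_comp, ← TensorProduct.map_comp]
      congr 2
      ext ξ : 1
      exact (reducedCStar_commute μ a k ξ).symm)

theorem coe_bundleAction (τ : UnitaryRep K V) (a : reducedCStar μ) (x : bundleL2 μ τ) :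
    (bundleAction μ τ a x : Lp ℂ 2 μ ⊗[ℂ] V)
      = (a : Lp ℂ 2 μ →L[ℂ] Lp ℂ 2 μ).rTensor V (x : Lp ℂ 2 μ ⊗[ℂ] V) := rfl

theorem bundleAction_star (τ : UnitaryRep K V) (a : reducedCStar μ) (x y : bundleL2 μ τ) :
    inner ℂ (bundleAction μ τ a x) y = inner ℂ x (bundleAction μ τ (star a) y) := by
  rw [Submodule.coe_inner, Submodule.coe_inner, coe_bundleAction, coe_bundleAction]
  generalize (x : Lp ℂ 2 μ ⊗[ℂ] V) = x
  generalize (y : Lp ℂ 2 μ ⊗[ℂ] V) = y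
  induction x using TensorProduct.induction_on with
  | zero => simp
  | add x x' hx hx' => rw [map_add, inner_add_left, inner_add_left, hx, hx']
  | tmul ξ v =>
    induction y using TensorProduct.induction_on with
    | zero => simp
    | add y y' hy hy' => rw [map_add, inner_add_right, inner_add_right, hy, hy']
    | tmul η w =>
      rw [ContinuousLinearMap.rTensor_tmul, ContinuousLinearMap.rTensor_tmul,
        TensorProduct.inner_tmul, TensorProduct.inner_tmul]
      congr 1
      exact (ContinuousLinearMap.adjoint_inner_right _ _ _).symm

theorem bundleL2_complete [FiniteDimensional ℂ V] (τ : UnitaryRep K V) :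
    CompleteSpace (bundleL2 μ τ) := by
  have := tensor_complete (E := Lp ℂ 2 μ) (V := V)
  have hc : IsClosed (bundleL2 μ τ : Set (Lp ℂ 2 μ ⊗[ℂ] V)) := by
    have h : (bundleL2 μ τ : Set (Lp ℂ 2 μ ⊗[ℂ] V)) = ⋂ k : K,
        {x | TensorProduct.mapIsometry (rightTranslation μ (k : G))
          (τ.toHom k).toLinearIsometry x = x} := by
      ext x
      rw [Set.mem_iInter]
      exact Iff.rfl
    rw [h]
    exact isClosed_iInter fun k => isClosed_eq (LinearIsometry.continuous _) continuous_id
  exact hc.completeSpace_coe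

theorem bundleAction_compact_star [FiniteDimensional ℂ V] (τ : UnitaryRep K V)
    (a : reducedCStar μ) (ha : IsCompactOperator (bundleAction μ τ a)) :
    IsCompactOperator (bundleAction μ τ (star a)) := by
  have := bundleL2_complete μ τ
  refine compact_of_adjoint (F := bundleL2 μ τ) (bundleAction μ τ (star a)) (bundleAction μ τ a)
    (fun x y => ?_) ha
  exact bundleAction_star μ τ a x y

theorem bundleAction_add (τ : UnitaryRep K V) (a b : reducedCStar μ) :
    bundleAction μ τ (a + b) = bundleAction μ τ a + bundleAction μ τ b := by
  ext x : 2
  simp [coe_bundleAction]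

theorem bundleAction_zero (τ : UnitaryRep K V) : bundleAction μ τ 0 = 0 := by
  ext x : 2
  simp [coe_bundleAction]

theorem bundleAction_smul (τ : UnitaryRep K V) (c : ℂ) (a : reducedCStar μ) :
    bundleAction μ τ (c • a) = c • bundleAction μ τ a := by
  ext x : 2
  simp [coe_bundleAction]

theorem bundleAction_mul (τ : UnitaryRep K V) (a b : reducedCStar μ) :
    bundleAction μ τ (a * b) = (bundleAction μ τ a).comp (bundleAction μ τ b) := by
  ext x : 2
  simp [coe_bundleAction, LinearMap.rTensor_mul]

/-- The compact ideal `C*_cpt(G)` in `C*_r(G)`: the elements that act as compact operators on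
`L²(G/K; V)` for every finite-dimensional unitary representation `V` of `K`. -/
def compactIdeal (K : Subgroup G) : NonUnitalStarSubalgebra ℂ (reducedCStar μ) where
  carrier := {a | ∀ (V : Type u) [NormedAddCommGroup V] [InnerProductSpace ℂ V]
    [FiniteDimensional ℂ V] (τ : UnitaryRep K V), IsCompactOperator (bundleAction μ τ a)}
  add_mem' {a b} ha hb V _ _ _ τ := by
    rw [bundleAction_add]
    exact (ha V τ).add (hb V τ)
  zero_mem' V _ _ _ τ := by
    rw [bundleAction_zero]
    exact isCompactOperator_zero
  mul_mem' {a b} ha _ V _ _ _ τ := by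
    rw [bundleAction_mul]
    exact (ha V τ).comp_clm _
  smul_mem' c a ha V _ _ _ τ := by
    rw [bundleAction_smul]
    exact (ha V τ).smul c
  star_mem' {a} ha V _ _ _ τ := bundleAction_compact_star μ τ a (ha V τ)

end CompactIdeal

section Identification

variable {G : Type u} [Group G] [TopologicalSpace G] [IsTopologicalGroup G]
  [LocallyCompactSpace G] [MeasurableSpace G] [BorelSpace G]

/-- `ρ` is (unitarily equivalent to) an extension to `A` of the representation `σ` of the
subalgebra `J`. -/
def IsExtension {A : Type u} [NonUnitalRing A] [StarRing A] [Module ℂ A]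
    (J : NonUnitalStarSubalgebra ℂ A) (ρ : IrrRep A) (σ : IrrRep J) : Prop :=
  ∃ U : σ.H ≃ₗᵢ[ℂ] ρ.H, ∀ (a : J) (ξ : σ.H), U (σ.rep a ξ) = ρ.rep (a : A) (U ξ)

/-- The identification of points of the spectrum of an ideal `J` of `C*_r(G)` with irreducible
unitary representations of `G`: `σ` extends to an irreducible representation of `C*_r(G)`, and
the extension is the integrated form of `π`. -/
def CorrespondsTo (μ : Measure G) [μ.IsHaarMeasure] [μ.Regular]
    (J : NonUnitalStarSubalgebra ℂ (reducedCStar μ)) (σ : IrrRep J) (π : IrrUnitaryRep G) : Prop :=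
  ∃ ρ : IrrRep (reducedCStar μ), IsExtension J ρ σ ∧ IsIntegratedForm μ ρ π

end Identification
end

noncomputable section

/-! ### Irreducible representations of C*-algebras -/

section IrreducibleRepresentations

/-! Write A for the reduced C*-algebra, J for the compact ideal, and aλ(φ) for the product of a in A
with ∫ φ(k) λ(k) dk, where φ is a matrix coefficient of a finite-dimensional unitary representation
of K. Since J is a closed ideal, restriction and extension identify its spectrum with the points ρ
of the spectrum of A that do not vanish on J (`IrrRep.restrictIdeal`, `IrrRep.exists_isExtension`,
`IsExtension.equiv_left`). Since A is the closure of the operators λ(f) and G acts on A by unitary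
multipliers, every ρ is the integrated form of a unique irreducible π (`IrrRep.exists_integrated`,
`IntegratesTo.equiv_right`). This yields the injective map. What remains is that ρ is non-zero on J
exactly when its class is open and closed and π is K-admissible.

Both sides are compared with one finiteness condition on c in A: the space cAλ(φ) has finite
dimension for every φ. By `mulSubgroupConv_leftConv_apply`, cλ(f)λ(φ) acts on h as right convolution
by h applied to c r(φ) f, so the condition says that c r(φ) has finite rank on L²(G)
(`finiteDimensional_subgroupCorner_iff`). Slicing tensors translates this into finite rank of c on
every L²(G/K;V). Hence such c lie in J; conversely an element c = bc with b in J satisfies the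
condition, because a compact operator fixes the range of c.

If ρ does not vanish on J, functional calculus produces c with ρ(c) ≠ 0 and c = bc, b in J. Taking
adjoints, finiteness of cAλ(φ) forces π(φ) to have finite rank, which is admissibility. A suitable
cλ(φ) is non-zero under ρ, so the corner cA(cλ(φ)) is finite-dimensional; a minimal choice gives y
with yAy = ℂy, up to which ρ is determined, so the class is open (`IrrRep.exists_corner`,
`IrrRep.equiv_of_corner`). The same argument inside ρ(A), where the operators ρ(a)π(φ) have finite
rank, shows that it is closed.

If the class is open and π admissible, let I be an ideal whose hull is the complement of the class.
Irreducible representations separate points (`exists_irrRep_apply_ne_zero`), so ρ is injective on I.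
For a suitable c in I with ρ(c) of finite rank, cAλ(φ) embeds into ρ(c)B(H)π(φ), which has finite
dimension; hence c lies in J and ρ does not vanish on J. All of this is assembled in
`exists_correspondence`. -/

/-- Two linear maps with dense ranges in Hilbert spaces and equal norms differ by a unitary. -/
theorem exists_unitary_of_norm_eq {E H H' : Type*} [AddCommGroup E] [Module ℂ E]
    [NormedAddCommGroup H] [InnerProductSpace ℂ H] [CompleteSpace H]
    [NormedAddCommGroup H'] [InnerProductSpace ℂ H'] [CompleteSpace H']
    (e : E →ₗ[ℂ] H) (f : E →ₗ[ℂ] H') (he : DenseRange e) (hf : DenseRange f)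
    (h : ∀ x, ‖e x‖ = ‖f x‖) : ∃ U : H ≃ₗᵢ[ℂ] H', ∀ x, U (e x) = f x := by
  have h1 : ∀ x, f.extendOfNorm e (e x) = f x := fun x =>
    LinearMap.extendOfNorm_eq he ⟨1, fun x => by simp [h]⟩ x
  have h2 : ∀ x, e.extendOfNorm f (f x) = e x := fun x =>
    LinearMap.extendOfNorm_eq hf ⟨1, fun x => by simp [h]⟩ x
  have h3 : ∀ y, e.extendOfNorm f (f.extendOfNorm e y) = y := fun y =>
    congrFun (he.equalizer (g := fun y => e.extendOfNorm f (f.extendOfNorm e y)) (h := id)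
      (by fun_prop) continuous_id (by ext x; simp [h1, h2])) y
  have h4 : ∀ y, f.extendOfNorm e (e.extendOfNorm f y) = y := fun y =>
    congrFun (hf.equalizer (g := fun y => f.extendOfNorm e (e.extendOfNorm f y)) (h := id)
      (by fun_prop) continuous_id (by ext x; simp [h1, h2])) y
  have h5 : ∀ y, ‖f.extendOfNorm e y‖ = ‖y‖ := fun y =>
    congrFun (he.equalizer (g := fun y => ‖f.extendOfNorm e y‖) (h := fun y => ‖y‖)
      (by fun_prop) continuous_norm (by ext x; simp [h1, h])) y
  exact ⟨⟨LinearEquiv.ofLinearMap (f.extendOfNorm e).toLinearMap (e.extendOfNorm f).toLinearMap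
    (by ext y; exact h4 y) (by ext y; exact h3 y), h5⟩, h1⟩

/-! ### Cyclicity, primeness, and data that determine an irreducible representation -/

section Algebraic

variable {A : Type u} [NonUnitalRing A] [StarRing A] [Module ℂ A]

/-- The orbit map `a ↦ ρ(a) ξ`. -/
def IrrRep.orbit (ρ : IrrRep A) (ξ : ρ.H) : A →ₗ[ℂ] ρ.H where
  toFun a := ρ.rep a ξ
  map_add' a b := by simp
  map_smul' c a := by simp

theorem IrrRep.orbit_apply (ρ : IrrRep A) (ξ : ρ.H) (a : A) : ρ.orbit ξ a = ρ.rep a ξ := rfl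

theorem IrrRep.mul_apply (ρ : IrrRep A) (a b : A) (ξ : ρ.H) :
    ρ.rep (a * b) ξ = ρ.rep a (ρ.rep b ξ) := by
  rw [map_mul]; rfl

theorem IrrRep.inner_star (ρ : IrrRep A) (a : A) (ξ η : ρ.H) :
    inner ℂ (ρ.rep (star a) ξ) η = inner ℂ ξ (ρ.rep a η) := by
  rw [map_star, ContinuousLinearMap.star_eq_adjoint, ContinuousLinearMap.adjoint_inner_left]

/-- The common kernel of all operators of the representation is closed and invariant, and it is not
the whole space because the representation is non-zero. As the algebra has no unit, this
non-degeneracy has to be derived from irreducibility. -/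
theorem IrrRep.eq_zero_of_forall (ρ : IrrRep A) {ξ : ρ.H} (h : ∀ a, ρ.rep a ξ = 0) : ξ = 0 := by
  let Z : Submodule ℂ ρ.H :=
    { carrier := {η | ∀ c, ρ.rep c η = 0}
      add_mem' := fun {x y} hx hy c => by simp [hx c, hy c]
      zero_mem' := fun c => by simp
      smul_mem' := fun r x hx c => by simp [hx c] }
  have hZc : IsClosed (Z : Set ρ.H) := by
    have : (Z : Set ρ.H) = ⋂ c, {η | ρ.rep c η = 0} := by
      ext η; simp [Z]
    rw [this]
    exact isClosed_iInter fun c => isClosed_eq (by fun_prop) continuous_const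
  have hmem : ξ ∈ Z := h
  rcases ρ.irreducible Z hZc (fun c η hη d => by rw [hη c]; simp) with hZ | hZ
  · rw [hZ] at hmem
    simpa using hmem
  · obtain ⟨c, hc⟩ := ρ.ne_zero
    exact absurd (ContinuousLinearMap.ext fun η => (hZ ▸ trivial : η ∈ Z) c) hc

theorem IrrRep.denseRange_orbit (ρ : IrrRep A) {ξ : ρ.H} (hξ : ξ ≠ 0) :
    DenseRange (ρ.orbit ξ) := by
  let W := (LinearMap.range (ρ.orbit ξ)).topologicalClosure
  have hW : W = ⊥ ∨ W = ⊤ := by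
    refine ρ.irreducible W (Submodule.isClosed_topologicalClosure _) fun a η hη => ?_
    refine map_mem_closure (ρ.rep a).continuous hη ?_
    rintro _ ⟨b, rfl⟩
    exact ⟨a * b, by simp only [orbit_apply, mul_apply]⟩
  rcases hW with hW | hW
  · refine absurd (ρ.eq_zero_of_forall fun a => ?_) hξ
    have : ρ.orbit ξ a ∈ W := Submodule.le_topologicalClosure _ ⟨a, rfl⟩
    rw [hW] at this
    exact (Submodule.mem_bot ℂ).1 this
  · have := Submodule.dense_iff_topologicalClosure_eq_top.2 hW
    rwa [LinearMap.coe_range] at this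

theorem IrrRep.exists_apply_ne_zero (ρ : IrrRep A) {a : A} (ha : ρ.rep a ≠ 0) :
    ∃ ξ, ρ.rep a ξ ≠ 0 := by
  by_contra! h
  exact ha (ContinuousLinearMap.ext h)

theorem IrrRep.apply_star_ne_zero (ρ : IrrRep A) {a : A} (ha : ρ.rep a ≠ 0) :
    ρ.rep (star a) ≠ 0 := by
  rwa [map_star, star_ne_zero]

theorem IrrRep.exists_apply_orbit_ne_zero (ρ : IrrRep A) {E : Type*} [NormedAddCommGroup E]
    [NormedSpace ℂ E] (T : ρ.H →L[ℂ] E) (hT : T ≠ 0) {ξ : ρ.H} (hξ : ξ ≠ 0) :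
    ∃ a, T (ρ.rep a ξ) ≠ 0 := by
  by_contra! h
  refine hT (ContinuousLinearMap.ext fun η => ?_)
  exact congrFun ((ρ.denseRange_orbit hξ).equalizer T.continuous continuous_const (funext h)) η

theorem IrrRep.exists_mul_mul_ne_zero (ρ : IrrRep A) {a b : A} (ha : ρ.rep a ≠ 0)
    (hb : ρ.rep b ≠ 0) : ∃ c, ρ.rep (a * c * b) ≠ 0 := by
  obtain ⟨ξ, hξ⟩ := ρ.exists_apply_ne_zero hb
  obtain ⟨c, hc⟩ := ρ.exists_apply_orbit_ne_zero _ ha hξ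
  refine ⟨c, fun h => hc ?_⟩
  rw [← ρ.mul_apply, ← ρ.mul_apply, h]
  rfl

/-- Matching ρ(a)ξ with ρ'(a)η is isometric between dense orbits, so it extends to a unitary. This
is the uniqueness half of the GNS construction, and the way all equivalences of irreducible
representations are produced here. -/
theorem IrrRep.equiv_of_norm_eq (ρ ρ' : IrrRep A) {ξ : ρ.H} {η : ρ'.H} (hξ : ξ ≠ 0) (hη : η ≠ 0)
    (h : ∀ a, ‖ρ.rep a ξ‖ = ‖ρ'.rep a η‖) : ρ ≈ ρ' := by
  obtain ⟨U, hU⟩ := exists_unitary_of_norm_eq (ρ.orbit ξ) (ρ'.orbit η) (ρ.denseRange_orbit hξ)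
    (ρ'.denseRange_orbit hη) h
  refine ⟨U, fun a ζ => ?_⟩
  refine congrFun ((ρ.denseRange_orbit hξ).equalizer (g := fun ζ => U (ρ.rep a ζ))
    (h := fun ζ => ρ'.rep a (U ζ)) (by fun_prop) (by fun_prop) (funext fun b => ?_)) ζ
  have h1 := hU (a * b)
  have h2 := hU b
  simp only [orbit_apply, mul_apply] at h1 h2
  simp [orbit_apply, h1, h2]

/-- If `y` generates a rank one corner on which two irreducible representations agree, then these
representations are equivalent. -/
theorem IrrRep.equiv_of_corner (ρ ρ' : IrrRep A) (y : A) (s : A → ℂ) (hρ : ρ.rep y ≠ 0)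
    (hρ' : ρ'.rep y ≠ 0) (h : ∀ b, ρ.rep (y * b * y) = s b • ρ.rep y)
    (h' : ∀ b, ρ'.rep (y * b * y) = s b • ρ'.rep y) : ρ ≈ ρ' := by
  have key : ∀ (x : IrrRep A), x.rep y ≠ 0 → (∀ b, x.rep (y * b * y) = s b • x.rep y) →
      ∃ ξ : x.H, ξ ≠ 0 ∧ ∀ a, ((‖x.rep a ξ‖ ^ 2 : ℝ) : ℂ) = s (star y * star a * a) := by
    intro x hx hxs
    -- Taking η in the range of x(y*) gives ⟨ζ, x(y)η⟩ = ‖η‖². Moving all operators onto one side,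
    -- ‖x(a)x(y)η‖² becomes s(y*a*a)‖η‖²; after dividing by ‖η‖ the norms on the orbit depend on s
    -- alone, hence agree for both representations.
    obtain ⟨ζ, hζ⟩ := x.exists_apply_ne_zero (x.apply_star_ne_zero hx)
    set η := x.rep (star y) ζ with hη
    have hη0 : ‖η‖ ≠ 0 := norm_ne_zero_iff.2 hζ
    have h1 : ∀ a, ((‖x.rep a (x.rep y η)‖ ^ 2 : ℝ) : ℂ)
        = s (star y * star a * a) * ((‖η‖ ^ 2 : ℝ) : ℂ) := by
      intro a
      have e1 : x.rep y (x.rep (star y) (x.rep (star a) (x.rep a (x.rep y η))))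
          = s (star y * star a * a) • x.rep y η := by
        rw [← smul_apply, ← hxs]
        simp only [mul_apply]
      rw [Complex.ofReal_pow, Complex.ofReal_pow]
      change ((‖_‖ : ℝ) : ℂ) ^ 2 = _ * ((‖_‖ : ℝ) : ℂ) ^ 2
      rw [← RCLike.ofReal_eq_complex_ofReal, ← inner_self_eq_norm_sq_to_K (𝕜 := ℂ),
        ← inner_self_eq_norm_sq_to_K (𝕜 := ℂ)]
      calc inner ℂ (x.rep a (x.rep y η)) (x.rep a (x.rep y η))
          = inner ℂ ζ (x.rep y (x.rep (star y) (x.rep (star a) (x.rep a (x.rep y η))))) := by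
            rw [← inner_star x y, ← hη, ← inner_conj_symm η, inner_star, inner_star, inner_conj_symm]
        _ = s (star y * star a * a) * inner ℂ η η := by
            rw [e1, inner_smul_right, ← inner_star]
    have h2 : x.rep y η ≠ 0 := by
      intro h0
      have : inner ℂ η η = (0 : ℂ) := by
        conv_lhs => rw [hη, inner_star, ← hη, h0, inner_zero_right]
      exact hζ (inner_self_eq_zero.1 this)
    refine ⟨((‖η‖⁻¹ : ℝ) : ℂ) • x.rep y η, ?_, fun a => ?_⟩
    · exact smul_ne_zero (by simpa using hζ) h2
    · rw [map_smul, norm_smul, mul_pow, Complex.ofReal_mul, h1]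
      rw [Complex.norm_real, norm_inv, norm_norm, mul_comm, mul_assoc, ← Complex.ofReal_mul,
        ← mul_pow, mul_inv_cancel₀ hη0]
      simp
  obtain ⟨ξ, hξ, h1⟩ := key ρ hρ h
  obtain ⟨η, hη, h2⟩ := key ρ' hρ' h'
  refine ρ.equiv_of_norm_eq ρ' hξ hη fun a => ?_
  have h3 : (‖ρ.rep a ξ‖ ^ 2 : ℝ) = ‖ρ'.rep a η‖ ^ 2 := by
    exact_mod_cast (h1 a).trans (h2 a).symm
  exact (sq_eq_sq₀ (norm_nonneg _) (norm_nonneg _)).1 h3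

end Algebraic

/-! ### Finite-dimensional corners and minimal elements -/

section Corner

variable {A : Type u} [NonUnitalCStarAlgebra A] {B : Type*} [NonUnitalCStarAlgebra B]

/-- The linear map `a ↦ θ(t a d)`. -/
def cornerMap (θ : A →⋆ₙₐ[ℂ] B) (t d : A) : A →ₗ[ℂ] B where
  toFun a := θ (t * a * d)
  map_add' a b := by rw [mul_add, add_mul, map_add]
  map_smul' c a := by rw [mul_smul_comm, smul_mul_assoc, map_smul]; rfl

theorem cornerMap_apply (θ : A →⋆ₙₐ[ℂ] B) (t d a : A) : cornerMap θ t d a = θ (t * a * d) := rfl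

/-- Left multiplication by `w - r` with an eigenvalue `r` shrinks a finite-dimensional corner. -/
theorem finrank_cornerMap_lt (θ : A →⋆ₙₐ[ℂ] B) (t d w : A) (r : ℂ)
    [FiniteDimensional ℂ (LinearMap.range (cornerMap θ t d))]
    (hw : ∀ a, ∃ b, w * t * a * d = t * b * d)
    (z : A) (hz : θ (t * z * d) ≠ 0) (hwz : θ (w * t * z * d) = r • θ (t * z * d)) :
    FiniteDimensional ℂ (LinearMap.range (cornerMap θ (w * t - r • t) d)) ∧
    Module.finrank ℂ (LinearMap.range (cornerMap θ (w * t - r • t) d)) <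
      Module.finrank ℂ (LinearMap.range (cornerMap θ t d)) := by
  set X := LinearMap.range (cornerMap θ t d) with hX
  -- Left multiplication by θ(w) - r carries the corner of t onto the corner of wt - rt and kills
  -- the given eigenvector, so rank-nullity gives the strict drop.
  let N : B →ₗ[ℂ] B := LinearMap.mulLeft ℂ (θ w) - r • LinearMap.id
  have hN : ∀ a, cornerMap θ (w * t - r • t) d a = N (cornerMap θ t d a) := by
    intro a
    simp [N, cornerMap_apply, sub_mul, mul_assoc, smul_mul_assoc]
  have hNX : ∀ v ∈ X, N v ∈ X := by
    rintro _ ⟨a, rfl⟩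
    obtain ⟨b, hb⟩ := hw a
    refine ⟨b - r • a, ?_⟩
    rw [← hN, cornerMap_apply, cornerMap_apply, mul_sub, sub_mul, sub_mul, sub_mul, hb]
    simp only [mul_assoc, smul_mul_assoc, mul_smul_comm]
  let N' : X →ₗ[ℂ] X := N.restrict hNX
  have hle : LinearMap.range (cornerMap θ (w * t - r • t) d)
      = (LinearMap.range N').map X.subtype := by
    ext v
    constructor
    · rintro ⟨a, rfl⟩
      exact ⟨N' ⟨cornerMap θ t d a, ⟨a, rfl⟩⟩, ⟨_, rfl⟩, (hN a).symm⟩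
    · rintro ⟨_, ⟨⟨_, a, rfl⟩, rfl⟩, rfl⟩
      exact ⟨a, hN a⟩
  rw [hle]
  refine ⟨inferInstance, ?_⟩
  rw [(Submodule.equivMapOfInjective _ X.injective_subtype _).symm.finrank_eq]
  have hker : LinearMap.ker N' ≠ ⊥ := by
    refine (Submodule.ne_bot_iff _).2 ⟨⟨cornerMap θ t d z, ⟨z, rfl⟩⟩, ?_, ?_⟩
    · rw [LinearMap.mem_ker]
      ext
      change N (cornerMap θ t d z) = 0
      rw [← hN, cornerMap_apply, sub_mul, sub_mul, map_sub, hwz, smul_mul_assoc, smul_mul_assoc, map_smul, sub_self]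
    · exact fun h => hz (congrArg Subtype.val h)
  have := LinearMap.finrank_range_add_finrank_ker N'
  have h2 : 0 < Module.finrank ℂ (LinearMap.ker N') :=
    Module.finrank_pos_iff.2 (Submodule.nontrivial_iff_ne_bot.2 hker)
  omega

/-- A finite-dimensional corner `θ(t A d)` on which an irreducible representation does not vanish
contains an element generating a one-dimensional corner. -/
theorem IrrRep.exists_corner (x : IrrRep A) (θ : A →⋆ₙₐ[ℂ] B)
    (hθ : ∀ a, θ a = 0 → x.rep a = 0) (t d : A) (ht : x.rep t ≠ 0) (hd : x.rep d ≠ 0)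
    (hfin : FiniteDimensional ℂ (LinearMap.range (cornerMap θ t d))) :
    ∃ (y : A) (s : A → ℂ), x.rep y ≠ 0 ∧ ∀ b, θ (y * b * y) = s b • θ y := by
  classical
  -- The right factor d stays fixed and t is chosen with a corner of minimal dimension among those
  -- not killed by x.
  have hex : ∃ n, ∃ t, x.rep t ≠ 0 ∧ FiniteDimensional ℂ (LinearMap.range (cornerMap θ t d)) ∧
      Module.finrank ℂ (LinearMap.range (cornerMap θ t d)) = n := ⟨_, t, ht, hfin, rfl⟩
  clear ht hfin t
  obtain ⟨t, ht, hfin, hn⟩ := Nat.find_spec hex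
  have hmin : ∀ t', x.rep t' ≠ 0 → FiniteDimensional ℂ (LinearMap.range (cornerMap θ t' d)) →
      Module.finrank ℂ (LinearMap.range (cornerMap θ t d))
        ≤ Module.finrank ℂ (LinearMap.range (cornerMap θ t' d)) := fun t' h1 h2 =>
    hn ▸ Nat.find_min' hex ⟨t', h1, h2, rfl⟩
  -- Minimality converts every eigenvector of θ(w) in the corner into an identity in x(A): replacing
  -- t by wt - rt shrinks the corner, so x must kill the new element.
  have hstep : ∀ (w : A) (r : ℂ), (∀ a, ∃ b, w * t * a * d = t * b * d) → ∀ z,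
      θ (t * z * d) ≠ 0 → θ (w * t * z * d) = r • θ (t * z * d) →
      x.rep (w * t - r • t) = 0 := by
    intro w r hw z hz hwz
    by_contra hne
    obtain ⟨h1, h2⟩ := finrank_cornerMap_lt θ t d w r hw z hz hwz
    exact absurd (hmin _ hne h1) (not_le.2 h2)
  set X := LinearMap.range (cornerMap θ t d) with hX
  -- Suppose y = tzd is killed by x but not by θ, and take w = yy*. Self-adjointness makes θ(w)
  -- injective on its own image, so it has a non-zero eigenvalue r there. By `hstep`, x(w)x(t) = r
  -- x(t), which is impossible since x(w) = 0 and x(t) ≠ 0.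
  have hinj : ∀ z, x.rep (t * z * d) = 0 → θ (t * z * d) = 0 := by
    intro z hz
    by_contra hne
    set y := t * z * d with hy
    set w := y * star y with hw
    have hwt : ∀ a, ∃ b, w * t * a * d = t * b * d := fun a =>
      ⟨z * d * star y * t * a, by simp only [hw, hy, mul_assoc]⟩
    let N : B →ₗ[ℂ] B := LinearMap.mulLeft ℂ (θ w)
    have hsq : ∀ v, N (N v) = 0 → N v = 0 := by
      intro v hv
      have h1 : star (N v) * N v = 0 := by
        have : star (N v) * N v = star v * (N (N v)) := by
          simp [N, hw, mul_assoc, map_star]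
        rw [this, hv, mul_zero]
      exact CStarRing.star_mul_self_eq_zero_iff _ |>.1 h1
    let Y : Submodule ℂ B := X.map N
    have hYX : Y ≤ X := by
      rintro _ ⟨_, ⟨a, rfl⟩, rfl⟩
      obtain ⟨b, hb⟩ := hwt a
      refine ⟨b, ?_⟩
      rw [cornerMap_apply, ← hb]
      simp [N, cornerMap_apply, mul_assoc]
    let N' : Y →ₗ[ℂ] Y := N.restrict (fun v hv => ⟨v, hYX hv, rfl⟩)
    have hYne : Nontrivial Y := by
      refine Submodule.nontrivial_iff_ne_bot.2 ((Submodule.ne_bot_iff _).2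
        ⟨N (θ y), ⟨_, ⟨z, rfl⟩, rfl⟩, ?_⟩)
      intro h0
      have h1 : θ y * star (θ y) * (θ y * star (θ y)) = 0 := by
        have := congrArg (· * star (θ y)) h0
        simpa [N, hw, mul_assoc, map_star] using this
      have h2 : star (θ y * star (θ y)) * (θ y * star (θ y)) = 0 := by
        simpa [mul_assoc] using h1
      exact hne (CStarRing.mul_star_self_eq_zero_iff _ |>.1
        (CStarRing.star_mul_self_eq_zero_iff _ |>.1 h2))
    obtain ⟨r, hr⟩ := Module.End.exists_eigenvalue N'
    obtain ⟨⟨v, hvY⟩, hv⟩ := hr.exists_hasEigenvector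
    have hv1 : N v = r • v := congrArg Subtype.val hv.apply_eq_smul
    have hv0 : v ≠ 0 := fun h => hv.2 (Subtype.ext h)
    have hr0 : r ≠ 0 := by
      rintro rfl
      obtain ⟨v', -, rfl⟩ := hvY
      exact hv0 (hsq _ (by rw [hv1, zero_smul]))
    obtain ⟨z', rfl⟩ := hYX hvY
    have h3 := hstep w r hwt z' hv0 (by
      have := hv1
      simp only [N, cornerMap_apply, LinearMap.mulLeft_apply] at this
      rw [← this, ← map_mul]
      simp only [mul_assoc])
    have hxw : x.rep w = 0 := by rw [hw, map_mul, hz, zero_mul]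
    rw [map_sub, map_mul, hxw, zero_mul, zero_sub, neg_eq_zero, map_smul] at h3
    exact (smul_ne_zero hr0 ht) h3
  obtain ⟨z₀, hz₀⟩ := x.exists_mul_mul_ne_zero ht hd
  have hXne : Nontrivial X := Submodule.nontrivial_iff_ne_bot.2 ((Submodule.ne_bot_iff _).2
    ⟨_, ⟨z₀, rfl⟩, fun h => hz₀ (hθ _ h)⟩)
  -- For w = tb the eigenvalue identity x(tbt) = r x(t) is pulled back to the corner by `hinj`:
  -- multiplication by θ(tb) is a scalar there.
  have hscal : ∀ b, ∃ r : ℂ, ∀ z, θ (t * b * t * z * d) = r • θ (t * z * d) := by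
    intro b
    have hwt : ∀ a, ∃ c, t * b * t * a * d = t * c * d := fun a =>
      ⟨b * t * a, by simp only [mul_assoc]⟩
    let N : B →ₗ[ℂ] B := LinearMap.mulLeft ℂ (θ (t * b))
    have hNX : ∀ v ∈ X, N v ∈ X := by
      rintro _ ⟨a, rfl⟩
      obtain ⟨c, hc⟩ := hwt a
      refine ⟨c, ?_⟩
      rw [cornerMap_apply, ← hc]
      simp [N, cornerMap_apply, mul_assoc]
    obtain ⟨r, hr⟩ := Module.End.exists_eigenvalue (N.restrict hNX)
    obtain ⟨⟨_, z', rfl⟩, hv⟩ := hr.exists_hasEigenvector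
    have hv1 : N (cornerMap θ t d z') = r • cornerMap θ t d z' := congrArg Subtype.val hv.apply_eq_smul
    have hv0 : cornerMap θ t d z' ≠ 0 := fun h => hv.2 (Subtype.ext h)
    have h3 := hstep (t * b) r hwt z' hv0 (by
      have := hv1
      simp only [N, cornerMap_apply, LinearMap.mulLeft_apply] at this
      rw [← this, ← map_mul]
      simp only [mul_assoc])
    refine ⟨r, fun z => ?_⟩
    have h4 := hinj (b * t * z - r • z) (by
      have h5 : t * (b * t * z - r • z) * d = (t * b * t - r • t) * (z * d) := by
        simp only [mul_sub, sub_mul, mul_assoc, mul_smul_comm, smul_mul_assoc]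
      rw [h5, map_mul, h3, zero_mul])
    rw [mul_sub, sub_mul, map_sub, sub_eq_zero, mul_smul_comm, smul_mul_assoc, map_smul] at h4
    rw [← h4]
    simp only [mul_assoc]
  choose s hs using hscal
  -- With y = tz₀d, the product yby equals t(z₀db)t·z₀d, to which the scalar action of t(z₀db)
  -- applies.
  refine ⟨t * z₀ * d, fun b => s (z₀ * d * b), hz₀, fun b => ?_⟩
  rw [← hs]
  simp only [mul_assoc]

/-- A finite-dimensional corner of `A` meeting `ρ` separates `ρ` from the rest of the spectrum. -/
theorem IrrRep.exists_isolating_element (ρ : IrrRep A) (t d : A) (ht : ρ.rep t ≠ 0)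
    (hd : ρ.rep d ≠ 0)
    (hfin : FiniteDimensional ℂ (LinearMap.range (cornerMap (NonUnitalStarAlgHom.id ℂ A) t d))) :
    ∃ y, ρ.rep y ≠ 0 ∧ ∀ x : IrrRep A, x.rep y ≠ 0 → ρ ≈ x := by
  obtain ⟨y, s, hy, hs⟩ := ρ.exists_corner (NonUnitalStarAlgHom.id ℂ A)
    (fun a ha => by rw [show a = 0 from ha, map_zero]) t d ht hd hfin
  have hs' : ∀ b, y * b * y = s b • y := hs
  exact ⟨y, hy, fun x hx => ρ.equiv_of_corner x y s hy hx (fun b => by rw [hs', map_smul])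
    (fun b => by rw [hs', map_smul])⟩

/-- Only the image of the corner in ρ(A) is assumed finite-dimensional, so the minimal element is
found with θ = ρ. Its defining relation holds modulo the kernel of ρ and therefore passes to x. -/
theorem IrrRep.equiv_of_ker_le (ρ x : IrrRep A) (h : ρ.ker ≤ x.ker) (t d : A) (ht : x.rep t ≠ 0)
    (hd : x.rep d ≠ 0)
    (hfin : FiniteDimensional ℂ (LinearMap.range (cornerMap ρ.rep t d))) : ρ ≈ x := by
  have h' : ∀ a, ρ.rep a = 0 → x.rep a = 0 := fun a ha =>
    (TwoSidedIdeal.mem_ker _).1 (h ((TwoSidedIdeal.mem_ker _).2 ha))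
  obtain ⟨y, s, hy, hs⟩ := x.exists_corner ρ.rep h' t d ht hd hfin
  refine ρ.equiv_of_corner x y s (fun h0 => hy (h' _ h0)) hy hs fun b => ?_
  rw [← sub_eq_zero, ← map_smul, ← map_sub]
  apply h'
  rw [map_sub, map_smul, hs, sub_self]

end Corner

end IrreducibleRepresentations

/-! ### Ideals of C*-algebras and their irreducible representations -/

section Ideals

variable {A : Type u} [NonUnitalCStarAlgebra A] (J : NonUnitalStarSubalgebra ℂ A)

theorem mul_mem_of_leftIdeal {J : NonUnitalStarSubalgebra ℂ A}
    (hJ : ∀ a : A, ∀ j ∈ J, a * j ∈ J) (a : A) {j : A} (hj : j ∈ J) : j * a ∈ J := by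
  have := star_mem (hJ (star a) (star j) (star_mem hj))
  simpa using this

/-- The restriction of an irreducible representation to an ideal on which it does not vanish. -/
def IrrRep.restrictIdeal (ρ : IrrRep A) (hJ : ∀ a : A, ∀ j ∈ J, a * j ∈ J)
    (h : ∃ j ∈ J, ρ.rep j ≠ 0) : IrrRep J where
  H := ρ.H
  rep := ρ.rep.comp (NonUnitalStarSubalgebraClass.subtype J)
  ne_zero := by
    obtain ⟨j, hj, h⟩ := h
    exact ⟨⟨j, hj⟩, h⟩
  irreducible W hW hinv := by
    rw [or_iff_not_imp_left]
    intro hne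
    obtain ⟨w, hw, hw0⟩ := (Submodule.ne_bot_iff _).1 hne
    obtain ⟨j, hj, hj0⟩ := h
    -- The vector ρ(ja)w is non-zero, so its orbit under A is dense; each ρ(b)ρ(ja)w stays in W
    -- because b(ja) belongs to the ideal.
    obtain ⟨a, ha⟩ := ρ.exists_apply_orbit_ne_zero _ hj0 hw0
    rw [← ρ.mul_apply] at ha
    have hja : j * a ∈ J := mul_mem_of_leftIdeal hJ a hj
    have hd := ρ.denseRange_orbit ha
    refine eq_top_iff.2 fun v _ => ?_
    refine hW.closure_subset_iff.2 ?_ (hd v)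
    rintro _ ⟨b, rfl⟩
    rw [ρ.orbit_apply, ← ρ.mul_apply]
    exact hinv ⟨b * (j * a), hJ b _ hja⟩ w hw

theorem IrrRep.isExtension_restrictIdeal (ρ : IrrRep A) (hJ : ∀ a : A, ∀ j ∈ J, a * j ∈ J)
    (h : ∃ j ∈ J, ρ.rep j ≠ 0) : IsExtension J ρ (ρ.restrictIdeal J hJ h) :=
  ⟨LinearIsometryEquiv.refl ℂ ρ.H, fun _ _ => rfl⟩

theorem IrrRep.exists_ne_zero (ρ : IrrRep A) : ∃ ξ : ρ.H, ξ ≠ 0 := by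
  obtain ⟨a, ha⟩ := ρ.ne_zero
  obtain ⟨ξ, hξ⟩ := ρ.exists_apply_ne_zero ha
  exact ⟨_, hξ⟩

variable {J}

theorem IsExtension.exists_apply_ne_zero {ρ : IrrRep A} {σ : IrrRep J} (h : IsExtension J ρ σ) :
    ∃ j ∈ J, ρ.rep j ≠ 0 := by
  obtain ⟨U, hU⟩ := h
  obtain ⟨j, hj⟩ := σ.ne_zero
  obtain ⟨ξ, hξ⟩ := σ.exists_apply_ne_zero hj
  refine ⟨j, j.2, fun h0 => hξ ?_⟩
  have := hU j ξ
  rw [h0] at this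
  simpa using this

theorem IsExtension.congr_left {ρ ρ' : IrrRep A} {σ : IrrRep J} (h : IsExtension J ρ σ)
    (hρ : ρ ≈ ρ') : IsExtension J ρ' σ := by
  obtain ⟨U, hU⟩ := h
  obtain ⟨W, hW⟩ := hρ
  exact ⟨U.trans W, fun a ξ => by simp [hU, hW]⟩

theorem IsExtension.congr_right {ρ : IrrRep A} {σ σ' : IrrRep J} (h : IsExtension J ρ σ)
    (hσ : σ ≈ σ') : IsExtension J ρ σ' := by
  obtain ⟨U, hU⟩ := h
  obtain ⟨W, hW⟩ := Setoid.symm hσ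
  exact ⟨W.trans U, fun a ξ => by simp [hU, hW]⟩

theorem IsExtension.equiv_right {ρ : IrrRep A} {σ σ' : IrrRep J} (h : IsExtension J ρ σ)
    (h' : IsExtension J ρ σ') : σ ≈ σ' := by
  obtain ⟨U, hU⟩ := h
  obtain ⟨W, hW⟩ := h'
  refine ⟨U.trans W.symm, fun a ξ => ?_⟩
  rw [LinearIsometryEquiv.trans_apply, LinearIsometryEquiv.symm_apply_eq, hU, hW]
  simp

/-- An irreducible representation of an ideal has at most one extension. -/
theorem IsExtension.equiv_left {ρ ρ' : IrrRep A} {σ : IrrRep J}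
    (hJ : ∀ a : A, ∀ j ∈ J, a * j ∈ J) (h : IsExtension J ρ σ)
    (h' : IsExtension J ρ' σ) : ρ ≈ ρ' := by
  obtain ⟨U, hU⟩ := h
  obtain ⟨W, hW⟩ := h'
  obtain ⟨j, hj⟩ := σ.ne_zero
  obtain ⟨ξ, hξ⟩ := σ.exists_apply_ne_zero hj
  -- On a vector of the form σ(j)ξ any extension is forced: a must send it to σ(aj)ξ. Both orbits
  -- thus have the same norms.
  have hρ : ρ.rep (j : A) (U ξ) ≠ 0 := by rw [← hU]; simpa using hξ
  have hρ' : ρ'.rep (j : A) (W ξ) ≠ 0 := by rw [← hW]; simpa using hξ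
  refine ρ.equiv_of_norm_eq ρ' hρ hρ' fun a => ?_
  rw [← ρ.mul_apply, ← ρ'.mul_apply]
  have h1 := hU ⟨a * j, hJ a j j.2⟩ ξ
  have h2 := hW ⟨a * j, hJ a j j.2⟩ ξ
  rw [← h1, ← h2, LinearIsometryEquiv.norm_map, LinearIsometryEquiv.norm_map]

/-- Left multiplication on an ideal. -/
def idealMulLeft (hJ : ∀ a : A, ∀ j ∈ J, a * j ∈ J) (a : A) : J →ₗ[ℂ] J where
  toFun j := ⟨a * j, hJ a j j.2⟩
  map_add' _ _ := Subtype.ext (mul_add _ _ _)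
  map_smul' _ _ := Subtype.ext (mul_smul_comm _ _ _)

/-- With e running through a contractive approximate unit of the ideal, σ(aej) = σ(ae)σ(j) and ‖ae‖
≤ ‖a‖; then pass to the limit. The bound is what makes σ(j)ξ ↦ σ(aj)ξ well defined and continuous
for a outside the ideal. -/
theorem IrrRep.norm_apply_mul_le [IsClosed (J : Set A)] (σ : IrrRep J)
    (hJ : ∀ a : A, ∀ j ∈ J, a * j ∈ J) (a : A) (j : J) (ξ : σ.H) :
    ‖σ.rep (idealMulLeft hJ a j) ξ‖ ≤ ‖a‖ * ‖σ.rep j ξ‖ := by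
  let _ := CStarAlgebra.spectralOrder J
  have _ := CStarAlgebra.spectralOrderedRing J
  have hcont : Continuous σ.rep :=
    AddMonoidHomClass.continuous_of_bound σ.rep 1 fun x => by
      simpa using NonUnitalStarAlgHom.norm_apply_le σ.rep x
  have hu := CStarAlgebra.increasingApproximateUnit J
  have h1 : Filter.Tendsto (fun e : J => e * j) (CStarAlgebra.approximateUnit J) (nhds j) :=
    hu.tendsto_mul_right j
  have hc : Continuous fun x : J => ‖σ.rep (idealMulLeft hJ a x) ξ‖ := by
    have : Continuous (idealMulLeft hJ a) :=
      Continuous.subtype_mk (continuous_const.mul continuous_subtype_val) _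
    have h2 := hcont.comp this
    exact (h2.clm_apply continuous_const).norm
  refine le_of_tendsto ((hc.tendsto j).comp h1) ?_
  filter_upwards [hu.eventually_norm] with e he
  have h3 : idealMulLeft hJ a (e * j) = idealMulLeft hJ a e * j :=
    Subtype.ext (mul_assoc a (e : A) (j : A)).symm
  simp only [Function.comp_apply]
  rw [h3, σ.mul_apply]
  refine (ContinuousLinearMap.le_opNorm _ _).trans ?_
  gcongr
  refine (NonUnitalStarAlgHom.norm_apply_le σ.rep _).trans ?_
  change ‖a * (e : A)‖ ≤ _
  refine (norm_mul_le _ _).trans ?_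
  have : ‖(e : A)‖ ≤ 1 := he
  nlinarith [norm_nonneg a]

/-- Every irreducible representation of a closed ideal extends. -/
theorem IrrRep.exists_isExtension [IsClosed (J : Set A)] (σ : IrrRep J)
    (hJ : ∀ a : A, ∀ j ∈ J, a * j ∈ J) : ∃ ρ : IrrRep A, IsExtension J ρ σ := by
  obtain ⟨ξ, hξ⟩ := σ.exists_ne_zero
  have hd := σ.denseRange_orbit hξ
  -- The operator for a extends σ(j)ξ ↦ σ(aj)ξ from the dense orbit of one fixed vector ξ. All
  -- algebraic identities are then checked on that orbit.
  let ext : A → σ.H →L[ℂ] σ.H := fun a =>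
    ((σ.orbit ξ).comp (idealMulLeft hJ a)).extendOfNorm (σ.orbit ξ)
  have hext : ∀ a j, ext a (σ.rep j ξ) = σ.rep (idealMulLeft hJ a j) ξ := fun a j =>
    LinearMap.extendOfNorm_eq hd ⟨‖a‖, fun j => σ.norm_apply_mul_le hJ a j ξ⟩ j
  have hdext : ∀ {S T : σ.H →L[ℂ] σ.H}, (∀ j, S (σ.rep j ξ) = T (σ.rep j ξ)) → S = T := by
    intro S T h
    exact ContinuousLinearMap.ext fun η =>
      congrFun (hd.equalizer S.continuous T.continuous (funext h)) η
  have hinner : ∀ a η ζ, inner ℂ (ext (star a) η) ζ = inner ℂ η (ext a ζ) := by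
    intro a η ζ
    refine congrFun (hd.equalizer (g := fun η => inner ℂ (ext (star a) η) ζ)
      (h := fun η => inner ℂ η (ext a ζ)) (by fun_prop) (by fun_prop) (funext fun j => ?_)) η
    refine congrFun (hd.equalizer (g := fun ζ => inner ℂ (ext (star a) (σ.orbit ξ j)) ζ)
      (h := fun ζ => inner ℂ (σ.orbit ξ j) (ext a ζ)) (by fun_prop) (by fun_prop)
      (funext fun k => ?_)) ζ
    simp only [Function.comp_apply, σ.orbit_apply, hext]
    rw [← star_star (idealMulLeft hJ (star a) j), σ.inner_star, ← σ.mul_apply,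
      ← star_star j, σ.inner_star, ← σ.mul_apply]
    congr 2
    have : star (idealMulLeft hJ (star a) (star (star j))) * k = star j * idealMulLeft hJ a k :=
      Subtype.ext (by simp [idealMulLeft, mul_assoc])
    rw [this]
  have hσ : ∀ (j : J) (η : σ.H), ext (j : A) η = σ.rep j η := by
    intro j η
    congr 1
    refine hdext fun k => ?_
    rw [hext, ← σ.mul_apply]
    rfl
  let rep : A →⋆ₙₐ[ℂ] (σ.H →L[ℂ] σ.H) :=
    { toFun := ext
      map_smul' := fun c a => hdext fun j => by
        have : idealMulLeft hJ (c • a) j = c • idealMulLeft hJ a j :=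
          Subtype.ext (smul_mul_assoc c a (j : A))
        rw [hext, this]
        simp [hext]
      map_zero' := hdext fun j => by
        have : idealMulLeft hJ 0 j = 0 := Subtype.ext (zero_mul (j : A))
        rw [hext, this]
        simp
      map_add' := fun a b => hdext fun j => by
        have : idealMulLeft hJ (a + b) j = idealMulLeft hJ a j + idealMulLeft hJ b j :=
          Subtype.ext (add_mul a b (j : A))
        rw [hext, this]
        simp [hext]
      map_mul' := fun a b => hdext fun j => by
        have : idealMulLeft hJ (a * b) j = idealMulLeft hJ a (idealMulLeft hJ b j) :=
          Subtype.ext (mul_assoc a b (j : A))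
        rw [hext, this]
        simp [hext]
      map_star' := fun a => by
        rw [ContinuousLinearMap.star_eq_adjoint, ContinuousLinearMap.eq_adjoint_iff]
        exact hinner a }
  refine ⟨{ H := σ.H, rep := rep, ne_zero := ?_, irreducible := fun W hW h => ?_ },
    LinearIsometryEquiv.refl ℂ σ.H, fun j η => (hσ j η).symm⟩
  · obtain ⟨j, hj⟩ := σ.ne_zero
    refine ⟨j, fun h => hj ?_⟩
    ext η
    rw [← hσ]
    exact congrArg (fun T : σ.H →L[ℂ] σ.H => T η) h
  · exact σ.irreducible W hW fun j η hη => (hσ j η) ▸ h j η hη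

end Ideals

/-! ### Functional calculus away from zero, and finite rank from compactness -/

section Truncation

/-- A self-adjoint element is a limit of elements obtained from it by functional calculus with
functions vanishing near `0`. -/
theorem IsSelfAdjoint.exists_truncation {A : Type*} [NonUnitalCStarAlgebra A] {b : A}
    (hb : IsSelfAdjoint b) {ε : ℝ} (hε : 0 < ε) :
    ∃ c g : A, ‖c - b‖ ≤ ε ∧ g * b * c = c ∧ ∀ x, Commute b x → Commute c x := by
  -- The function f is the soft threshold at ε: it vanishes on [-ε, ε] and moves every point by at
  -- most ε. The function g equals 1/t outside that interval, so g(t)·t·f(t) = f(t). Both vanish at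
  -- 0, as the non-unital calculus requires.
  let f : ℝ → ℝ := fun t => t - max (-ε) (min ε t)
  let g : ℝ → ℝ := fun t => t / max (t ^ 2) (ε ^ 2)
  have hpos : ∀ t : ℝ, 0 < max (t ^ 2) (ε ^ 2) := fun t =>
    lt_max_of_lt_right (by positivity)
  have hf : Continuous f := by fun_prop
  have hg : Continuous g := Continuous.div (by fun_prop) (by fun_prop) fun t => (hpos t).ne'
  have hf0 : f 0 = 0 := by simp [f, hε.le]
  have hg0 : g 0 = 0 := by simp [g]
  refine ⟨cfcₙ f b, cfcₙ g b, ?_, ?_, fun x hx => hx.cfcₙ_real f⟩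
  · nth_rw 2 [← cfcₙ_id ℝ b]
    rw [← cfcₙ_sub f id b hf.continuousOn hf0 continuousOn_id rfl]
    refine norm_cfcₙ_le fun t _ => ?_
    simp only [f, id, sub_sub_cancel_left, norm_neg, Real.norm_eq_abs, abs_le]
    exact ⟨le_max_left _ _, max_le (by linarith) (min_le_left _ _)⟩
  · nth_rw 2 [← cfcₙ_id ℝ b]
    rw [← cfcₙ_mul g id b hg.continuousOn hg0 continuousOn_id rfl,
      ← cfcₙ_mul (fun t => g t * id t) f b (hg.mul continuous_id).continuousOn (by simp [hg0])
        hf.continuousOn hf0]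
    congr 1
    ext t
    simp only [f, g, id]
    by_cases ht : |t| ≤ ε
    · rw [abs_le] at ht
      rw [min_eq_right ht.2, max_eq_right ht.1, sub_self, mul_zero]
    · have : ε ^ 2 ≤ t ^ 2 := by
        rw [← sq_abs t]
        exact pow_le_pow_left₀ hε.le (not_le.1 ht).le 2
      have ht0 : t ≠ 0 := by
        rintro rfl
        simp [hε.le] at ht
      rw [max_eq_left this, div_mul_eq_mul_div, ← sq, div_self (pow_ne_zero 2 ht0), one_mul]

/-- If a compact operator fixes the range of `S`, then `S` has finite rank. -/
theorem finiteDimensional_range_of_compact_fixing {H : Type*} [NormedAddCommGroup H]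
    [InnerProductSpace ℂ H] {E : Type*} [AddCommGroup E] [Module ℂ E]
    (T : H →L[ℂ] H) (hT : IsCompactOperator T) (S : E →ₗ[ℂ] H) (h : ∀ x, T (S x) = S x) :
    FiniteDimensional ℂ (LinearMap.range S) := by
  -- On the closed eigenspace of T for the eigenvalue 1 the identity is compact, so by Riesz this
  -- space, which contains the range of S, has finite dimension.
  let F : Submodule ℂ H := LinearMap.ker (T.toLinearMap - LinearMap.id)
  have hF : IsClosed (F : Set H) := (T - ContinuousLinearMap.id ℂ H).isClosed_ker
  have hfix : ∀ v ∈ F, T v = v := fun v hv => by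
    have : T v - v = 0 := hv
    rwa [sub_eq_zero] at this
  have hc := hT.restrict (f := T.toLinearMap) (V := F) (fun v hv => by
    change T v ∈ F
    rwa [hfix v hv]) hF
  have hid : (T.toLinearMap.restrict (p := F) (q := F) (fun v hv => by
    change T v ∈ F
    rwa [hfix v hv]) : F → F) = id := by
    ext v
    exact hfix v v.2
  rw [hid] at hc
  have := FiniteDimensional.of_isCompactOperator_id (𝕜 := ℂ) hc
  refine Submodule.finiteDimensional_of_le (S₂ := F) ?_
  rintro _ ⟨x, rfl⟩
  change T (S x) - S x = 0
  rw [h, sub_self]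

end Truncation

/-! ### Irreducible representations separate points -/

section PureStates

open scoped ComplexOrder

variable {A : Type u} [NonUnitalCStarAlgebra A]

/-- The functional `a ↦ ⟨w, θ(a) w⟩`. -/
def vectorFunctional {H : Type*} [NormedAddCommGroup H] [InnerProductSpace ℂ H] [CompleteSpace H]
    (θ : A →⋆ₙₐ[ℂ] (H →L[ℂ] H)) (w : H) : StrongDual ℂ A :=
  LinearMap.mkContinuous
    { toFun := fun a => inner ℂ w (θ a w)
      map_add' := fun a b => by simp
      map_smul' := fun c a => by simp }
    (‖w‖ ^ 2) (fun a => by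
      refine (norm_inner_le_norm _ _).trans ?_
      have h1 : ‖θ a w‖ ≤ ‖a‖ * ‖w‖ := (ContinuousLinearMap.le_opNorm _ _).trans
        (by gcongr; exact NonUnitalStarAlgHom.norm_apply_le θ a)
      calc ‖w‖ * ‖θ a w‖ ≤ ‖w‖ * (‖a‖ * ‖w‖) := by gcongr
        _ = ‖w‖ ^ 2 * ‖a‖ := by ring)

theorem vectorFunctional_apply {H : Type*} [NormedAddCommGroup H] [InnerProductSpace ℂ H]
    [CompleteSpace H] (θ : A →⋆ₙₐ[ℂ] (H →L[ℂ] H)) (w : H) (a : A) :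
    vectorFunctional θ w a = inner ℂ w (θ a w) := rfl

variable (A) in
/-- Positive functionals of norm at most one. -/
def quasiStates : Set (WeakDual ℂ A) :=
  WeakDual.toStrongDual ⁻¹' Metric.closedBall 0 1 ∩ {φ | ∀ a, 0 ≤ φ (star a * a)}

variable (A) in
-- Banach-Alaoglu. Functionals of norm less than one are kept because, without a unit, the states
-- need not be weak-* closed.
theorem isCompact_quasiStates : IsCompact (quasiStates A) := by
  refine (WeakDual.isCompact_closedBall (0 : StrongDual ℂ A) 1).inter_right ?_
  have : {φ : WeakDual ℂ A | ∀ a, 0 ≤ φ (star a * a)} = ⋂ a, {φ | 0 ≤ φ (star a * a)} := by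
    ext φ; simp
  rw [this]
  exact isClosed_iInter fun a => isClosed_le continuous_const (WeakDual.eval_continuous _)

theorem vectorFunctional_mem_quasiStates {H : Type*} [NormedAddCommGroup H]
    [InnerProductSpace ℂ H] [CompleteSpace H] (θ : A →⋆ₙₐ[ℂ] (H →L[ℂ] H)) {w : H} (hw : ‖w‖ ≤ 1) :
    StrongDual.toWeakDual (vectorFunctional θ w) ∈ quasiStates A := by
  refine ⟨?_, fun a => ?_⟩
  · change vectorFunctional θ w ∈ Metric.closedBall 0 1
    rw [mem_closedBall_zero_iff]
    refine (LinearMap.mkContinuous_norm_le _ (by positivity) _).trans ?_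
    exact pow_le_one₀ (norm_nonneg _) hw
  · change 0 ≤ inner ℂ w (θ (star a * a) w)
    rw [map_mul, map_star, mul_apply_eq_comp, ContinuousLinearMap.star_eq_adjoint,
      ContinuousLinearMap.adjoint_inner_right]
    rw [inner_self_eq_norm_sq_to_K, RCLike.ofReal_eq_complex_ofReal, ← Complex.ofReal_pow]
    exact Complex.zero_le_real.2 (sq_nonneg _)

/-- A quasi-state that is extreme and maximal at `star b * b`. -/
theorem exists_extreme_quasiState (b : A) : ∃ φ ∈ (quasiStates A).extremePoints ℝ,
    ∀ ψ ∈ quasiStates A, (ψ (star b * b)).re ≤ (φ (star b * b)).re := by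
  have hc : Continuous fun φ : WeakDual ℂ A => (φ (star b * b)).re :=
    Complex.continuous_re.comp (WeakDual.eval_continuous _)
  have h0 : (0 : WeakDual ℂ A) ∈ quasiStates A :=
    ⟨by
      rw [Set.mem_preimage, map_zero]
      exact Metric.mem_closedBall_self zero_le_one, fun a => le_refl (0 : ℂ)⟩
  obtain ⟨φ₀, hφ₀, hmax⟩ := (isCompact_quasiStates A).exists_isMaxOn ⟨0, h0⟩ hc.continuousOn
  -- F is the face on which evaluation at b*b is maximal. Krein-Milman gives an extreme point of F,
  -- and it is extreme among all quasi-states: if it lies inside a segment of quasi-states, both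
  -- endpoints must also attain the maximum, hence lie in F.
  let F : Set (WeakDual ℂ A) :=
    quasiStates A ∩ {φ | (φ₀ (star b * b)).re ≤ (φ (star b * b)).re}
  have hF : IsCompact F :=
    (isCompact_quasiStates A).inter_right (isClosed_le continuous_const hc)
  have : LocallyConvexSpace ℝ (WeakDual ℂ A) :=
    inferInstanceAs (LocallyConvexSpace ℝ (WeakBilin (topDualPairing ℂ A)))
  obtain ⟨φ, hφ⟩ := hF.extremePoints_nonempty ⟨φ₀, hφ₀, le_refl (φ₀ (star b * b)).re⟩
  rw [mem_extremePoints] at hφ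
  have hle : ∀ ψ ∈ quasiStates A, (ψ (star b * b)).re ≤ (φ (star b * b)).re := fun ψ hψ =>
    (hmax hψ).trans hφ.1.2
  refine ⟨φ, mem_extremePoints.2 ⟨hφ.1.1, fun ψ₁ h₁ ψ₂ h₂ hs => ?_⟩, hle⟩
  have hs' := hs
  obtain ⟨s, t, hs0, ht0, hst, rfl⟩ := hs'
  have hval : ((s • ψ₁ + t • ψ₂) (star b * b)).re
      = s * (ψ₁ (star b * b)).re + t * (ψ₂ (star b * b)).re := by
    change (s • ψ₁ (star b * b) + t • ψ₂ (star b * b)).re = _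
    simp
  have e1 := hle ψ₁ h₁
  have e2 := hle ψ₂ h₂
  have e0 := hφ.1.2
  rw [Set.mem_ofPred_eq] at e0
  have hm1 := hmax h₁
  have hm2 := hmax h₂
  simp only [Set.mem_ofPred_eq] at hm1 hm2
  rw [hval] at e0 e1 e2
  have hM : s * (φ₀ (star b * b)).re + t * (φ₀ (star b * b)).re = (φ₀ (star b * b)).re := by
    rw [← add_mul, hst, one_mul]
  refine hφ.2 ψ₁ ⟨h₁, ?_⟩ ψ₂ ⟨h₂, ?_⟩ hs <;> rw [Set.mem_ofPred_eq] <;>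
    refine not_lt.1 fun h => ?_
  · linarith [mul_lt_mul_of_pos_left h hs0, mul_le_mul_of_nonneg_left hm2 ht0.le]
  · linarith [mul_lt_mul_of_pos_left h ht0, mul_le_mul_of_nonneg_left hm1 hs0.le]

/-- The GNS representation of a contractive positive functional, with its cyclic vector. -/
theorem exists_cyclic_representation [PartialOrder A] [StarOrderedRing A] (f : A →ₚ[ℂ] ℂ)
    (hnorm : ∀ a, ‖f a‖ ≤ ‖a‖) :
    ∃ (H : Type u) (_ : NormedAddCommGroup H) (_ : InnerProductSpace ℂ H)
      (_ : CompleteSpace H) (θ : A →⋆ₙₐ[ℂ] (H →L[ℂ] H)) (ξ : H), ‖ξ‖ ≤ 1 ∧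
      (DenseRange fun a => θ a ξ) ∧ ∀ a, f a = inner ℂ ξ (θ a ξ) := by
  let ι : A →ₗ[ℂ] f.GNS :=
    (UniformSpace.Completion.toComplₗᵢ (𝕜 := ℂ) (E := f.PreGNS)).toLinearMap.comp
      f.toPreGNS.toLinearMap
  have hι : DenseRange ι :=
    (UniformSpace.Completion.denseRange_coe (α := f.PreGNS)).comp
      f.toPreGNS.surjective.denseRange (UniformSpace.Completion.continuous_coe _)
  have hin : ∀ a b, inner ℂ (ι a) (ι b) = f (star a * b) := fun a b =>
    UniformSpace.Completion.inner_coe _ _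
  have hmul : ∀ a b, f.gnsNonUnitalStarAlgHom a (ι b) = ι (a * b) := fun a b =>
    f.gnsNonUnitalStarAlgHom_apply_coe
  -- By Cauchy-Schwarz applied to f(ea) = ⟨e*, a⟩ along an approximate unit, f is bounded for the
  -- GNS norm.
  have hb : ∀ a, ‖f a‖ ≤ 1 * ‖ι a‖ := by
    intro a
    have hu := CStarAlgebra.increasingApproximateUnit A
    have hφc : Continuous f :=
      AddMonoidHomClass.continuous_of_bound f 1 fun x => by simpa using hnorm x
    refine le_of_tendsto ((hφc.tendsto a).norm.comp (hu.tendsto_mul_right a)) ?_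
    filter_upwards [hu.eventually_norm] with e he
    have h1 : f (e * a) = inner ℂ (ι (star e)) (ι a) := by rw [hin, star_star]
    have h2 : ‖ι (star e)‖ ≤ 1 := by
      have h3 : ‖ι (star e)‖ ^ 2 ≤ 1 := by
        rw [← inner_self_eq_norm_sq (𝕜 := ℂ), hin, star_star]
        refine (Complex.re_le_norm _).trans ((hnorm _).trans ?_)
        refine (norm_mul_le _ _).trans ?_
        rw [norm_star]
        exact mul_le_one₀ he (norm_nonneg _) he
      exact (sq_le_one_iff₀ (norm_nonneg _)).1 h3
    simp only [Function.comp_apply]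
    rw [h1]
    refine (norm_inner_le_norm _ _).trans ?_
    gcongr
  let g : StrongDual ℂ f.GNS := (f : A →ₗ[ℂ] ℂ).extendOfNorm ι
  have hg : ∀ a, g (ι a) = f a := fun a =>
    LinearMap.extendOfNorm_eq hι ⟨1, hb⟩ a
  have hg1 : ‖g‖ ≤ 1 := ContinuousLinearMap.opNorm_le_bound _ zero_le_one
    (LinearMap.norm_extendOfNorm_apply_le hι 1 hb)
  -- The Riesz vector of this bounded functional replaces the class of the missing unit.
  let ξ : f.GNS := (InnerProductSpace.toDual ℂ f.GNS).symm g
  have hξ : ∀ a, inner ℂ ξ (ι a) = f a := fun a => by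
    rw [← hg a]
    exact InnerProductSpace.toDual_symm_apply
  have hcyc : ∀ a, f.gnsNonUnitalStarAlgHom a ξ = ι a := by
    intro a
    refine ext_inner_left ℂ fun v => ?_
    refine congrFun (hι.equalizer (g := fun v => inner ℂ v (f.gnsNonUnitalStarAlgHom a ξ))
      (h := fun v => inner ℂ v (ι a)) (by fun_prop) (by fun_prop) (funext fun b => ?_)) v
    simp only [Function.comp_apply]
    rw [← star_star a, map_star f.gnsNonUnitalStarAlgHom, ContinuousLinearMap.star_eq_adjoint,
      ContinuousLinearMap.adjoint_inner_right, hmul, ← inner_conj_symm, hξ, star_star, ← hin,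
      inner_conj_symm]
  refine ⟨f.GNS, inferInstance, inferInstance, inferInstance, f.gnsNonUnitalStarAlgHom, ξ, ?_, ?_,
    fun a => ?_⟩
  · rw [LinearIsometryEquiv.norm_map]
    exact hg1
  · simpa only [hcyc] using hι
  · rw [hcyc, hξ]

/-- The GNS representation of a quasi-state, with its cyclic vector. -/
theorem exists_cyclic_representation_of_quasiState {φ : WeakDual ℂ A} (hφ : φ ∈ quasiStates A) :
    ∃ (H : Type u) (_ : NormedAddCommGroup H) (_ : InnerProductSpace ℂ H)
      (_ : CompleteSpace H) (θ : A →⋆ₙₐ[ℂ] (H →L[ℂ] H)) (ξ : H), ‖ξ‖ ≤ 1 ∧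
      (DenseRange fun a => θ a ξ) ∧ ∀ a, φ a = inner ℂ ξ (θ a ξ) := by
  let _ := CStarAlgebra.spectralOrder A
  have _ := CStarAlgebra.spectralOrderedRing A
  have hpos : ∀ x : A, 0 ≤ x → 0 ≤ (WeakDual.toStrongDual φ).toLinearMap x := fun x hx => by
    obtain ⟨s, rfl⟩ := CStarAlgebra.nonneg_iff_eq_star_mul_self.1 hx
    exact hφ.2 s
  refine exists_cyclic_representation
    (PositiveLinearMap.mk₀ (WeakDual.toStrongDual φ).toLinearMap hpos) fun a => ?_
  have h1 : ‖WeakDual.toStrongDual φ‖ ≤ 1 := mem_closedBall_zero_iff.1 hφ.1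
  refine ((WeakDual.toStrongDual φ).le_opNorm a).trans ?_
  exact mul_le_of_le_one_left (norm_nonneg _) h1

/-- The cyclic representation of an extreme quasi-state is irreducible. -/
theorem irreducible_of_extreme {H : Type*} [NormedAddCommGroup H] [InnerProductSpace ℂ H]
    [CompleteSpace H] (θ : A →⋆ₙₐ[ℂ] (H →L[ℂ] H)) {ξ : H} (hξ : ‖ξ‖ ≤ 1)
    (hd : DenseRange fun a => θ a ξ)
    (hext : StrongDual.toWeakDual (vectorFunctional θ ξ) ∈ (quasiStates A).extremePoints ℝ)
    (W : Submodule ℂ H) (hW : IsClosed (W : Set H)) (hinv : ∀ a, ∀ η ∈ W, θ a η ∈ W) :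
    W = ⊥ ∨ W = ⊤ := by
  have : CompleteSpace W := hW.completeSpace_coe
  have hstar : ∀ a x y, inner ℂ x (θ a y) = inner ℂ (θ (star a) x) y := fun a x y => by
    rw [map_star, ContinuousLinearMap.star_eq_adjoint, ContinuousLinearMap.adjoint_inner_left]
  have hinv' : ∀ a, ∀ η ∈ Wᗮ, θ a η ∈ Wᗮ := fun a η hη w hw => by
    rw [hstar]
    exact hη _ (hinv _ _ hw)
  -- Split ξ along W and its orthogonal complement, both invariant. If neither part vanishes, the
  -- vector functional of ξ is the sum of those of u and v, which contradicts extremality.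
  set u : H := W.starProjection ξ with hu
  set v : H := ξ - u with hv
  have huW : u ∈ W := Submodule.starProjection_apply_mem _ _
  have hvW : v ∈ Wᗮ := Submodule.sub_starProjection_mem_orthogonal _
  have huv : ξ = u + v := by rw [hv]; abel
  have hi1 : ∀ a, inner ℂ u (θ a v) = 0 := fun a => hinv' a v hvW u huW
  have hi2 : ∀ a, inner ℂ v (θ a u) = 0 := fun a =>
    Submodule.inner_left_of_mem_orthogonal (hinv a u huW) hvW
  by_cases hu0 : u = 0
  · left
    rw [Submodule.eq_bot_iff]
    intro w hw
    have hξv : ξ = v := by rw [huv, hu0, zero_add]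
    refine (inner_self_eq_zero (𝕜 := ℂ)).1 (congrFun (hd.equalizer (g := fun x => inner ℂ w x)
      (h := fun _ => (0 : ℂ)) (by fun_prop) continuous_const (funext fun a => ?_)) w)
    exact hinv' a ξ (hξv ▸ hvW) w hw
  by_cases hv0 : v = 0
  · right
    have hξu : ξ = u := by rw [huv, hv0, add_zero]
    refine eq_top_iff.2 fun x _ => hW.closure_subset_iff.2 ?_ (hd x)
    rintro _ ⟨a, rfl⟩
    exact hinv a ξ (hξu ▸ huW)
  exfalso
  have hnu : 0 < ‖u‖ := norm_pos_iff.2 hu0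
  have hnv : 0 < ‖v‖ := norm_pos_iff.2 hv0
  have hpyth : ‖u‖ ^ 2 + ‖v‖ ^ 2 ≤ 1 := by
    have h1 := norm_add_sq_eq_norm_sq_add_norm_sq_of_inner_eq_zero u v
      (show inner ℂ u v = (0 : ℂ) from hvW u huW)
    rw [← huv] at h1
    nlinarith [norm_nonneg ξ]
  set t := ‖u‖ ^ 2 with ht
  have ht0 : 0 < t := by positivity
  have hs0 : 0 < 1 - t := by nlinarith
  set p : H := ((‖u‖⁻¹ : ℝ) : ℂ) • u with hp
  -- The normalisation is by √(1 - t) and not by ‖v‖, since only ‖ξ‖ ≤ 1 is known: the weights t and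
  -- 1 - t must sum to 1, and q needs only norm at most 1.
  set q : H := (((√(1 - t))⁻¹ : ℝ) : ℂ) • v with hq
  have hp1 : ‖p‖ ≤ 1 := by
    rw [hp, norm_smul, Complex.norm_real, norm_inv, norm_norm, inv_mul_cancel₀ hnu.ne']
  have hq1 : ‖q‖ ≤ 1 := by
    rw [hq, norm_smul, Complex.norm_real, norm_inv, Real.norm_of_nonneg (Real.sqrt_nonneg _),
      inv_mul_le_one₀ (Real.sqrt_pos.2 hs0)]
    exact Real.le_sqrt_of_sq_le (by linarith)
  have hval : ∀ (r : ℝ) (x : H) (a : A), vectorFunctional θ ((r : ℂ) • x) a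
      = ((r ^ 2 : ℝ) : ℂ) * inner ℂ x (θ a x) := by
    intro r x a
    rw [vectorFunctional_apply, map_smul, inner_smul_left, inner_smul_right, Complex.conj_ofReal]
    push_cast
    ring
  have hseg : StrongDual.toWeakDual (vectorFunctional θ ξ) ∈ openSegment ℝ
      (StrongDual.toWeakDual (vectorFunctional θ p))
      (StrongDual.toWeakDual (vectorFunctional θ q)) := by
    refine ⟨t, 1 - t, ht0, hs0, by ring, ?_⟩
    refine DFunLike.ext _ _ fun a => ?_
    change t • vectorFunctional θ p a + (1 - t) • vectorFunctional θ q a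
      = vectorFunctional θ ξ a
    rw [hp, hq, hval, hval, vectorFunctional_apply, Complex.real_smul, Complex.real_smul,
      ← mul_assoc, ← mul_assoc, ← Complex.ofReal_mul, ← Complex.ofReal_mul, inv_pow, inv_pow,
      Real.sq_sqrt hs0.le, ← ht, mul_inv_cancel₀ ht0.ne', mul_inv_cancel₀ hs0.ne']
    conv_rhs => rw [huv, map_add, inner_add_left, inner_add_right, inner_add_right, hi1, hi2]
    simp
  have heq := ((mem_extremePoints.1 hext).2 _ (vectorFunctional_mem_quasiStates θ hp1) _
    (vectorFunctional_mem_quasiStates θ hq1) hseg).1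
  -- Extremality equates the functionals of p and ξ. As ξ is cyclic this gives u = tξ, and pairing
  -- with v, which is orthogonal to u, leaves t‖v‖² = 0.
  have heq' : ∀ a, inner ℂ u (θ a ξ) = (t : ℂ) * inner ℂ ξ (θ a ξ) := by
    intro a
    have h1 : vectorFunctional θ p a = vectorFunctional θ ξ a :=
      congrArg (fun ψ : WeakDual ℂ A => ψ a) heq
    rw [hp, hval, vectorFunctional_apply] at h1
    rw [← h1, ← mul_assoc, ← Complex.ofReal_mul, inv_pow, ← ht, mul_inv_cancel₀ ht0.ne',
      Complex.ofReal_one, one_mul]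
    conv_lhs => rw [huv, map_add, inner_add_right, hi1, add_zero]
  have h2 : u - (t : ℂ) • ξ = 0 := by
    refine (inner_self_eq_zero (𝕜 := ℂ)).1 (congrFun (hd.equalizer
      (g := fun x => inner ℂ (u - (t : ℂ) • ξ) x)
      (h := fun _ => (0 : ℂ)) (by fun_prop) continuous_const (funext fun a => ?_)) _)
    simp only [Function.comp_apply]
    rw [inner_sub_left, inner_smul_left, heq', Complex.conj_ofReal, sub_self]
  have h3 : inner ℂ v (u - (t : ℂ) • ξ) = (0 : ℂ) := by rw [h2, inner_zero_right]
  rw [inner_sub_right, inner_smul_right, huv, inner_add_right,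
    Submodule.inner_left_of_mem_orthogonal huW hvW, zero_add, zero_sub, neg_eq_zero,
    mul_eq_zero, inner_self_eq_zero] at h3
  rcases h3 with h3 | h3
  · exact ht0.ne' (by exact_mod_cast h3)
  · exact hv0 h3

/-- An element that is non-zero in some representation is non-zero in an irreducible one. -/
theorem exists_irrRep_apply_ne_zero {H : Type*} [NormedAddCommGroup H] [InnerProductSpace ℂ H]
    [CompleteSpace H] (θ : A →⋆ₙₐ[ℂ] (H →L[ℂ] H)) {b : A} (hb : θ b ≠ 0) :
    ∃ x : IrrRep A, x.rep b ≠ 0 := by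
  obtain ⟨φ, hφ, hmax⟩ := exists_extreme_quasiState b
  -- A unit vector not killed by θ(b) gives a quasi-state that is positive at b*b, and φ dominates
  -- it there.
  have hpos : 0 < (φ (star b * b)).re := by
    obtain ⟨w, hw⟩ : ∃ w, θ b w ≠ 0 := by
      by_contra! h
      exact hb (ContinuousLinearMap.ext h)
    have hw0 : ‖w‖ ≠ 0 := fun h => hw (by rw [norm_eq_zero.1 h, map_zero])
    set w' : H := ((‖w‖⁻¹ : ℝ) : ℂ) • w with hw'
    have hw1 : ‖w'‖ ≤ 1 := by
      rw [hw', norm_smul, Complex.norm_real, norm_inv, norm_norm, inv_mul_cancel₀ hw0]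
    refine lt_of_lt_of_le ?_ (hmax _ (vectorFunctional_mem_quasiStates θ hw1))
    change 0 < (inner ℂ w' (θ (star b * b) w')).re
    rw [map_mul, map_star, mul_apply_eq_comp, ContinuousLinearMap.star_eq_adjoint,
      ContinuousLinearMap.adjoint_inner_right]
    have h1 := inner_self_eq_norm_sq (𝕜 := ℂ) (θ b w')
    change (inner ℂ (θ b w') (θ b w')).re = _ at h1
    rw [h1]
    have : θ b w' ≠ 0 := by
      rw [hw', map_smul]
      exact smul_ne_zero (by simpa using hw0) hw
    positivity
  obtain ⟨H', _, _, _, θ', ξ, hξ, hd, hval⟩ :=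
    exists_cyclic_representation_of_quasiState hφ.1
  have hφξ : φ = StrongDual.toWeakDual (vectorFunctional θ' ξ) := DFunLike.ext _ _ hval
  have hne : θ' b ≠ 0 := by
    intro h0
    rw [hval, map_mul, h0, mul_zero] at hpos
    simp at hpos
  have hirr := irreducible_of_extreme θ' hξ hd (hφξ ▸ hφ)
  exact ⟨{ H := H', rep := θ', ne_zero := ⟨b, hne⟩, irreducible := hirr }, hne⟩

end PureStates

/-! ### Unitary representations of compact groups -/

/-! ### Vector-valued integrals and integrated forms -/

section Integration

/-- The quotient map by the closed subspace is bounded, so it commutes with the integral, and it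
kills the integrand. -/
theorem integral_mem_of_isClosed {X E : Type*} [MeasurableSpace X] {μ : Measure X}
    [NormedAddCommGroup E] [NormedSpace ℂ E] [CompleteSpace E] (S : Submodule ℂ E)
    (hS : IsClosed (S : Set E)) {f : X → E} (hf : Integrable f μ) (h : ∀ x, f x ∈ S) :
    ∫ x, f x ∂μ ∈ S := by
  have : IsClosed (S : Set E) := hS
  have h1 : S.mkQL (∫ x, f x ∂μ) = ∫ x, S.mkQL (f x) ∂μ := (S.mkQL.integral_comp_comm hf).symm
  have h2 : ∀ x, S.mkQL (f x) = 0 := fun x => (Submodule.Quotient.mk_eq_zero S).2 (h x)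
  simp only [h2, integral_zero] at h1
  exact (Submodule.Quotient.mk_eq_zero S).1 h1

theorem inner_integral_right {X E : Type*} [MeasurableSpace X] {μ : Measure X}
    [NormedAddCommGroup E] [InnerProductSpace ℂ E] [CompleteSpace E] {f : X → E}
    (hf : Integrable f μ) (c : E) : inner ℂ c (∫ x, f x ∂μ) = ∫ x, inner ℂ c (f x) ∂μ :=
  ((innerSL ℂ c).integral_comp_comm hf).symm

theorem inner_integral_left {X E : Type*} [MeasurableSpace X] {μ : Measure X}
    [NormedAddCommGroup E] [InnerProductSpace ℂ E] [CompleteSpace E] {f : X → E}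
    (hf : Integrable f μ) (c : E) : inner ℂ (∫ x, f x ∂μ) c = ∫ x, inner ℂ (f x) c ∂μ := by
  rw [← inner_conj_symm, inner_integral_right hf, ← integral_conj]
  simp only [inner_conj_symm]

namespace UnitaryRep

variable {G : Type*} [Group G] [TopologicalSpace G]
  {H : Type*} [NormedAddCommGroup H] [InnerProductSpace ℂ H]

theorem map_mul_apply (π : UnitaryRep G H) (g h : G) (ξ : H) :
    π.toHom (g * h) ξ = π.toHom g (π.toHom h ξ) := by
  rw [map_mul]; rfl

theorem map_one_apply (π : UnitaryRep G H) (ξ : H) : π.toHom 1 ξ = ξ := by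
  rw [map_one]; rfl

theorem map_inv_map (π : UnitaryRep G H) (g : G) (ξ : H) :
    π.toHom g⁻¹ (π.toHom g ξ) = ξ := by
  rw [← map_mul_apply, inv_mul_cancel, map_one_apply]

theorem inner_map_left (π : UnitaryRep G H) (g : G) (ξ η : H) :
    inner ℂ (π.toHom g ξ) η = inner ℂ ξ (π.toHom g⁻¹ η) := by
  rw [← LinearIsometryEquiv.inner_map_map (π.toHom g⁻¹), map_inv_map]

variable [MeasurableSpace G] [BorelSpace G] [CompleteSpace H]
variable (μ : Measure G) [IsFiniteMeasureOnCompacts μ]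

theorem integrated_apply (π : UnitaryRep G H) (f : C_c(G, ℂ)) (ξ : H) :
    π.integrated μ f ξ = ∫ g, f g • π.toHom g ξ ∂μ := rfl

/-- The integrated form is linear in the function. -/
def integratedₗ (π : UnitaryRep G H) : C_c(G, ℂ) →ₗ[ℂ] (H →L[ℂ] H) where
  toFun := π.integrated μ
  map_add' f g := by
    ext ξ
    simp only [integrated_apply, CompactlySupportedContinuousMap.add_apply, add_smul, add_apply]
    exact integral_add (π.integrable_smul μ f ξ) (π.integrable_smul μ g ξ)
  map_smul' c f := by
    ext ξ
    simp only [integrated_apply, CompactlySupportedContinuousMap.smul_apply, smul_assoc,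
      smul_apply, RingHom.id_apply]
    exact integral_smul _ _

theorem integratedₗ_apply (π : UnitaryRep G H) (f : C_c(G, ℂ)) :
    π.integratedₗ μ f = π.integrated μ f := rfl

theorem inner_integrated_left [IsTopologicalGroup G] [μ.IsInvInvariant] (π : UnitaryRep G H)
    (f f' : C_c(G, ℂ)) (hf : ∀ g, f' g = starRingEnd ℂ (f g⁻¹)) (ξ η : H) :
    inner ℂ (π.integrated μ f ξ) η = inner ℂ ξ (π.integrated μ f' η) := by
  rw [integrated_apply, integrated_apply, inner_integral_left (π.integrable_smul μ f ξ),
    inner_integral_right (π.integrable_smul μ f' η)]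
  rw [← integral_inv_eq_self _ μ]
  refine integral_congr_ae (Filter.Eventually.of_forall fun g => ?_)
  simp only [inner_smul_left, inner_smul_right, hf, inner_map_left, inv_inv]

/-- A bounded operator intertwining two representations intertwines the integrated forms. -/
theorem map_integrated {H' : Type*} [NormedAddCommGroup H'] [InnerProductSpace ℂ H']
    [CompleteSpace H'] (π : UnitaryRep G H) (π' : UnitaryRep G H') (T : H →L[ℂ] H')
    (hT : ∀ g ξ, T (π.toHom g ξ) = π'.toHom g (T ξ)) (f : C_c(G, ℂ)) (ξ : H) :
    T (π.integrated μ f ξ) = π'.integrated μ f (T ξ) := by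
  rw [integrated_apply, integrated_apply, ← T.integral_comp_comm (π.integrable_smul μ f ξ)]
  simp only [map_smul, hT]

/-- The representation on an invariant subspace. -/
def subrep {G : Type*} [Group G] [TopologicalSpace G] {H : Type*} [NormedAddCommGroup H]
    [InnerProductSpace ℂ H] (π : UnitaryRep G H) (W : Submodule ℂ H)
    (hW : ∀ g, ∀ ξ ∈ W, π.toHom g ξ ∈ W) : UnitaryRep G W where
  toHom :=
    { toFun := fun g =>
        { (π.toHom g).toLinearEquiv.toLinearMap.restrict (hW g) with
          invFun := fun ξ => ⟨π.toHom g⁻¹ ξ, hW g⁻¹ ξ ξ.2⟩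
          left_inv := fun ξ => by
            ext
            change π.toHom g⁻¹ (π.toHom g ξ) = ξ
            rw [map_inv]
            exact (π.toHom g).symm_apply_apply _
          right_inv := fun ξ => by
            ext
            change π.toHom g (π.toHom g⁻¹ ξ) = ξ
            rw [map_inv]
            exact (π.toHom g).apply_symm_apply _
          norm_map' := fun ξ => (π.toHom g).norm_map ξ }
      map_one' := by
        ext ξ
        change π.toHom 1 (ξ : H) = ξ
        rw [map_one]
        rfl
      map_mul' := fun g h => by
        ext ξ
        change π.toHom (g * h) (ξ : H) = π.toHom g (π.toHom h ξ)
        rw [map_mul]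
        rfl }
  strongly_continuous ξ := (π.strongly_continuous (ξ : H)).subtype_mk _

end UnitaryRep

end Integration

/-! ### Representative functions and multiplicities: the Peter-Weyl theorem in operator form -/

section CompactGroup

variable {K : Type u} [Group K] [TopologicalSpace K] [CompactSpace K]

/-- The matrix coefficient `k ↦ ⟨τ(k) v, w⟩`. -/
def matrixCoeff {V : Type*} [NormedAddCommGroup V] [InnerProductSpace ℂ V] (τ : UnitaryRep K V)
    (v w : V) : C_c(K, ℂ) where
  toFun k := inner ℂ (τ.toHom k v) w
  continuous_toFun := (τ.strongly_continuous v).inner continuous_const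
  hasCompactSupport' := HasCompactSupport.of_compactSpace _

theorem matrixCoeff_apply {V : Type*} [NormedAddCommGroup V] [InnerProductSpace ℂ V]
    (τ : UnitaryRep K V) (v w : V) (k : K) : matrixCoeff τ v w k = inner ℂ (τ.toHom k v) w := rfl

theorem matrixCoeff_swap {V : Type*} [NormedAddCommGroup V] [InnerProductSpace ℂ V]
    (τ : UnitaryRep K V) (v w : V) (k : K) :
    matrixCoeff τ w v k = starRingEnd ℂ (matrixCoeff τ v w k⁻¹) := by
  rw [matrixCoeff_apply, matrixCoeff_apply, inner_conj_symm, UnitaryRep.inner_map_left]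

/-- Functions that are matrix coefficients of finite-dimensional unitary representations. -/
def IsRepresentative (φ : C_c(K, ℂ)) : Prop :=
  ∃ (V : Type u) (_ : NormedAddCommGroup V) (_ : InnerProductSpace ℂ V)
    (_ : FiniteDimensional ℂ V) (τ : UnitaryRep K V) (v w : V), φ = matrixCoeff τ v w

/-- Exchanging the two vectors of a matrix coefficient gives the function whose integrated form is
the adjoint operator, so adjoints never leave the class. -/
theorem IsRepresentative.exists_adjoint {φ : C_c(K, ℂ)} (h : IsRepresentative φ) :
    ∃ φ' : C_c(K, ℂ), IsRepresentative φ' ∧ ∀ k, φ' k = starRingEnd ℂ (φ k⁻¹) := by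
  obtain ⟨V, _, _, _, τ, v, w, rfl⟩ := h
  exact ⟨matrixCoeff τ w v, ⟨V, _, _, inferInstance, τ, w, v, rfl⟩, matrixCoeff_swap τ v w⟩

variable [IsTopologicalGroup K] [MeasurableSpace K] [BorelSpace K] (ν : Measure K)
  [ν.IsHaarMeasure]
variable {H : Type u} [NormedAddCommGroup H] [InnerProductSpace ℂ H] [CompleteSpace H]

/-- The average `∫ |π(k) ξ⟩⟨π(k) ξ| dk`. -/
def orbitOperator (π : UnitaryRep K H) (ξ : H) : H →L[ℂ] H :=
  ∫ k, InnerProductSpace.rankOne ℂ (π.toHom k ξ) (π.toHom k ξ) ∂ν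

theorem continuous_rankOne_orbit (π : UnitaryRep K H) (ξ : H) : Continuous fun k =>
    InnerProductSpace.rankOne ℂ (π.toHom k ξ) (π.toHom k ξ) := by
  have h := π.strongly_continuous ξ
  exact (ContinuousLinearMap.smulRightL ℂ H H).continuous₂.comp
    (((innerSL ℂ).continuous.comp h).prodMk h)

theorem integrable_rankOne_orbit (π : UnitaryRep K H) (ξ : H) : Integrable (fun k =>
    InnerProductSpace.rankOne ℂ (π.toHom k ξ) (π.toHom k ξ)) ν :=
  (continuous_rankOne_orbit π ξ).integrable_of_hasCompactSupport (HasCompactSupport.of_compactSpace _)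

theorem orbitOperator_apply (π : UnitaryRep K H) (ξ η : H) :
    orbitOperator ν π ξ η = ∫ k, inner ℂ (π.toHom k ξ) η • π.toHom k ξ ∂ν := by
  rw [orbitOperator, ContinuousLinearMap.integral_apply (integrable_rankOne_orbit ν π ξ)]
  rfl

theorem integrable_inner_smul_orbit (π : UnitaryRep K H) (ξ η : H) :
    Integrable (fun k => inner ℂ (π.toHom k ξ) η • π.toHom k ξ) ν :=
  (((π.strongly_continuous ξ).inner continuous_const).smul
    (π.strongly_continuous ξ)).integrable_of_hasCompactSupport (HasCompactSupport.of_compactSpace _)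

/-- The integrand is a norm-continuous family of rank one operators, and compact operators form a
closed subspace. -/
theorem isCompactOperator_orbitOperator (π : UnitaryRep K H) (ξ : H) :
    IsCompactOperator (orbitOperator ν π ξ) := by
  have h := integral_mem_of_isClosed (compactOperator (RingHom.id ℂ) H H)
    isClosed_setOfPred_isCompactOperator (integrable_rankOne_orbit ν π ξ) fun k => by
      change IsCompactOperator _
      rw [InnerProductSpace.rankOne_def']
      have h1 : IsCompactOperator (ContinuousLinearMap.toSpanSingleton ℂ (π.toHom k ξ)) :=
        isCompactOperator_of_locallyCompactSpace_rng _
      exact h1.comp_clm (innerSL ℂ (π.toHom k ξ))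
  exact h

theorem isSelfAdjoint_orbitOperator (π : UnitaryRep K H) (ξ : H) :
    IsSelfAdjoint (orbitOperator ν π ξ) := by
  rw [ContinuousLinearMap.isSelfAdjoint_iff_isSymmetric]
  intro x y
  change inner ℂ (orbitOperator ν π ξ x) y = inner ℂ x (orbitOperator ν π ξ y)
  rw [orbitOperator_apply, orbitOperator_apply,
    inner_integral_left (integrable_inner_smul_orbit ν π ξ x),
    inner_integral_right (integrable_inner_smul_orbit ν π ξ y)]
  refine integral_congr_ae (Filter.Eventually.of_forall fun k => ?_)
  simp only [inner_smul_left, inner_smul_right, inner_conj_symm]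
  ring

theorem orbitOperator_map (π : UnitaryRep K H) (ξ η : H) (h : K) :
    orbitOperator ν π ξ (π.toHom h η) = π.toHom h (orbitOperator ν π ξ η) := by
  rw [orbitOperator_apply, orbitOperator_apply]
  have h1 := (π.toHom h).toContinuousLinearEquiv.toContinuousLinearMap.integral_comp_comm
    (integrable_inner_smul_orbit ν π ξ η)
  refine Eq.trans ?_ h1
  rw [← integral_mul_left_eq_self _ h]
  refine integral_congr_ae (Filter.Eventually.of_forall fun k => ?_)
  change inner ℂ (π.toHom (h * k) ξ) (π.toHom h η) • π.toHom (h * k) ξ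
    = π.toHom h (inner ℂ (π.toHom k ξ) η • π.toHom k ξ)
  rw [map_smul, π.map_mul_apply, LinearIsometryEquiv.inner_map_map]

theorem integral_norm_inner_sq_pos (π : UnitaryRep K H) {ξ : H} (hξ : ξ ≠ 0) :
    0 < ∫ k, ‖inner ℂ (π.toHom k ξ) ξ‖ ^ 2 ∂ν := by
  have hc : Continuous fun k => ‖inner ℂ (π.toHom k ξ) ξ‖ ^ 2 :=
    ((π.strongly_continuous ξ).inner continuous_const).norm.pow 2
  refine hc.integral_pos_of_hasCompactSupport_nonneg_nonzero (HasCompactSupport.of_compactSpace _)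
    (fun k => by positivity) (x := 1) ?_
  simpa [π.map_one_apply] using hξ

theorem inner_orbitOperator_self (π : UnitaryRep K H) (ξ : H) :
    inner ℂ ξ (orbitOperator ν π ξ ξ) = ((∫ k, ‖inner ℂ (π.toHom k ξ) ξ‖ ^ 2 ∂ν : ℝ) : ℂ) := by
  rw [orbitOperator_apply, inner_integral_right (integrable_inner_smul_orbit ν π ξ ξ),
    ← integral_complex_ofReal]
  refine integral_congr_ae (Filter.Eventually.of_forall fun k => ?_)
  simp only [inner_smul_right]
  rw [← inner_conj_symm ξ, Complex.mul_conj, Complex.normSq_eq_norm_sq]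

/-- Representative functions act non-trivially on every non-zero vector. -/
theorem exists_isRepresentative_apply_ne_zero (π : UnitaryRep K H) {η : H} (hη : η ≠ 0) :
    ∃ φ, IsRepresentative φ ∧ π.integrated ν φ η ≠ 0 := by
  set T := orbitOperator ν π η with hT
  have hTη : T η ≠ 0 := by
    intro h0
    have h1 := inner_orbitOperator_self ν π η
    rw [← hT, h0, inner_zero_right] at h1
    exact (integral_norm_inner_sq_pos ν π hη).ne (by exact_mod_cast h1)
  -- Truncating the compact operator T near 0 yields a finite rank operator that still commutes with
  -- K. The tolerance is chosen so that cη differs from Tη by at most half of ‖Tη‖, hence is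
  -- non-zero.
  obtain ⟨c, g, hc, hgc, hcomm⟩ := (isSelfAdjoint_orbitOperator ν π η).exists_truncation
    (ε := ‖T η‖ / (2 * ‖η‖)) (by
      have := norm_pos_iff.2 hη
      have := norm_pos_iff.2 hTη
      positivity)
  have hcη : c η ≠ 0 := by
    intro h0
    have h1 : ‖(c - T) η‖ ≤ ‖T η‖ / (2 * ‖η‖) * ‖η‖ := (c - T).le_of_opNorm_le hc η
    have h2 : ‖T η‖ / (2 * ‖η‖) * ‖η‖ = ‖T η‖ / 2 := by
      have := (norm_pos_iff.2 hη).ne'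
      field_simp
    have h3 := norm_pos_iff.2 hTη
    rw [h2, sub_apply, h0, zero_sub, norm_neg] at h1
    linarith
  have hfin : FiniteDimensional ℂ (LinearMap.range c.toLinearMap) :=
    finiteDimensional_range_of_compact_fixing (g * T)
      ((isCompactOperator_orbitOperator ν π η).clm_comp g) c.toLinearMap fun x =>
        congrArg (fun S : H →L[ℂ] H => S x) hgc
  have hcπ : ∀ k ξ, c (π.toHom k ξ) = π.toHom k (c ξ) := by
    intro k ξ
    have h1 := hcomm (π.toHom k).toContinuousLinearEquiv.toContinuousLinearMap (by
      ext x
      exact orbitOperator_map ν π η x k)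
    exact congrArg (fun S : H →L[ℂ] H => S ξ) h1
  let V := LinearMap.range c.toLinearMap
  have hV : ∀ k, ∀ ξ ∈ V, π.toHom k ξ ∈ V := by
    rintro k _ ⟨ξ, rfl⟩
    exact ⟨π.toHom k ξ, hcπ k ξ⟩
  let v : V := ⟨c η, η, rfl⟩
  -- For φ the diagonal coefficient of v = cη, the vector cπ(φ)η = π(φ)cη is the orbit operator of
  -- cη applied to cη, whose inner product with cη is ∫ |⟨π(k)cη, cη⟩|² > 0.
  refine ⟨matrixCoeff (π.subrep V hV) v v, ⟨V, _, _, hfin, _, v, v, rfl⟩, fun h0 => ?_⟩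
  have h1 := π.map_integrated ν π c hcπ (matrixCoeff (π.subrep V hV) v v) η
  rw [h0, map_zero] at h1
  have h2 := inner_orbitOperator_self ν π (c η)
  have h3 : orbitOperator ν π (c η) (c η)
      = π.integrated ν (matrixCoeff (π.subrep V hV) v v) (c η) := by
    rw [orbitOperator_apply, π.integrated_apply ν]
    rfl
  rw [h3, ← h1, inner_zero_right] at h2
  exact (integral_norm_inner_sq_pos ν π hcη).ne (by exact_mod_cast h2)

/-- Multiplicities are finite if representative functions act by finite rank operators. -/
theorem finiteDimensional_intertwiners_of_irreducible (π : UnitaryRep K H)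
    (hπ : ∀ φ, IsRepresentative φ → FiniteDimensional ℂ (LinearMap.range (π.integrated ν φ).toLinearMap))
    {V : Type u} [NormedAddCommGroup V] [InnerProductSpace ℂ V] [CompleteSpace V]
    (τ : UnitaryRep K V) (hτ : τ.IsIrreducible) :
    FiniteDimensional ℂ (τ.intertwiners π) := by
  obtain ⟨hn, hirr⟩ := hτ
  obtain ⟨w, hw⟩ := exists_ne (0 : V)
  obtain ⟨φ, hφ, hφw⟩ := exists_isRepresentative_apply_ne_zero ν τ hw
  have := hπ φ hφ
  -- An intertwiner T is determined by its value at the non-zero vector τ(φ)w, because its kernel is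
  -- a closed invariant subspace. That value is π(φ)Tw, which lies in a fixed finite-dimensional
  -- space.
  let ev : τ.intertwiners π →ₗ[ℂ] LinearMap.range (π.integrated ν φ).toLinearMap :=
    { toFun := fun T => ⟨(T : V →L[ℂ] H) (τ.integrated ν φ w), (T : V →L[ℂ] H) w,
        (τ.map_integrated ν π T T.2 φ w).symm⟩
      map_add' := fun S T => rfl
      map_smul' := fun c T => rfl }
  refine FiniteDimensional.of_injective ev ((injective_iff_map_eq_zero ev).2 fun T hT => ?_)
  have hT' : (T : V →L[ℂ] H) (τ.integrated ν φ w) = 0 := congrArg Subtype.val hT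
  rcases hirr (LinearMap.ker (T : V →L[ℂ] H).toLinearMap) (T : V →L[ℂ] H).isClosed_ker
    (fun k ξ hξ => by
      change (T : V →L[ℂ] H) _ = 0
      rw [T.2 k ξ, show (T : V →L[ℂ] H) ξ = 0 from hξ, map_zero]) with h | h
  · have : τ.integrated ν φ w ∈ LinearMap.ker (T : V →L[ℂ] H).toLinearMap := hT'
    rw [h] at this
    exact absurd ((Submodule.mem_bot ℂ).1 this) hφw
  · ext x
    have : x ∈ LinearMap.ker (T : V →L[ℂ] H).toLinearMap := h ▸ trivial
    exact this

/-- Finiteness of multiplicities passes from irreducible to finite-dimensional representations. -/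
theorem finiteDimensional_intertwiners_of_finite (π : UnitaryRep K H)
    (hπ : ∀ (V : Type u) [NormedAddCommGroup V] [InnerProductSpace ℂ V] [CompleteSpace V]
      (τ : UnitaryRep K V), τ.IsIrreducible → FiniteDimensional ℂ (τ.intertwiners π)) (n : ℕ) :
    ∀ (V : Type u) [NormedAddCommGroup V] [InnerProductSpace ℂ V] [FiniteDimensional ℂ V]
      (τ : UnitaryRep K V), Module.finrank ℂ V = n → FiniteDimensional ℂ (τ.intertwiners π) := by
  induction n using Nat.strong_induction_on with
  | _ n ih =>
    intro V _ _ _ τ hn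
    have : CompleteSpace V := FiniteDimensional.complete ℂ V
    by_cases hτ : τ.IsIrreducible
    · exact hπ V τ hτ
    rcases subsingleton_or_nontrivial V with hs | hs
    · have : Subsingleton (τ.intertwiners π) := ⟨fun S T => by
        ext x
        rw [Subsingleton.elim x 0, map_zero, map_zero]⟩
      infer_instance
    obtain ⟨W, hW, hW1, hW2⟩ : ∃ W : Submodule ℂ V, (∀ k, ∀ ξ ∈ W, τ.toHom k ξ ∈ W) ∧ W ≠ ⊥ ∧
        W ≠ ⊤ := by
      by_contra! h
      exact hτ ⟨hs, fun W _ hW => or_iff_not_imp_left.2 (h W hW)⟩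
    have hW' : ∀ k, ∀ ξ ∈ Wᗮ, τ.toHom k ξ ∈ Wᗮ := fun k ξ hξ w hw => by
      rw [← inner_conj_symm, τ.inner_map_left, inner_conj_symm]
      exact hξ _ (hW _ _ hw)
    have hsum := W.finrank_add_finrank_orthogonal
    have hlt : Module.finrank ℂ W < n := hn ▸ Submodule.finrank_lt hW2
    have hpos : 0 < Module.finrank ℂ W :=
      Module.finrank_pos_iff.2 (Submodule.nontrivial_iff_ne_bot.2 hW1)
    have h1 := ih _ hlt W (τ.subrep W hW) rfl
    have h2 := ih _ (show Module.finrank ℂ Wᗮ < n by omega) Wᗮ (τ.subrep Wᗮ hW') rfl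
    let res : τ.intertwiners π →ₗ[ℂ]
        ((τ.subrep W hW).intertwiners π × (τ.subrep Wᗮ hW').intertwiners π) :=
      { toFun := fun T => (⟨(T : V →L[ℂ] H).comp W.subtypeL, fun k ξ => T.2 k ξ⟩,
          ⟨(T : V →L[ℂ] H).comp Wᗮ.subtypeL, fun k ξ => T.2 k ξ⟩)
        map_add' := fun S T => rfl
        map_smul' := fun c T => rfl }
    refine FiniteDimensional.of_injective res ((injective_iff_map_eq_zero res).2 fun T hT => ?_)
    ext x
    obtain ⟨y, hy, z, hz, rfl⟩ := W.exists_add_mem_mem_orthogonal x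
    have e1 : (T : V →L[ℂ] H) y = 0 := congrArg
      (fun p => (p.1 : W →L[ℂ] H) ⟨y, hy⟩) hT
    have e2 : (T : V →L[ℂ] H) z = 0 := congrArg
      (fun p => (p.2 : Wᗮ →L[ℂ] H) ⟨z, hz⟩) hT
    rw [map_add, e1, e2, add_zero]
    rfl

/-- For a finite-dimensional `V`, the vector `π(⟨τ(·) v, w⟩) ξ` is the image of `w` under an
intertwiner. -/
theorem finiteDimensional_range_integrated (π : UnitaryRep K H)
    (hπ : ∀ (V : Type u) [NormedAddCommGroup V] [InnerProductSpace ℂ V] [CompleteSpace V]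
      (τ : UnitaryRep K V), τ.IsIrreducible → FiniteDimensional ℂ (τ.intertwiners π))
    {φ : C_c(K, ℂ)} (hφ : IsRepresentative φ) :
    FiniteDimensional ℂ (LinearMap.range (π.integrated ν φ).toLinearMap) := by
  obtain ⟨V, _, _, _, τ, v, w, rfl⟩ := hφ
  have := finiteDimensional_intertwiners_of_finite π hπ _ V τ rfl
  let ev : τ.intertwiners π →ₗ[ℂ] H :=
    { toFun := fun T => (T : V →L[ℂ] H) w
      map_add' := fun S T => rfl
      map_smul' := fun c T => rfl }
  refine Submodule.finiteDimensional_of_le (S₂ := LinearMap.range ev) ?_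
  rintro _ ⟨ξ, rfl⟩
  let T : V →ₗ[ℂ] H :=
    { toFun := fun w => π.integrated ν (matrixCoeff τ v w) ξ
      map_add' := fun w w' => by
        have : matrixCoeff τ v (w + w') = matrixCoeff τ v w + matrixCoeff τ v w' := by
          ext k
          simp [matrixCoeff_apply]
        rw [this, ← π.integratedₗ_apply ν, map_add]
        rfl
      map_smul' := fun c w => by
        have : matrixCoeff τ v (c • w) = c • matrixCoeff τ v w := by
          ext k
          simp [matrixCoeff_apply]
        rw [this, ← π.integratedₗ_apply ν, map_smul]
        rfl }
  refine ⟨⟨LinearMap.toContinuousLinearMap T, fun k w => ?_⟩, rfl⟩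
  change π.integrated ν (matrixCoeff τ v (τ.toHom k w)) ξ
    = π.toHom k (π.integrated ν (matrixCoeff τ v w) ξ)
  rw [π.integrated_apply ν, π.integrated_apply ν]
  have h1 := (π.toHom k).toContinuousLinearEquiv.toContinuousLinearMap.integral_comp_comm
    (π.integrable_smul ν (matrixCoeff τ v w) ξ)
  refine Eq.trans ?_ h1
  rw [← integral_mul_left_eq_self _ k]
  refine integral_congr_ae (Filter.Eventually.of_forall fun h => ?_)
  change inner ℂ (τ.toHom (k * h) v) (τ.toHom k w) • π.toHom (k * h) ξ
    = π.toHom k (inner ℂ (τ.toHom h v) w • π.toHom h ξ)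
  rw [map_smul, π.map_mul_apply, τ.map_mul_apply, LinearIsometryEquiv.inner_map_map]

end CompactGroup

/-! ### Haar measures invariant under inversion -/

section Haar

variable {G : Type*} [Group G] [TopologicalSpace G] [IsTopologicalGroup G] [LocallyCompactSpace G]
  [MeasurableSpace G] [BorelSpace G]

/-- The image of μ under inversion is left invariant because μ is right invariant, so it is cμ.
Inverting twice gives c² = 1. -/
theorem isInvInvariant_of_isMulRightInvariant (μ : Measure G) [μ.IsHaarMeasure] [μ.Regular]
    [μ.IsMulRightInvariant] : μ.IsInvInvariant := by
  constructor
  let c : ℝ≥0∞ := Measure.haarScalarFactor μ.inv μ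
  have hc : μ.inv = c • μ := Measure.isMulLeftInvariant_eq_smul_of_regular μ.inv μ
  have h1 : Measure.map Inv.inv (Measure.map Inv.inv μ) = c ^ 2 • μ := by
    rw [← Measure.inv_def μ, hc, Measure.map_smul, ← Measure.inv_def μ, hc, smul_smul, pow_two]
  have μeq : μ = c ^ 2 • μ := by
    rw [Measure.map_map continuous_inv.measurable continuous_inv.measurable] at h1
    have h2 : ((fun a : G => a⁻¹) ∘ fun a => a⁻¹) = id := by
      ext x
      simp
    rwa [h2, Measure.map_id] at h1
  have S : TopologicalSpace.PositiveCompacts G := Classical.arbitrary _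
  have h2 : c ^ 2 * μ S = 1 ^ 2 * μ S := by
    conv_rhs => rw [μeq]
    simp
  have h3 : c ^ 2 = 1 ^ 2 :=
    (ENNReal.mul_left_inj (Measure.measure_pos_of_nonempty_interior _ S.interior_nonempty).ne'
          S.isCompact.measure_lt_top.ne).1 h2
  have h4 : c = 1 := (ENNReal.pow_right_strictMono two_ne_zero).injective h3
  rw [hc, h4, one_smul]

/-- A right translate is a multiple of ν with the same finite, non-zero total mass. -/
theorem isMulRightInvariant_of_compactSpace [CompactSpace G] (ν : Measure G) [ν.IsHaarMeasure] :
    ν.IsMulRightInvariant := by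
  constructor
  intro g
  have h := Measure.isMulLeftInvariant_eq_smul_of_regular (ν.map (· * g)) ν
  have h1 : (ν.map (· * g)) Set.univ = ν Set.univ := by
    rw [Measure.map_apply (continuous_mul_const g).measurable MeasurableSet.univ, Set.preimage_univ]
  have hc : (Measure.haarScalarFactor (ν.map (· * g)) ν : ℝ≥0∞) * ν Set.univ
      = 1 * ν Set.univ := by
    rw [one_mul, ← h1]
    conv_rhs => rw [h]
    rw [Measure.smul_apply, h1]
    rfl
  have h2 := (ENNReal.mul_left_inj (NeZero.ne _) (measure_ne_top _ _)).1 hc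
  rw [h, ENNReal.coe_eq_one.1 h2, one_smul]

theorem isInvInvariant_of_compactSpace [CompactSpace G] (ν : Measure G) [ν.IsHaarMeasure] :
    ν.IsInvInvariant :=
  have := isMulRightInvariant_of_compactSpace ν
  isInvInvariant_of_isMulRightInvariant ν

end Haar

/-! ### Translates of compactly supported functions -/

section Translates

/-- Composition of a compactly supported function with a homeomorphism. -/
def CompactlySupportedContinuousMap.compHomeomorph {X Y : Type*} [TopologicalSpace X]
    [TopologicalSpace Y] (f : C_c(Y, ℂ)) (e : X ≃ₜ Y) : C_c(X, ℂ) where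
  toFun x := f (e x)
  continuous_toFun := f.continuous.comp e.continuous
  hasCompactSupport' := f.hasCompactSupport.comp_homeomorph e

variable {G : Type*} [Group G] [TopologicalSpace G] [IsTopologicalGroup G]

/-- The function `x ↦ f(g⁻¹ x)`. -/
def lTrans (g : G) (f : C_c(G, ℂ)) : C_c(G, ℂ) := f.compHomeomorph (Homeomorph.mulLeft g⁻¹)

/-- The function `x ↦ f(x g)`. -/
def rTrans (g : G) (f : C_c(G, ℂ)) : C_c(G, ℂ) := f.compHomeomorph (Homeomorph.mulRight g)

/-- The function `x ↦ f(x⁻¹)`. -/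
def invFn (f : C_c(G, ℂ)) : C_c(G, ℂ) := f.compHomeomorph (Homeomorph.inv G)

/-- The function `x ↦ conj f(x⁻¹)`. -/
def adjFn (f : C_c(G, ℂ)) : C_c(G, ℂ) := star (invFn f)

theorem lTrans_apply (g : G) (f : C_c(G, ℂ)) (x : G) : lTrans g f x = f (g⁻¹ * x) := rfl

theorem rTrans_apply (g : G) (f : C_c(G, ℂ)) (x : G) : rTrans g f x = f (x * g) := rfl

theorem invFn_apply (f : C_c(G, ℂ)) (x : G) : invFn f x = f x⁻¹ := rfl

theorem adjFn_apply (f : C_c(G, ℂ)) (x : G) : adjFn f x = starRingEnd ℂ (f x⁻¹) := rfl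

theorem invFn_invFn (f : C_c(G, ℂ)) : invFn (invFn f) = f := by
  ext x
  simp [invFn_apply]

variable [MeasurableSpace G] [BorelSpace G] (μ : Measure G) [μ.IsHaarMeasure]

namespace UnitaryRep

variable {H : Type*} [NormedAddCommGroup H] [InnerProductSpace ℂ H] [CompleteSpace H]

theorem integrated_lTrans (π : UnitaryRep G H) (g : G) (f : C_c(G, ℂ)) (ξ : H) :
    π.integrated μ (lTrans g f) ξ = π.toHom g (π.integrated μ f ξ) := by
  have h1 := (π.toHom g).toContinuousLinearEquiv.toContinuousLinearMap.integral_comp_comm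
    (π.integrable_smul μ f ξ)
  rw [integrated_apply]
  refine Eq.trans ?_ h1
  rw [← integral_mul_left_eq_self _ g]
  refine integral_congr_ae (Filter.Eventually.of_forall fun x => ?_)
  change lTrans g f (g * x) • π.toHom (g * x) ξ = π.toHom g (f x • π.toHom x ξ)
  rw [lTrans_apply, inv_mul_cancel_left, map_smul, map_mul_apply]

theorem integrated_rTrans [μ.IsMulRightInvariant] (π : UnitaryRep G H) (g : G) (f : C_c(G, ℂ))
    (ξ : H) : π.integrated μ (rTrans g f) ξ = π.integrated μ f (π.toHom g⁻¹ ξ) := by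
  rw [integrated_apply, integrated_apply,
    ← integral_mul_right_eq_self (fun x => f x • π.toHom x (π.toHom g⁻¹ ξ)) g]
  refine integral_congr_ae (Filter.Eventually.of_forall fun x => ?_)
  simp only [rTrans_apply, ← map_mul_apply, mul_inv_cancel_right]

theorem norm_integrated_le (π : UnitaryRep G H) (f : C_c(G, ℂ)) :
    ‖π.integrated μ f‖ ≤ ∫ g, ‖f g‖ ∂μ :=
  LinearMap.mkContinuous_norm_le _ (integral_nonneg fun _ => norm_nonneg _) _

theorem star_integrated [μ.IsInvInvariant] (π : UnitaryRep G H) (f : C_c(G, ℂ)) :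
    star (π.integrated μ f) = π.integrated μ (adjFn f) := by
  rw [ContinuousLinearMap.star_eq_adjoint, eq_comm, ContinuousLinearMap.eq_adjoint_iff]
  intro ξ η
  exact π.inner_integrated_left μ _ _ (fun g => by simp [adjFn_apply]) ξ η

open scoped Pointwise in
-- The representation itself is only strongly continuous. Norm continuity comes from ‖π(f)‖ ≤ ‖f‖₁
-- and continuity of translation in L¹; for g in a compact neighbourhood the translates have support
-- in one compact set.
theorem continuous_integrated_lTrans [LocallyCompactSpace G] [T2Space G] (π : UnitaryRep G H)
    (f : C_c(G, ℂ)) : Continuous fun g => π.integrated μ (lTrans g f) := by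
  refine continuous_iff_continuousAt.2 fun g₀ => ?_
  obtain ⟨s, hs, hsg⟩ := exists_compact_mem_nhds g₀
  have hk : IsCompact (s * tsupport f) := hs.mul f.hasCompactSupport
  have hz : ∀ g ∈ s, ∀ x, x ∉ s * tsupport f → f (g⁻¹ * x) = 0 := fun g hg x hx => by
    by_contra h
    exact hx ⟨g, hg, g⁻¹ * x, subset_tsupport _ h, by simp⟩
  have hc : ContinuousOn (fun g => ∫ x, ‖f (g⁻¹ * x) - f (g₀⁻¹ * x)‖ ∂μ) s := by
    refine continuousOn_integral_of_compact_support hk (Continuous.continuousOn ?_) ?_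
    · have := f.continuous
      change Continuous fun p : G × G => ‖f (p.1⁻¹ * p.2) - f (g₀⁻¹ * p.2)‖
      fun_prop
    · intro g x hg hx
      rw [hz g hg x hx, hz g₀ (mem_of_mem_nhds hsg) x hx, sub_zero, norm_zero]
  have h0 : Filter.Tendsto (fun g => ∫ x, ‖f (g⁻¹ * x) - f (g₀⁻¹ * x)‖ ∂μ) (nhds g₀) (nhds 0) := by
    have := (hc.continuousAt hsg).tendsto
    simpa using this
  refine tendsto_iff_norm_sub_tendsto_zero.2 (squeeze_zero (fun _ => norm_nonneg _) (fun g => ?_) h0)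
  change ‖π.integratedₗ μ (lTrans g f) - π.integratedₗ μ (lTrans g₀ f)‖ ≤ _
  rw [← map_sub]
  exact norm_integrated_le μ π _

/-- Integrated forms act non-trivially on non-zero vectors. -/
theorem exists_integrated_apply_ne_zero [LocallyCompactSpace G] [T2Space G] (π : UnitaryRep G H)
    {η : H} (hη : η ≠ 0) : ∃ f : C_c(G, ℂ), π.integrated μ f η ≠ 0 := by
  obtain ⟨h, h1, hcs, hI⟩ : ∃ h : C(G, ℝ), h 1 = 1 ∧ HasCompactSupport h ∧ ∀ x, 0 ≤ h x := by
    obtain ⟨h, h1, -, h2, h3⟩ := exists_continuous_one_zero_of_isCompact (X := G)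
      (isCompact_singleton (x := 1)) isClosed_empty (by simp)
    exact ⟨h, h1 rfl, h2, fun x => (h3 x).1⟩
  have hc : Continuous fun g => inner ℂ (π.toHom g η) η :=
    (π.strongly_continuous η).inner continuous_const
  -- Cutting off the diagonal coefficient of η by a bump function h makes ⟨η, π(f)η⟩ the integral of
  -- h|⟨π(g)η, η⟩|², which is positive since the integrand is non-zero at the identity.
  let f : C_c(G, ℂ) :=
    { toFun := fun g => (h g : ℂ) * inner ℂ (π.toHom g η) η
      continuous_toFun := (Complex.continuous_ofReal.comp h.continuous).mul hc
      hasCompactSupport' := (hcs.comp_left (g := Complex.ofReal) rfl).mul_right }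
  refine ⟨f, fun h0 => ?_⟩
  have e1 : inner ℂ η (π.integrated μ f η)
      = ((∫ g, h g * ‖inner ℂ (π.toHom g η) η‖ ^ 2 ∂μ : ℝ) : ℂ) := by
    rw [integrated_apply, inner_integral_right (π.integrable_smul μ f η), ← integral_complex_ofReal]
    refine integral_congr_ae (Filter.Eventually.of_forall fun g => ?_)
    change inner ℂ η (((h g : ℂ) * inner ℂ (π.toHom g η) η) • π.toHom g η) = _
    rw [inner_smul_right, ← inner_conj_symm η, mul_assoc, Complex.mul_conj,
      Complex.normSq_eq_norm_sq]
    push_cast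
    rfl
  have hpos : 0 < ∫ g, h g * ‖inner ℂ (π.toHom g η) η‖ ^ 2 ∂μ :=
    (h.continuous.mul (hc.norm.pow 2)).integral_pos_of_hasCompactSupport_nonneg_nonzero
      hcs.mul_right (fun g => mul_nonneg (hI g) (by positivity)) (x := 1)
      (by simpa [π.map_one_apply, h1] using hη)
  rw [h0, inner_zero_right] at e1
  exact hpos.ne (by exact_mod_cast e1)

end UnitaryRep

end Translates

/-! ### The group acts on the reduced C*-algebra by multipliers -/

/-- A uniformly contractive family of linear maps is pointwise continuous on a closed set. -/
theorem continuous_apply_of_mem_closure {X E F : Type*} [TopologicalSpace X]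
    [NormedAddCommGroup E] [NormedSpace ℂ E] [NormedAddCommGroup F] [NormedSpace ℂ F]
    (T : X → E →ₗ[ℂ] F) (hT : ∀ x e, ‖T x e‖ ≤ ‖e‖) {S : Set E}
    (hS : ∀ e ∈ S, Continuous fun x => T x e) {e : E} (he : e ∈ closure S) :
    Continuous fun x => T x e := by
  refine continuous_of_uniform_approx_of_continuous fun u hu => ?_
  obtain ⟨ε, hε, hεu⟩ := Metric.mem_uniformity_dist.1 hu
  obtain ⟨e', he', hd⟩ := Metric.mem_closure_iff.1 he ε hε
  refine ⟨fun x => T x e', hS e' he', fun x => hεu ?_⟩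
  rw [dist_eq_norm, ← map_sub]
  exact (hT x _).trans_lt (by rwa [← dist_eq_norm])

theorem continuous_starHom {A B : Type*} [NonUnitalCStarAlgebra A] [NonUnitalCStarAlgebra B]
    (θ : A →⋆ₙₐ[ℂ] B) : Continuous θ :=
  AddMonoidHomClass.continuous_of_bound θ 1 fun a => by
    rw [one_mul]
    exact NonUnitalStarAlgHom.norm_apply_le θ a

/-- A `*`-homomorphism of C*-algebras as a bounded linear map. -/
def starHomCLM {A B : Type*} [NonUnitalCStarAlgebra A] [NonUnitalCStarAlgebra B]
    (θ : A →⋆ₙₐ[ℂ] B) : A →L[ℂ] B where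
  toFun := θ
  map_add' := map_add θ
  map_smul' := map_smul θ
  cont := continuous_starHom θ

namespace UnitaryRep

variable {G : Type*} [Group G] [TopologicalSpace G]
  {H : Type*} [NormedAddCommGroup H] [InnerProductSpace ℂ H]

/-- The unitary `π(g)` as a bounded operator. -/
def toCLM (π : UnitaryRep G H) (g : G) : H →L[ℂ] H :=
  (π.toHom g).toContinuousLinearEquiv.toContinuousLinearMap

theorem toCLM_apply (π : UnitaryRep G H) (g : G) (ξ : H) : π.toCLM g ξ = π.toHom g ξ := rfl

theorem norm_toCLM_mul_le (π : UnitaryRep G H) (g : G) (a : H →L[ℂ] H) :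
    ‖π.toCLM g * a‖ ≤ ‖a‖ := by
  refine ContinuousLinearMap.opNorm_le_bound _ (norm_nonneg _) fun ξ => ?_
  refine Eq.trans_le ?_ (a.le_opNorm ξ)
  exact (π.toHom g).norm_map _

theorem star_toCLM [CompleteSpace H] (π : UnitaryRep G H) (g : G) :
    star (π.toCLM g) = π.toCLM g⁻¹ := by
  rw [ContinuousLinearMap.star_eq_adjoint, eq_comm, ContinuousLinearMap.eq_adjoint_iff]
  intro ξ η
  rw [toCLM_apply, toCLM_apply, inner_map_left, inv_inv]

variable [MeasurableSpace G] [BorelSpace G] [CompleteSpace H]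
variable (μ : Measure G) [IsFiniteMeasureOnCompacts μ]

/-- Integrated forms are defined vector by vector. Once g ↦ π(g)a is norm continuous, the product
becomes a Bochner integral of operators, to which closed subspaces and *-homomorphisms can be
applied. -/
theorem integrated_mul (π : UnitaryRep G H) (f : C_c(G, ℂ)) (a : H →L[ℂ] H)
    (ha : Continuous fun g => π.toCLM g * a) :
    Integrable (fun g => f g • (π.toCLM g * a)) μ ∧
      π.integrated μ f * a = ∫ g, f g • (π.toCLM g * a) ∂μ := by
  have hi : Integrable (fun g => f g • (π.toCLM g * a)) μ :=
    (f.continuous.smul ha).integrable_of_hasCompactSupport f.hasCompactSupport.smul_right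
  refine ⟨hi, ?_⟩
  ext ξ
  rw [ContinuousLinearMap.integral_apply hi]
  rfl

end UnitaryRep

section ReducedAlgebra

variable {G : Type u} [Group G] [TopologicalSpace G] [IsTopologicalGroup G]
  [LocallyCompactSpace G] [T2Space G] [MeasurableSpace G] [BorelSpace G]
variable (μ : Measure G) [μ.IsHaarMeasure] [μ.Regular]

instance isClosed_reducedCStar :
    IsClosed (reducedCStar μ : Set (Lp ℂ 2 μ →L[ℂ] Lp ℂ 2 μ)) :=
  NonUnitalStarSubalgebra.isClosed_topologicalClosure _

instance reducedCStar.instSMul : SMul ℂ (reducedCStar μ) :=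
  (inferInstance : Module ℂ (reducedCStar μ)).toDistribMulAction.toMulAction.toSMul

theorem toCLM_mul_integrated (g : G) (f : C_c(G, ℂ)) :
    (leftRegular μ).toCLM g * (leftRegular μ).integrated μ f
      = (leftRegular μ).integrated μ (lTrans g f) := by
  ext1 ξ
  exact ((leftRegular μ).integrated_lTrans μ g f ξ).symm

variable [μ.IsMulRightInvariant]

/-- The closure of the operators λ(f) is already an algebra: λ(f)λ(h) is an integral of multiples of
λ of the translates of h, so no convolution of functions is needed. Adjoints use that μ is inversion
invariant. -/
theorem mem_closure_range_integrated {a : Lp ℂ 2 μ →L[ℂ] Lp ℂ 2 μ} (ha : a ∈ reducedCStar μ) :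
    a ∈ closure (Set.range ((leftRegular μ).integrated μ)) := by
  have := isInvInvariant_of_isMulRightInvariant μ
  let N := (LinearMap.range ((leftRegular μ).integratedₗ μ)).topologicalClosure
  have hNcl : IsClosed (N : Set (Lp ℂ 2 μ →L[ℂ] Lp ℂ 2 μ)) :=
    Submodule.isClosed_topologicalClosure _
  have hmem : ∀ f, (leftRegular μ).integrated μ f ∈ N := fun f =>
    Submodule.le_topologicalClosure _ ⟨f, rfl⟩
  have hcl : ∀ a, a ∈ N ↔ a ∈ closure (Set.range ((leftRegular μ).integrated μ)) := fun a =>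
    Iff.rfl
  rw [← hcl]
  refine closure_minimal (fun T hT => ?_) hNcl ha
  change T ∈ N
  induction hT using NonUnitalStarAlgebra.adjoin_induction with
  | mem T hT =>
    obtain ⟨f, rfl⟩ := hT
    exact hmem f
  | add S T _ _ hS hT => exact N.add_mem hS hT
  | zero => exact N.zero_mem
  | smul c T _ hT => exact N.smul_mem c hT
  | mul S T _ _ hS hT =>
    rw [hcl] at hS hT
    refine hNcl.closure_subset_iff.2 (Set.Subset.refl _)
      (map_mem_closure₂ continuous_mul hS hT ?_)
    rintro _ ⟨f, rfl⟩ _ ⟨h, rfl⟩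
    have h1 := (leftRegular μ).integrated_mul μ f ((leftRegular μ).integrated μ h) (by
      simp only [toCLM_mul_integrated]
      exact (leftRegular μ).continuous_integrated_lTrans μ h)
    change (leftRegular μ).integrated μ f * (leftRegular μ).integrated μ h ∈ N
    rw [h1.2]
    refine integral_mem_of_isClosed N hNcl h1.1 fun g => N.smul_mem _ ?_
    rw [toCLM_mul_integrated]
    exact hmem _
  | star T _ hT =>
    rw [hcl] at hT ⊢
    refine map_mem_closure continuous_star hT ?_
    rintro _ ⟨f, rfl⟩
    exact ⟨adjFn f, ((leftRegular μ).star_integrated μ f).symm⟩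

theorem denseRange_leftConv : DenseRange (leftConv μ) := by
  intro a
  rw [closure_subtype]
  refine closure_mono ?_ (mem_closure_range_integrated μ a.2)
  rintro _ ⟨f, rfl⟩
  exact ⟨leftConv μ f, ⟨f, rfl⟩, rfl⟩

theorem toCLM_mul_mem (g : G) {a : Lp ℂ 2 μ →L[ℂ] Lp ℂ 2 μ} (ha : a ∈ reducedCStar μ) :
    (leftRegular μ).toCLM g * a ∈ reducedCStar μ := by
  refine (isClosed_reducedCStar μ).closure_subset_iff.2 (Set.Subset.refl _)
    (map_mem_closure (continuous_const_mul _) (mem_closure_range_integrated μ ha) ?_)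
  rintro _ ⟨f, rfl⟩
  change (leftRegular μ).toCLM g * (leftRegular μ).integrated μ f ∈ reducedCStar μ
  rw [toCLM_mul_integrated]
  exact (leftConv μ _).2

/-- The product `λ(g) a`. -/
def lMul (g : G) (a : reducedCStar μ) : reducedCStar μ :=
  ⟨(leftRegular μ).toCLM g * a, toCLM_mul_mem μ g a.2⟩

/-- The product `a λ(g)`. -/
def rMul (a : reducedCStar μ) (g : G) : reducedCStar μ := star (lMul μ g⁻¹ (star a))

theorem lMul_leftConv (g : G) (f : C_c(G, ℂ)) :
    lMul μ g (leftConv μ f) = leftConv μ (lTrans g f) :=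
  Subtype.ext (toCLM_mul_integrated μ g f)

theorem continuous_lMul_left (a : reducedCStar μ) : Continuous fun g => lMul μ g a := by
  refine Continuous.subtype_mk ?_ _
  refine continuous_apply_of_mem_closure
    (fun g => LinearMap.mulLeft ℂ ((leftRegular μ).toCLM g))
    (fun g b => (leftRegular μ).norm_toCLM_mul_le g b) ?_ (mem_closure_range_integrated μ a.2)
  rintro _ ⟨f, rfl⟩
  change Continuous fun g => (leftRegular μ).toCLM g * (leftRegular μ).integrated μ f
  simp only [toCLM_mul_integrated]
  exact (leftRegular μ).continuous_integrated_lTrans μ f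

theorem continuous_lMul_right (g : G) : Continuous fun a => lMul μ g a :=
  ((continuous_const_mul _).comp continuous_subtype_val).subtype_mk _

theorem continuous_rMul (a : reducedCStar μ) : Continuous fun g => rMul μ a g :=
  ((continuous_lMul_left μ (star a)).comp continuous_inv).star

/-- The inclusion of the reduced C*-algebra into the bounded operators on `L²(G)`. -/
def reducedInclusion : reducedCStar μ →⋆ₙₐ[ℂ] (Lp ℂ 2 μ →L[ℂ] Lp ℂ 2 μ) :=
  NonUnitalStarSubalgebraClass.subtype (reducedCStar μ)

theorem leftConv_mul (f : C_c(G, ℂ)) (a : reducedCStar μ) :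
    Integrable (fun g => f g • lMul μ g a) μ ∧ leftConv μ f * a = ∫ g, f g • lMul μ g a ∂μ := by
  have hi : Integrable (fun g => f g • lMul μ g a) μ :=
    (f.continuous.smul (continuous_lMul_left μ a)).integrable_of_hasCompactSupport
      f.hasCompactSupport.smul_right
  refine ⟨hi, Subtype.ext ?_⟩
  refine Eq.trans ?_ ((starHomCLM (reducedInclusion μ)).integral_comp_comm hi)
  exact ((leftRegular μ).integrated_mul μ f a
    (continuous_subtype_val.comp (continuous_lMul_left μ a))).2

section Subgroup

variable {K : Subgroup G} (ν : Measure K) [IsFiniteMeasureOnCompacts ν]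

/-- The product of `a` with the operator `∫ φ(k) λ(k) dk`. -/
def mulSubgroupConv (a : reducedCStar μ) (φ : C_c(K, ℂ)) : reducedCStar μ :=
  ∫ k, φ k • rMul μ a k ∂ν

theorem integrable_smul_rMul (a : reducedCStar μ) (φ : C_c(K, ℂ)) :
    Integrable (fun k : K => φ k • rMul μ a k) ν :=
  (φ.continuous.smul ((continuous_rMul μ a).comp continuous_subtype_val)
    ).integrable_of_hasCompactSupport φ.hasCompactSupport.smul_right

end Subgroup

section IntegratedForm

variable {H : Type*} [NormedAddCommGroup H] [InnerProductSpace ℂ H] [CompleteSpace H]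
  (θ : reducedCStar μ →⋆ₙₐ[ℂ] (H →L[ℂ] H)) (π : UnitaryRep G H)

theorem apply_lMul (hθ : ∀ f, θ (leftConv μ f) = π.integrated μ f) (g : G) (a : reducedCStar μ) :
    θ (lMul μ g a) = π.toCLM g * θ a := by
  refine congrFun (DenseRange.equalizer (denseRange_leftConv μ) (g := fun a => θ (lMul μ g a))
    (h := fun a => π.toCLM g * θ a) ((continuous_starHom θ).comp (continuous_lMul_right μ g))
    (continuous_const.mul (continuous_starHom θ)) ?_) a
  ext f : 1
  change θ (lMul μ g (leftConv μ f)) = π.toCLM g * θ (leftConv μ f)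
  rw [lMul_leftConv, hθ, hθ]
  ext1 ξ
  exact π.integrated_lTrans μ g f ξ

theorem apply_rMul (hθ : ∀ f, θ (leftConv μ f) = π.integrated μ f) (g : G) (a : reducedCStar μ) :
    θ (rMul μ a g) = θ a * π.toCLM g := by
  rw [rMul, map_star, apply_lMul μ θ π hθ, star_mul, map_star, star_star, π.star_toCLM, inv_inv]

/-- The element aλ(φ) is a Bochner integral inside A although λ(φ) itself is only a multiplier. This
formula is used both for the inclusion into the operators on L²(G) and for irreducible
representations. -/
theorem apply_mulSubgroupConv (hθ : ∀ f, θ (leftConv μ f) = π.integrated μ f) {K : Subgroup G}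
    (ν : Measure K) [IsFiniteMeasureOnCompacts ν] (a : reducedCStar μ) (φ : C_c(K, ℂ)) :
    θ (mulSubgroupConv μ ν a φ) = θ a * (π.restrict K).integrated ν φ := by
  have hi := integrable_smul_rMul μ ν a φ
  refine ((starHomCLM θ).integral_comp_comm hi).symm.trans ?_
  ext1 ξ
  rw [ContinuousLinearMap.integral_apply ((starHomCLM θ).integrable_comp hi)]
  change _ = θ a ((π.restrict K).integrated ν φ ξ)
  rw [(π.restrict K).integrated_apply ν,
    ← ContinuousLinearMap.integral_comp_comm _ ((π.restrict K).integrable_smul ν φ ξ)]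
  refine integral_congr_ae (Filter.Eventually.of_forall fun k => ?_)
  change θ (φ k • rMul μ a k) ξ = θ a (φ k • π.toHom k ξ)
  rw [map_smul, map_smul, apply_rMul μ θ π hθ]
  rfl

end IntegratedForm

section Subgroup

variable {K : Subgroup G} (ν : Measure K) [IsFiniteMeasureOnCompacts ν]

theorem coe_mulSubgroupConv (a : reducedCStar μ) (φ : C_c(K, ℂ)) :
    (mulSubgroupConv μ ν a φ : Lp ℂ 2 μ →L[ℂ] Lp ℂ 2 μ)
      = a * ((leftRegular μ).restrict K).integrated ν φ :=
  apply_mulSubgroupConv μ (reducedInclusion μ) (leftRegular μ) (fun _ => rfl) ν a φ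

theorem mul_mulSubgroupConv (a b : reducedCStar μ) (φ : C_c(K, ℂ)) :
    mulSubgroupConv μ ν (a * b) φ = a * mulSubgroupConv μ ν b φ := by
  apply Subtype.ext
  change _ = (a : Lp ℂ 2 μ →L[ℂ] Lp ℂ 2 μ) * (mulSubgroupConv μ ν b φ : Lp ℂ 2 μ →L[ℂ] Lp ℂ 2 μ)
  rw [coe_mulSubgroupConv, coe_mulSubgroupConv, ← mul_assoc]
  rfl

end Subgroup

end ReducedAlgebra

/-! ### The right regular representation -/

theorem finiteDimensional_range_of_ker_le {E F F' : Type*} [AddCommGroup E] [Module ℂ E]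
    [AddCommGroup F] [Module ℂ F] [AddCommGroup F'] [Module ℂ F'] (L : E →ₗ[ℂ] F)
    (M : E →ₗ[ℂ] F') (h : LinearMap.ker L ≤ LinearMap.ker M)
    (hL : FiniteDimensional ℂ (LinearMap.range L)) : FiniteDimensional ℂ (LinearMap.range M) := by
  have : FiniteDimensional ℂ (E ⧸ LinearMap.ker L) := L.quotKerEquivRange.symm.finiteDimensional
  rw [← Submodule.range_liftQ _ M h]
  infer_instance

/-- A finite-dimensional subspace is closed, so it contains the image of the closure as soon as it
contains the image of a dense subspace. -/
theorem finiteDimensional_range_of_denseRange {E X F : Type*} [AddCommGroup E] [Module ℂ E]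
    [AddCommGroup X] [Module ℂ X] [TopologicalSpace X] [AddCommGroup F] [Module ℂ F]
    [TopologicalSpace F] [IsTopologicalAddGroup F] [ContinuousSMul ℂ F] [T2Space F]
    (S : E →ₗ[ℂ] X) (hS : DenseRange S) (T : X →L[ℂ] F)
    (h : FiniteDimensional ℂ (LinearMap.range (T.toLinearMap ∘ₗ S))) :
    FiniteDimensional ℂ (LinearMap.range T.toLinearMap) := by
  refine Submodule.finiteDimensional_of_le (S₂ := LinearMap.range (T.toLinearMap ∘ₗ S)) ?_
  rintro _ ⟨x, rfl⟩
  have hcl : IsClosed (LinearMap.range (T.toLinearMap ∘ₗ S) : Set F) :=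
    Submodule.closed_of_finiteDimensional _
  refine hcl.closure_subset_iff.2 (Set.Subset.refl _) (map_mem_closure T.continuous (hS x) ?_)
  rintro _ ⟨e, rfl⟩
  exact ⟨e, rfl⟩

/-- Two operators on unrelated spaces are compared through a common dense source: equal kernels
there give isomorphic ranges, and density upgrades this to the full ranges. It will be applied with
C_c(G) mapped to A and to L²(G). -/
theorem finiteDimensional_range_iff_of_ker_eq {E F F' X X' : Type*} [AddCommGroup E] [Module ℂ E]
    [AddCommGroup X] [Module ℂ X] [TopologicalSpace X] [AddCommGroup F] [Module ℂ F]
    [TopologicalSpace F] [IsTopologicalAddGroup F] [ContinuousSMul ℂ F] [T2Space F]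
    [AddCommGroup X'] [Module ℂ X'] [TopologicalSpace X'] [AddCommGroup F'] [Module ℂ F']
    [TopologicalSpace F'] [IsTopologicalAddGroup F'] [ContinuousSMul ℂ F'] [T2Space F']
    (S : E →ₗ[ℂ] X) (hS : DenseRange S) (T : X →L[ℂ] F)
    (S' : E →ₗ[ℂ] X') (hS' : DenseRange S') (T' : X' →L[ℂ] F')
    (h : ∀ e, T (S e) = 0 ↔ T' (S' e) = 0) :
    FiniteDimensional ℂ (LinearMap.range T.toLinearMap) ↔
      FiniteDimensional ℂ (LinearMap.range T'.toLinearMap) := by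
  constructor
  · intro hT
    refine finiteDimensional_range_of_denseRange S' hS' _ ?_
    refine finiteDimensional_range_of_ker_le (T.toLinearMap ∘ₗ S) _ (fun e => (h e).1) ?_
    exact Submodule.finiteDimensional_of_le (LinearMap.range_comp_le_range _ _)
  · intro hT
    refine finiteDimensional_range_of_denseRange S hS _ ?_
    refine finiteDimensional_range_of_ker_le (T'.toLinearMap ∘ₗ S') _ (fun e => (h e).2) ?_
    exact Submodule.finiteDimensional_of_le (LinearMap.range_comp_le_range _ _)

theorem UnitaryRep.apply_integrated {G H F : Type*} [Group G] [TopologicalSpace G]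
    [NormedAddCommGroup H] [InnerProductSpace ℂ H] [CompleteSpace H] [NormedAddCommGroup F]
    [InnerProductSpace ℂ F] [CompleteSpace F] [MeasurableSpace G] [BorelSpace G] (μ : Measure G)
    [IsFiniteMeasureOnCompacts μ] (π : UnitaryRep G H) (f : C_c(G, ℂ)) (T : H →L[ℂ] F) (ξ : H) :
    T (π.integrated μ f ξ) = ∫ g, f g • T (π.toHom g ξ) ∂μ := by
  rw [π.integrated_apply μ, ← T.integral_comp_comm (π.integrable_smul μ f ξ)]
  simp only [map_smul]

section RightRegular

variable {G : Type u} [Group G] [TopologicalSpace G] [IsTopologicalGroup G]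
  [MeasurableSpace G] [BorelSpace G]
variable (μ : Measure G)

theorem rightTranslation_one [μ.IsMulRightInvariant] (ξ : Lp ℂ 2 μ) :
    rightTranslation μ 1 ξ = ξ := by
  apply Lp.ext
  filter_upwards [Lp.coeFn_compMeasurePreserving ξ (measurePreserving_mul_right μ (1 : G))]
    with x hx
  refine hx.trans ?_
  simp

theorem rightTranslation_mul [μ.IsMulRightInvariant] (g h : G) (ξ : Lp ℂ 2 μ) :
    rightTranslation μ (g * h) ξ = rightTranslation μ g (rightTranslation μ h ξ) := by
  apply Lp.ext
  have h1 := Lp.coeFn_compMeasurePreserving ξ (measurePreserving_mul_right μ (g * h))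
  have h2 := Lp.coeFn_compMeasurePreserving (rightTranslation μ h ξ)
    (measurePreserving_mul_right μ g)
  have h3 := (measurePreserving_mul_right μ g).quasiMeasurePreserving.ae_eq_comp
    (Lp.coeFn_compMeasurePreserving ξ (measurePreserving_mul_right μ h))
  filter_upwards [h1, h2, h3] with x hx1 hx2 hx3
  refine hx1.trans (Eq.trans ?_ hx2.symm)
  refine Eq.trans ?_ hx3.symm
  simp [mul_assoc]

variable [LocallyCompactSpace G] [μ.IsHaarMeasure] [μ.Regular] [μ.IsMulRightInvariant]

/-- The right regular representation of `G` on `L²(G)`. -/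
def rightRegular : UnitaryRep G (Lp ℂ 2 μ) where
  toHom :=
    { toFun := fun g =>
        { (rightTranslation μ g).toLinearMap with
          invFun := rightTranslation μ g⁻¹
          left_inv := fun ξ => by
            change rightTranslation μ g⁻¹ (rightTranslation μ g ξ) = ξ
            rw [← rightTranslation_mul, inv_mul_cancel, rightTranslation_one]
          right_inv := fun ξ => by
            change rightTranslation μ g (rightTranslation μ g⁻¹ ξ) = ξ
            rw [← rightTranslation_mul, mul_inv_cancel, rightTranslation_one]
          norm_map' := (rightTranslation μ g).norm_map }
      map_one' := by
        ext1 ξ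
        exact rightTranslation_one μ ξ
      map_mul' := fun g h => by
        ext1 ξ
        exact rightTranslation_mul μ g h ξ }
  strongly_continuous ξ := by
    have : Fact ((2 : ℝ≥0∞) ≠ ∞) := ⟨by simp⟩
    let c : C(G, C(G, G)) := (ContinuousMap.mk (fun p : G × G => p.2 * p.1) (by fun_prop)).curry
    exact (continuous_const (y := ξ)).compMeasurePreservingLp (g := c) c.continuous
      (fun g => measurePreserving_mul_right μ g) Fact.out

theorem rightRegular_apply (g : G) (ξ : Lp ℂ 2 μ) :
    (rightRegular μ).toHom g ξ = rightTranslation μ g ξ := rfl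

theorem leftRegular_apply (g : G) (ξ : Lp ℂ 2 μ) :
    (leftRegular μ).toHom g ξ = leftTranslation μ g ξ := rfl

/-- The class in `L²(G)` of a continuous function with compact support. -/
def toL2 : C_c(G, ℂ) →ₗ[ℂ] Lp ℂ 2 μ where
  toFun f := MemLp.toLp f (f.continuous.memLp_of_hasCompactSupport f.hasCompactSupport)
  map_add' _ _ := rfl
  map_smul' _ _ := rfl

theorem coeFn_toL2 (f : C_c(G, ℂ)) : toL2 μ f =ᵐ[μ] f :=
  MemLp.coeFn_toLp (f.continuous.memLp_of_hasCompactSupport f.hasCompactSupport)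

/-- Squeeze t between a compact s inside t and an open V containing s, and take a Urysohn function
times c. The error is bounded by ‖c‖ and lives on (V \ s) ∪ (t \ s), a set of small measure. -/
theorem exists_continuous_eLpNorm_sub_indicator_le {X : Type*} [TopologicalSpace X] [T2Space X]
    [LocallyCompactSpace X] [MeasurableSpace X] [BorelSpace X] (μ : Measure X) [μ.Regular] (c : ℂ)
    {t : Set X} (ht : MeasurableSet t) (htμ : μ t < ∞) {ε : ℝ≥0∞} (hε : ε ≠ 0) :
    ∃ g : X → ℂ, eLpNorm (g - t.indicator fun _ => c) 2 μ ≤ ε ∧ Continuous g ∧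
      HasCompactSupport g := by
  obtain ⟨η, hη0, hη⟩ := exists_eLpNorm_indicator_le (μ := μ) (p := 2) (by simp) c hε
  have hη2 : (η : ℝ≥0∞) / 2 ≠ 0 := by simpa using hη0.ne'
  obtain ⟨s, hst, hs, hμs⟩ := ht.exists_isCompact_sdiff_lt htμ.ne hη2
  obtain ⟨V, hsV, hV, -, hμV⟩ := hs.measurableSet.exists_isOpen_sdiff_lt
    ((measure_mono hst).trans_lt htμ).ne hη2
  obtain ⟨g, hg1, hg0, hgc, hgI⟩ := exists_continuous_one_zero_of_isCompact hs hV.isClosed_compl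
    (Set.disjoint_compl_right_iff_subset.2 hsV)
  have hgc' : HasCompactSupport fun x => (g x : ℂ) * c :=
    (hgc.comp_left (g := Complex.ofReal) rfl).mul_right
  refine ⟨fun x => (g x : ℂ) * c, ?_,
    (Complex.continuous_ofReal.comp g.continuous).mul continuous_const, hgc'⟩
  refine (eLpNorm_mono fun x => ?_).trans (hη ((V \ s) ∪ (t \ s)) ?_)
  · have h01 := hgI x
    by_cases hxs : x ∈ s
    · simp [hst hxs, hg1 hxs, hxs]
    · by_cases hxt : x ∈ t
      · simp only [Pi.sub_apply, Set.indicator_of_mem hxt]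
        rw [Set.indicator_of_mem (Set.mem_union_right (V \ s) (Set.mem_sdiff_of_mem hxt hxs))]
        have : (g x : ℂ) * c - c = ((g x - 1 : ℝ) : ℂ) * c := by push_cast; ring
        rw [this, norm_mul, Complex.norm_real, Real.norm_eq_abs]
        exact mul_le_of_le_one_left (norm_nonneg _) (abs_le.2 ⟨by linarith [h01.1], by linarith [h01.2]⟩)
      · by_cases hxV : x ∈ V
        · simp only [Pi.sub_apply, Set.indicator_of_notMem hxt, sub_zero]
          rw [Set.indicator_of_mem (Set.mem_union_left (t \ s) (Set.mem_sdiff_of_mem hxV hxs)), norm_mul, Complex.norm_real,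
            Real.norm_eq_abs]
          exact mul_le_of_le_one_left (norm_nonneg _) (abs_le.2 ⟨by linarith [h01.1], h01.2⟩)
        · simp [hxt, hg0 hxV]
  · refine (measure_union_le _ _).trans ?_
    rw [← ENNReal.add_halves (η : ℝ≥0∞)]
    exact add_le_add hμV.le hμs.le

theorem denseRange_toL2 [T2Space G] : DenseRange (toL2 μ) := by
  intro ξ
  refine EMetric.mem_closure_iff.2 fun ε hε => ?_
  obtain ⟨ε', h0, hε'⟩ := exists_between hε
  obtain ⟨g, hle, hgc, hg⟩ := (Lp.memLp ξ).induction_dense (by simp)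
    (fun g => Continuous g ∧ HasCompactSupport g)
    (fun c s hs hμs ε hε => exists_continuous_eLpNorm_sub_indicator_le μ c hs hμs hε)
    (fun f g hf hg => ⟨hf.1.add hg.1, hf.2.add hg.2⟩)
    (fun f hf => (hf.1.memLp_of_hasCompactSupport (p := 2) hf.2).aestronglyMeasurable) h0.ne'
  refine ⟨_, ⟨⟨⟨g, hgc⟩, hg⟩, rfl⟩, lt_of_le_of_lt ?_ hε'⟩
  rw [Lp.edist_def]
  refine le_of_eq_of_le (eLpNorm_congr_ae ?_) hle
  filter_upwards [coeFn_toL2 μ ⟨⟨g, hgc⟩, hg⟩] with x hx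
  simp only [Pi.sub_apply, hx]
  rfl

theorem leftTranslation_toL2 (g : G) (f : C_c(G, ℂ)) :
    leftTranslation μ g (toL2 μ f) = toL2 μ (lTrans g f) := by
  apply Lp.ext
  have h1 := Lp.coeFn_compMeasurePreserving (toL2 μ f) (measurePreserving_mul_left μ g⁻¹)
  have h2 := (measurePreserving_mul_left μ g⁻¹).quasiMeasurePreserving.ae_eq_comp (coeFn_toL2 μ f)
  filter_upwards [h1, h2, coeFn_toL2 μ (lTrans g f)] with x hx1 hx2 hx3
  exact (hx1.trans hx2).trans hx3.symm

theorem rightTranslation_toL2 (g : G) (f : C_c(G, ℂ)) :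
    rightTranslation μ g (toL2 μ f) = toL2 μ (rTrans g f) := by
  apply Lp.ext
  have h1 := Lp.coeFn_compMeasurePreserving (toL2 μ f) (measurePreserving_mul_right μ g)
  have h2 := (measurePreserving_mul_right μ g).quasiMeasurePreserving.ae_eq_comp (coeFn_toL2 μ f)
  filter_upwards [h1, h2, coeFn_toL2 μ (rTrans g f)] with x hx1 hx2 hx3
  exact (hx1.trans hx2).trans hx3.symm

theorem inner_toL2 (k h : C_c(G, ℂ)) :
    inner ℂ (toL2 μ k) (toL2 μ h) = ∫ x, inner ℂ (k x) (h x) ∂μ := by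
  rw [L2.inner_def]
  refine integral_congr_ae ?_
  filter_upwards [coeFn_toL2 μ k, coeFn_toL2 μ h] with x hx hx'
  rw [hx, hx']

/-- Haar measure need not be σ-finite, so Fubini is used for continuous integrands of compact
support. The factors a and k supply the compact support in g and in x respectively. -/
theorem integral_inner_mul_swap (k a : C_c(G, ℂ)) (b : G → G → ℂ)
    (hb : Continuous fun p : G × G => b p.1 p.2) :
    ∫ g, ∫ x, inner ℂ (k x) (a g * b g x) ∂μ ∂μ = ∫ x, ∫ g, inner ℂ (k x) (a g * b g x) ∂μ ∂μ := by
  refine integral_integral_swap_of_hasCompactSupport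
    (f := fun g x => inner ℂ (k x) (a g * b g x)) ?_ ?_
  · have hk := k.continuous
    have ha := a.continuous
    change Continuous fun p : G × G => inner ℂ (k p.2) (a p.1 * b p.1 p.2)
    fun_prop
  · have hc : IsCompact (tsupport a ×ˢ tsupport k) :=
      IsCompact.prod a.hasCompactSupport k.hasCompactSupport
    refine HasCompactSupport.intro' hc
      ((isClosed_tsupport a).prod (isClosed_tsupport k)) ?_
    rintro ⟨g, x⟩ hp
    rw [Set.mem_prod, not_and_or] at hp
    change inner ℂ (k x) (a g * b g x) = 0
    rcases hp with hp | hp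
    · rw [image_eq_zero_of_notMem_tsupport hp, zero_mul, inner_zero_right]
    · rw [image_eq_zero_of_notMem_tsupport hp, inner_zero_left]

/-- Left convolution by `f` applied to `h` is right convolution by `h` applied to `f`. -/
theorem leftRegular_integrated_toL2 [T2Space G] (f h : C_c(G, ℂ)) :
    (leftRegular μ).integrated μ f (toL2 μ h)
      = (rightRegular μ).integrated μ (invFn h) (toL2 μ f) := by
  refine (denseRange_toL2 μ).eq_of_inner_right ℂ fun k => ?_
  have hh := h.continuous
  have hf := f.continuous
  have e1 : ∀ g x, inner ℂ (k x) (f g * h (g⁻¹ * x)) = f g * inner ℂ (k x) (lTrans g h x) :=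
    fun g x => by rw [lTrans_apply, ← inner_smul_right, smul_eq_mul]
  have e2 : ∀ g x, inner ℂ (k x) (invFn h g * f (x * g))
      = invFn h g * inner ℂ (k x) (rTrans g f x) :=
    fun g x => by rw [rTrans_apply, ← inner_smul_right, smul_eq_mul]
  have h1 : inner ℂ (toL2 μ k) ((leftRegular μ).integrated μ f (toL2 μ h))
      = ∫ g, ∫ x, inner ℂ (k x) (f g * h (g⁻¹ * x)) ∂μ ∂μ := by
    rw [UnitaryRep.integrated_apply,
      inner_integral_right ((leftRegular μ).integrable_smul μ f (toL2 μ h))]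
    refine integral_congr_ae (Filter.Eventually.of_forall fun g => ?_)
    simp only [e1, integral_const_mul]
    rw [inner_smul_right, leftRegular_apply, leftTranslation_toL2, inner_toL2]
  have h2 : inner ℂ (toL2 μ k) ((rightRegular μ).integrated μ (invFn h) (toL2 μ f))
      = ∫ g, ∫ x, inner ℂ (k x) (invFn h g * f (x * g)) ∂μ ∂μ := by
    rw [UnitaryRep.integrated_apply,
      inner_integral_right ((rightRegular μ).integrable_smul μ (invFn h) (toL2 μ f))]
    refine integral_congr_ae (Filter.Eventually.of_forall fun g => ?_)
    simp only [e2, integral_const_mul]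
    rw [inner_smul_right, rightRegular_apply, rightTranslation_toL2, inner_toL2]
  rw [h1, h2, integral_inner_mul_swap μ k f (fun g x => h (g⁻¹ * x)) (by fun_prop),
    integral_inner_mul_swap μ k (invFn h) (fun g x => f (x * g)) (by fun_prop)]
  refine integral_congr_ae (Filter.Eventually.of_forall fun x => ?_)
  -- The substitution g ↦ xg turns f(g)h(g⁻¹x) into f(xg)h(g⁻¹).
  refine (integral_mul_left_eq_self (fun g => inner ℂ (k x) (f g * h (g⁻¹ * x))) x).symm.trans ?_
  refine integral_congr_ae (Filter.Eventually.of_forall fun g => ?_)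
  simp only [invFn_apply, mul_inv_rev, inv_mul_cancel_right]
  rw [mul_comm]

variable [T2Space G]

theorem leftRegular_integrated_translate_toL2 (f h : C_c(G, ℂ)) (g : G) :
    (leftRegular μ).integrated μ f ((leftRegular μ).toHom g (toL2 μ h))
      = (rightRegular μ).integrated μ (invFn h) ((rightRegular μ).toHom g⁻¹ (toL2 μ f)) := by
  have h1 := (leftRegular μ).integrated_rTrans μ g⁻¹ f (toL2 μ h)
  rw [inv_inv] at h1
  rw [← h1, leftRegular_integrated_toL2, rightRegular_apply, rightTranslation_toL2]

/-! ### Comparing the spaces cAλ(φ) with the operators c r(φ) -/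

section Subgroup

variable {K : Subgroup G} (ν : Measure K) [IsFiniteMeasureOnCompacts ν]

/-- Right convolution by `φ` on `L²(G)`, the operator `∫ φ(k) r(k⁻¹) dk`. -/
def rightConv (φ : C_c(K, ℂ)) : Lp ℂ 2 μ →L[ℂ] Lp ℂ 2 μ :=
  ((rightRegular μ).restrict K).integrated ν (invFn φ)

/-- Since c commutes with right translations, right convolution by h can be pulled out of c. The
symmetry of convolution moves λ(φ), acting on h, to right convolution by φ acting on f. This
exchanges the algebra A with the Hilbert space L²(G). -/
theorem mulSubgroupConv_leftConv_apply [ν.IsInvInvariant] (c : reducedCStar μ) (f h : C_c(G, ℂ))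
    (φ : C_c(K, ℂ)) :
    (mulSubgroupConv μ ν (c * leftConv μ f) φ : Lp ℂ 2 μ →L[ℂ] Lp ℂ 2 μ) (toL2 μ h)
      = (rightRegular μ).integrated μ (invFn h)
        ((c : Lp ℂ 2 μ →L[ℂ] Lp ℂ 2 μ) (rightConv μ ν φ (toL2 μ f))) := by
  rw [← UnitaryRep.map_integrated μ (rightRegular μ) (rightRegular μ) _
    (fun g ξ => reducedCStar_commute μ c g ξ), coe_mulSubgroupConv]
  change (c : Lp ℂ 2 μ →L[ℂ] Lp ℂ 2 μ) ((leftRegular μ).integrated μ f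
    (((leftRegular μ).restrict K).integrated ν φ (toL2 μ h))) = _
  congr 1
  rw [rightConv, UnitaryRep.apply_integrated ν, UnitaryRep.apply_integrated ν,
    ← integral_inv_eq_self _ ν]
  refine integral_congr_ae (Filter.Eventually.of_forall fun k => ?_)
  change φ k⁻¹ • (leftRegular μ).integrated μ f ((leftRegular μ).toHom (k : G)⁻¹ (toL2 μ h))
    = φ k⁻¹ • (rightRegular μ).integrated μ (invFn h) ((rightRegular μ).toHom (k : G) (toL2 μ f))
  rw [leftRegular_integrated_translate_toL2, inv_inv]

/-- The map `a ↦ a λ(φ)` on the reduced C*-algebra. -/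
def mulSubgroupConvL (φ : C_c(K, ℂ)) : reducedCStar μ →L[ℂ] reducedCStar μ where
  toFun a := mulSubgroupConv μ ν a φ
  map_add' a b := Subtype.ext (by
    change _ = (mulSubgroupConv μ ν a φ : Lp ℂ 2 μ →L[ℂ] Lp ℂ 2 μ) + mulSubgroupConv μ ν b φ
    simp only [coe_mulSubgroupConv]
    exact add_mul _ _ _)
  map_smul' c a := Subtype.ext (by
    change _ = c • (mulSubgroupConv μ ν a φ : Lp ℂ 2 μ →L[ℂ] Lp ℂ 2 μ)
    simp only [coe_mulSubgroupConv]
    exact smul_mul_assoc _ _ _)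
  cont := by
    refine continuous_induced_rng.2 ?_
    change Continuous fun a => (mulSubgroupConv μ ν a φ : Lp ℂ 2 μ →L[ℂ] Lp ℂ 2 μ)
    simp only [coe_mulSubgroupConv]
    exact continuous_subtype_val.mul continuous_const

/-- The convolution operators `λ(f)`, as a linear map. -/
def leftConvₗ : C_c(G, ℂ) →ₗ[ℂ] reducedCStar μ where
  toFun := leftConv μ
  map_add' f g := Subtype.ext (map_add ((leftRegular μ).integratedₗ μ) f g)
  map_smul' c f := Subtype.ext (map_smul ((leftRegular μ).integratedₗ μ) c f)

/-- The map `a ↦ c a λ(φ)` on the reduced C*-algebra. -/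
def subgroupCorner (c : reducedCStar μ) (φ : C_c(K, ℂ)) : reducedCStar μ →L[ℂ] reducedCStar μ :=
  (mulSubgroupConvL μ ν φ).comp (ContinuousLinearMap.mul ℂ (reducedCStar μ) c)

/-- A non-zero vector of L²(G) has a non-zero right convolution with some function in C_c(G), and an
operator vanishing on C_c(G) is zero. -/
theorem mulSubgroupConv_leftConv_eq_zero_iff [ν.IsInvInvariant] (c : reducedCStar μ)
    (φ : C_c(K, ℂ)) (f : C_c(G, ℂ)) :
    mulSubgroupConv μ ν (c * leftConv μ f) φ = 0
      ↔ (c : Lp ℂ 2 μ →L[ℂ] Lp ℂ 2 μ) (rightConv μ ν φ (toL2 μ f)) = 0 := by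
  constructor
  · intro h
    by_contra h0
    obtain ⟨k, hk⟩ := (rightRegular μ).exists_integrated_apply_ne_zero μ h0
    have h1 := mulSubgroupConv_leftConv_apply μ ν c f (invFn k) φ
    rw [h, invFn_invFn] at h1
    exact hk h1.symm
  · intro h
    apply Subtype.ext
    change (mulSubgroupConv μ ν (c * leftConv μ f) φ : Lp ℂ 2 μ →L[ℂ] Lp ℂ 2 μ) = 0
    refine DFunLike.coe_injective ((denseRange_toL2 μ).equalizer (ContinuousLinearMap.continuous _)
      (ContinuousLinearMap.continuous _) ?_)
    ext1 k
    change (mulSubgroupConv μ ν (c * leftConv μ f) φ : Lp ℂ 2 μ →L[ℂ] Lp ℂ 2 μ) (toL2 μ k) = 0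
    rw [mulSubgroupConv_leftConv_apply, h, map_zero]

/-- The operator `c r(φ)` has finite rank if and only if the space `c C*_r(G) λ(φ)` has finite
dimension. -/
theorem finiteDimensional_subgroupCorner_iff [ν.IsInvInvariant] (c : reducedCStar μ)
    (φ : C_c(K, ℂ)) :
    FiniteDimensional ℂ (LinearMap.range (subgroupCorner μ ν c φ).toLinearMap) ↔
      FiniteDimensional ℂ
        (LinearMap.range ((c : Lp ℂ 2 μ →L[ℂ] Lp ℂ 2 μ) * rightConv μ ν φ).toLinearMap) :=
  finiteDimensional_range_iff_of_ker_eq (leftConvₗ μ) (denseRange_leftConv μ) _ (toL2 μ)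
    (denseRange_toL2 μ) _ (mulSubgroupConv_leftConv_eq_zero_iff μ ν c φ)

end Subgroup

end RightRegular

/-! ### Disintegration of representations of the reduced C*-algebra -/

/-- An action of `G` by unitary multipliers of `A` is implemented in irreducible representations
of `A`. -/
theorem IrrRep.exists_unitaryRep {A : Type u} [NonUnitalCStarAlgebra A] (ρ : IrrRep A)
    {G : Type*} [Group G] [TopologicalSpace G] (m : G → A →ₗ[ℂ] A)
    (h_one : ∀ a, m 1 a = a) (h_mul : ∀ g h a, m (g * h) a = m g (m h a))
    (h_star : ∀ g a, star (m g a) * m g a = star a * a) (h_assoc : ∀ g a b, m g (a * b) = m g a * b)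
    (h_cont : ∀ a, Continuous fun g => m g a) :
    ∃ π : UnitaryRep G ρ.H, ∀ g a ξ, π.toHom g (ρ.rep a ξ) = ρ.rep (m g a) ξ := by
  obtain ⟨ξ₀, hξ₀⟩ := ρ.exists_ne_zero
  have hd := ρ.denseRange_orbit hξ₀
  -- The map ρ(a)ξ₀ ↦ ρ(ga)ξ₀ is isometric because (ga)*(ga) = a*a, and it has dense range because
  -- the multiplier is invertible.
  have hU : ∀ g, ∃ U : ρ.H ≃ₗᵢ[ℂ] ρ.H, ∀ a, U (ρ.orbit ξ₀ a) = (ρ.orbit ξ₀ ∘ₗ m g) a := by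
    intro g
    refine exists_unitary_of_norm_eq (ρ.orbit ξ₀) (ρ.orbit ξ₀ ∘ₗ m g) hd ?_ fun a => ?_
    · have hs : Function.Surjective (m g) := fun a => ⟨m g⁻¹ a, by rw [← h_mul, mul_inv_cancel, h_one]⟩
      intro η
      refine closure_mono ?_ (hd η)
      rintro _ ⟨a, rfl⟩
      obtain ⟨b, rfl⟩ := hs a
      exact ⟨b, rfl⟩
    · have key : ∀ b, ‖ρ.rep b ξ₀‖ ^ 2 = RCLike.re (inner ℂ ξ₀ (ρ.rep (star b * b) ξ₀)) := by
        intro b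
        rw [ρ.mul_apply, ← ρ.inner_star, star_star, inner_self_eq_norm_sq (𝕜 := ℂ)]
      have h1 : ‖ρ.rep (m g a) ξ₀‖ ^ 2 = ‖ρ.rep a ξ₀‖ ^ 2 := by rw [key, key, h_star]
      exact ((pow_left_inj₀ (norm_nonneg _) (norm_nonneg _) two_ne_zero).1 h1).symm
  choose U hU using hU
  have hU' : ∀ g a, U g (ρ.rep a ξ₀) = ρ.rep (m g a) ξ₀ := hU
  refine ⟨⟨⟨⟨U, ?_⟩, ?_⟩, ?_⟩, ?_⟩
  · refine DFunLike.coe_injective (hd.equalizer (U 1).continuous continuous_id ?_)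
    ext1 a
    change U 1 (ρ.rep a ξ₀) = ρ.rep a ξ₀
    rw [hU', h_one]
  · intro g h
    refine DFunLike.coe_injective (hd.equalizer (U (g * h)).continuous
      ((U g).continuous.comp (U h).continuous) ?_)
    ext1 a
    change U (g * h) (ρ.rep a ξ₀) = U g (U h (ρ.rep a ξ₀))
    rw [hU', hU', hU', h_mul]
  · intro ξ
    refine continuous_apply_of_mem_closure (fun g => (U g).toLinearEquiv.toLinearMap)
      (fun g η => ((U g).norm_map η).le) (S := Set.range (ρ.orbit ξ₀)) ?_ (hd ξ)
    rintro _ ⟨a, rfl⟩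
    change Continuous fun g => U g (ρ.rep a ξ₀)
    simp only [hU']
    exact ((continuous_starHom ρ.rep).comp (h_cont a)).clm_apply continuous_const
  · intro g a ξ
    change U g (ρ.rep a ξ) = ρ.rep (m g a) ξ
    refine congrFun (hd.equalizer (g := fun ξ => U g (ρ.rep a ξ)) (h := ρ.rep (m g a))
      ((U g).continuous.comp (ρ.rep a).continuous) (ρ.rep (m g a)).continuous ?_) ξ
    ext1 b
    change U g (ρ.rep a (ρ.rep b ξ₀)) = ρ.rep (m g a) (ρ.rep b ξ₀)
    rw [← ρ.mul_apply, ← ρ.mul_apply, hU', h_assoc]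

section Disintegration

variable {G : Type u} [Group G] [TopologicalSpace G] [IsTopologicalGroup G]
  [MeasurableSpace G] [BorelSpace G]
variable (μ : Measure G) [μ.IsHaarMeasure]

/-- Disintegration of an irreducible representation of a C*-algebra `A` in which the functions
with compact support are dense and on which `G` acts by unitary multipliers `m`. -/
theorem IrrRep.exists_integrated {A : Type u} [NonUnitalCStarAlgebra A] (ρ : IrrRep A)
    {conv : C_c(G, ℂ) → A} (hconv : DenseRange conv) (m : G → A →ₗ[ℂ] A)
    (h_one : ∀ a, m 1 a = a) (h_mul : ∀ g h a, m (g * h) a = m g (m h a))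
    (h_star : ∀ g a, star (m g a) * m g a = star a * a) (h_assoc : ∀ g a b, m g (a * b) = m g a * b)
    (h_cont : ∀ a, Continuous fun g => m g a)
    (h_conv : ∀ f a, Integrable (fun g => f g • m g a) μ ∧ conv f * a = ∫ g, f g • m g a ∂μ) :
    ∃ π : UnitaryRep G ρ.H, π.IsIrreducible ∧ ∀ f, ρ.rep (conv f) = π.integrated μ f := by
  obtain ⟨π, hπ⟩ := ρ.exists_unitaryRep m h_one h_mul h_star h_assoc h_cont
  have hform : ∀ f, ρ.rep (conv f) = π.integrated μ f := by
    intro f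
    obtain ⟨ξ₀, hξ₀⟩ := ρ.exists_ne_zero
    refine DFunLike.coe_injective ((ρ.denseRange_orbit hξ₀).equalizer
      (ContinuousLinearMap.continuous _) (ContinuousLinearMap.continuous _) ?_)
    ext1 a
    change ρ.rep (conv f) (ρ.rep a ξ₀) = π.integrated μ f (ρ.rep a ξ₀)
    obtain ⟨hi, he⟩ := h_conv f a
    rw [← ρ.mul_apply, he, π.integrated_apply μ]
    have h2 : ρ.rep (∫ g, f g • m g a ∂μ) = ∫ g, starHomCLM ρ.rep (f g • m g a) ∂μ :=
      ((starHomCLM ρ.rep).integral_comp_comm hi).symm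
    rw [h2, ContinuousLinearMap.integral_apply ((starHomCLM ρ.rep).integrable_comp hi)]
    refine integral_congr_ae (Filter.Eventually.of_forall fun g => ?_)
    change ρ.rep (f g • m g a) ξ₀ = f g • π.toHom g (ρ.rep a ξ₀)
    rw [hπ, map_smul]
    rfl
  refine ⟨π, ⟨?_, fun W hW hWπ => ρ.irreducible W hW fun a ξ hξ => ?_⟩, hform⟩
  · obtain ⟨ξ₀, hξ₀⟩ := ρ.exists_ne_zero
    exact ⟨ξ₀, 0, hξ₀⟩
  -- A closed π-invariant subspace is preserved by all integrals π(f), hence by density by all of A.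
  · refine hconv.induction_on (p := fun a => ρ.rep a ξ ∈ W) a
      (hW.preimage ((continuous_starHom ρ.rep).clm_apply continuous_const)) fun f => ?_
    rw [hform, π.integrated_apply μ]
    exact integral_mem_of_isClosed W hW (π.integrable_smul μ f ξ)
      fun g => W.smul_mem _ (hWπ g ξ hξ)

/-- `ρ` is unitarily equivalent to the integrated form of `π`, where functions on `G` are mapped to
`A` by `conv`. -/
def IntegratesTo {A : Type u} [NonUnitalRing A] [StarRing A] [Module ℂ A] (conv : C_c(G, ℂ) → A)
    (ρ : IrrRep A) (π : IrrUnitaryRep G) : Prop :=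
  ∃ U : π.H ≃ₗᵢ[ℂ] ρ.H, ∀ (f : C_c(G, ℂ)) (ξ : π.H),
    U (π.rep.integrated μ f ξ) = ρ.rep (conv f) (U ξ)

variable {μ} {A : Type u} [NonUnitalCStarAlgebra A] {conv : C_c(G, ℂ) → A}

theorem IntegratesTo.congr_left {ρ ρ' : IrrRep A} {π : IrrUnitaryRep G}
    (h : IntegratesTo μ conv ρ π) (hρ : ρ ≈ ρ') : IntegratesTo μ conv ρ' π := by
  obtain ⟨U, hU⟩ := h
  obtain ⟨V, hV⟩ := hρ
  exact ⟨U.trans V, fun f ξ => by simp [hU, hV]⟩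

theorem IntegratesTo.congr_right {ρ : IrrRep A} {π π' : IrrUnitaryRep G}
    (h : IntegratesTo μ conv ρ π) (hπ : π' ≈ π) : IntegratesTo μ conv ρ π' := by
  obtain ⟨U, hU⟩ := h
  obtain ⟨V, hV⟩ := hπ
  refine ⟨V.trans U, fun f ξ => ?_⟩
  have h1 := UnitaryRep.map_integrated μ π'.rep π.rep
    V.toContinuousLinearEquiv.toContinuousLinearMap hV f ξ
  change V (π'.rep.integrated μ f ξ) = π.rep.integrated μ f (V ξ) at h1
  change U (V _) = ρ.rep (conv f) (U (V ξ))
  rw [h1, hU]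

theorem IntegratesTo.equiv_left (hconv : DenseRange conv) {ρ ρ' : IrrRep A}
    {π : IrrUnitaryRep G} (h : IntegratesTo μ conv ρ π) (h' : IntegratesTo μ conv ρ' π) :
    ρ ≈ ρ' := by
  obtain ⟨U, hU⟩ := h
  obtain ⟨V, hV⟩ := h'
  refine ⟨U.symm.trans V, fun a ξ => ?_⟩
  change V (U.symm (ρ.rep a ξ)) = ρ'.rep a (V (U.symm ξ))
  refine hconv.induction_on
    (p := fun a => V (U.symm (ρ.rep a ξ)) = ρ'.rep a (V (U.symm ξ))) a
    (isClosed_eq (V.continuous.comp (U.symm.continuous.comp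
      ((continuous_starHom ρ.rep).clm_apply continuous_const)))
      ((continuous_starHom ρ'.rep).clm_apply continuous_const)) fun f => ?_
  rw [← hV]
  congr 1
  rw [LinearIsometryEquiv.symm_apply_eq, hU, LinearIsometryEquiv.apply_symm_apply]

theorem IntegratesTo.equiv_right (hconv : DenseRange conv) {ρ : IrrRep A}
    {π π' : IrrUnitaryRep G} (h : IntegratesTo μ conv ρ π) (h' : IntegratesTo μ conv ρ π') :
    π ≈ π' := by
  obtain ⟨U, hU⟩ := h
  obtain ⟨V, hV⟩ := h'
  let W := U.trans V.symm
  have hW : ∀ f ξ, W (π.rep.integrated μ f ξ) = π'.rep.integrated μ f (W ξ) := by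
    intro f ξ
    change V.symm (U _) = _
    rw [LinearIsometryEquiv.symm_apply_eq, hU, hV]
    congr 1
    exact (V.apply_symm_apply _).symm
  obtain ⟨ξ₀, hξ₀⟩ := ρ.exists_ne_zero
  -- The vectors π(f)ξ are dense, and π(g)π(f) is π of a translate of f, so the group action is
  -- recovered from the integrated form.
  have hd : DenseRange fun f => π.rep.integrated μ f (U.symm ξ₀) := by
    have h1 : DenseRange fun f => U.symm (ρ.orbit ξ₀ (conv f)) :=
      U.symm.surjective.denseRange.comp ((ρ.denseRange_orbit hξ₀).comp hconv
        ((continuous_starHom ρ.rep).clm_apply continuous_const)) U.symm.continuous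
    refine (congrArg DenseRange ?_).mp h1
    ext1 f
    rw [LinearIsometryEquiv.symm_apply_eq, hU, LinearIsometryEquiv.apply_symm_apply]
    rfl
  refine ⟨W, fun g ξ => ?_⟩
  refine congrFun (hd.equalizer (g := fun ξ => W (π.rep.toHom g ξ))
    (h := fun ξ => π'.rep.toHom g (W ξ)) (W.continuous.comp (π.rep.toHom g).continuous)
    ((π'.rep.toHom g).continuous.comp W.continuous) ?_) ξ
  ext1 f
  change W (π.rep.toHom g (π.rep.integrated μ f _)) = π'.rep.toHom g (W (π.rep.integrated μ f _))
  rw [← π.rep.integrated_lTrans μ, hW, hW, π'.rep.integrated_lTrans μ]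

end Disintegration

section ReducedDisintegration

variable {G : Type u} [Group G] [TopologicalSpace G] [IsTopologicalGroup G]
  [LocallyCompactSpace G] [T2Space G] [MeasurableSpace G] [BorelSpace G]
variable (μ : Measure G) [μ.IsHaarMeasure] [μ.Regular] [μ.IsMulRightInvariant]

/-- The product `λ(g) a`, as a linear map in `a`. -/
def lMulₗ (g : G) : reducedCStar μ →ₗ[ℂ] reducedCStar μ where
  toFun := lMul μ g
  map_add' _ _ := Subtype.ext (mul_add _ _ _)
  map_smul' _ _ := Subtype.ext (mul_smul_comm _ _ _)

theorem lMul_one (a : reducedCStar μ) : lMul μ 1 a = a := by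
  apply Subtype.ext
  ext1 ξ
  exact (leftRegular μ).map_one_apply _

theorem lMul_mul (g h : G) (a : reducedCStar μ) : lMul μ (g * h) a = lMul μ g (lMul μ h a) := by
  apply Subtype.ext
  ext1 ξ
  exact (leftRegular μ).map_mul_apply g h _

theorem star_lMul_mul_lMul (g : G) (a : reducedCStar μ) :
    star (lMul μ g a) * lMul μ g a = star a * a := by
  apply Subtype.ext
  change star ((leftRegular μ).toCLM g * (a : Lp ℂ 2 μ →L[ℂ] Lp ℂ 2 μ))
    * ((leftRegular μ).toCLM g * a) = star (a : Lp ℂ 2 μ →L[ℂ] Lp ℂ 2 μ) * a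
  rw [star_mul, UnitaryRep.star_toCLM, mul_assoc]
  congr 1
  ext1 ξ
  exact (leftRegular μ).map_inv_map g _

theorem lMul_mul_assoc (g : G) (a b : reducedCStar μ) : lMul μ g (a * b) = lMul μ g a * b :=
  Subtype.ext (mul_assoc _ _ _).symm

theorem exists_integrated_reducedCStar {K : Subgroup G} (ν : Measure K)
    [IsFiniteMeasureOnCompacts ν] (ρ : IrrRep (reducedCStar μ)) :
    ∃ π : UnitaryRep G ρ.H, π.IsIrreducible ∧ (∀ f, ρ.rep (leftConv μ f) = π.integrated μ f) ∧
      ∀ (φ : C_c(K, ℂ)) (a : reducedCStar μ), ρ.rep (mulSubgroupConv μ ν a φ)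
        = ρ.rep a * (π.restrict K).integrated ν φ := by
  have h1 := ρ.exists_integrated μ (denseRange_leftConv μ)
  have h2 := h1 (lMulₗ μ)
  have h3 := h2 (lMul_one μ) (lMul_mul μ) (star_lMul_mul_lMul μ) (lMul_mul_assoc μ)
  have h4 := h3 (continuous_lMul_left μ) (leftConv_mul μ)
  refine Exists.elim h4 fun π hπ => Exists.intro π (And.intro hπ.1 (And.intro hπ.2 fun φ a => ?_))
  exact apply_mulSubgroupConv μ ρ.rep π hπ.2 ν a φ

end ReducedDisintegration

theorem UnitaryRep.IsAdmissible.congr {G : Type u} [Group G] [TopologicalSpace G]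
    {H H' : Type u} [NormedAddCommGroup H] [InnerProductSpace ℂ H] [NormedAddCommGroup H']
    [InnerProductSpace ℂ H'] {K : Subgroup G} {π : UnitaryRep G H} {π' : UnitaryRep G H'}
    (h : π.IsAdmissible K) (U : H ≃ₗᵢ[ℂ] H') (hU : ∀ g ξ, U (π.toHom g ξ) = π'.toHom g (U ξ)) :
    π'.IsAdmissible K := by
  intro V _ _ _ τ hτ
  have := h V τ hτ
  have hU' : ∀ g ξ, U.symm (π'.toHom g ξ) = π.toHom g (U.symm ξ) := fun g ξ => by
    rw [LinearIsometryEquiv.symm_apply_eq, hU, LinearIsometryEquiv.apply_symm_apply]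
  let e : τ.intertwiners (π'.restrict K) →ₗ[ℂ] τ.intertwiners (π.restrict K) :=
    { toFun := fun T => ⟨U.symm.toContinuousLinearEquiv.toContinuousLinearMap.comp
        (T : V →L[ℂ] H'), fun k ξ => by
          change U.symm ((T : V →L[ℂ] H') (τ.toHom k ξ)) = π.toHom k (U.symm ((T : V →L[ℂ] H') ξ))
          rw [T.2 k ξ]
          exact hU' _ _⟩
      map_add' := fun S T => Subtype.ext (ContinuousLinearMap.comp_add _ _ _)
      map_smul' := fun c T => Subtype.ext (ContinuousLinearMap.comp_smul _ _ _) }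
  refine FiniteDimensional.of_injective e ((injective_iff_map_eq_zero e).2 fun T hT => ?_)
  ext ξ
  have h1 := congrArg (fun S : τ.intertwiners (π.restrict K) => (S : V →L[ℂ] H) ξ) hT
  change U.symm ((T : V →L[ℂ] H') ξ) = 0 at h1
  exact (map_eq_zero_iff _ U.symm.injective).1 h1

/-! ### Discrete points of the spectrum -/

theorem CStarDual.isClosed_iff {A : Type u} [NonUnitalRing A] [StarRing A] [Module ℂ A]
    {S : Set (CStarDual A)} :
    IsClosed S ↔ ∃ I : TwoSidedIdeal A, S = {x | I ≤ x.ker} := by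
  rw [← isOpen_compl_iff]
  change Sᶜᶜ ∈ {S : Set (CStarDual A) | ∃ I : TwoSidedIdeal A, S = {x | I ≤ x.ker}} ↔ _
  rw [compl_compl]
  rfl

theorem IrrRep.mem_ker {A : Type u} [NonUnitalRing A] [StarRing A] [Module ℂ A] (ρ : IrrRep A)
    (a : A) : a ∈ ρ.ker ↔ ρ.rep a = 0 := TwoSidedIdeal.mem_ker _

theorem IrrRep.toDual_ker {A : Type u} [NonUnitalRing A] [StarRing A] [Module ℂ A] (ρ : IrrRep A) :
    ρ.toDual.ker = ρ.ker := rfl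

theorem IrrRep.toDual_eq_iff {A : Type u} [NonUnitalRing A] [StarRing A] [Module ℂ A]
    {ρ x : IrrRep A} : ρ.toDual = x.toDual ↔ ρ ≈ x := Quotient.eq

theorem IrrRep.apply_ne_zero_of_equiv {A : Type u} [NonUnitalRing A] [StarRing A] [Module ℂ A]
    {ρ x : IrrRep A} (h : ρ ≈ x) {a : A} (ha : ρ.rep a ≠ 0) : x.rep a ≠ 0 := by
  have h1 : ρ.ker = x.ker := by rw [← toDual_ker, ← toDual_ker, toDual_eq_iff.2 h]
  exact fun h0 => ha ((ρ.mem_ker a).1 (h1 ▸ (x.mem_ker a).2 h0))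

/-- The operators `D T D'`, with `D` and `D'` of finite rank, form a finite-dimensional space. -/
theorem finiteDimensional_range_sandwich {E H : Type*} [AddCommGroup E] [Module ℂ E]
    [NormedAddCommGroup H] [InnerProductSpace ℂ H] (D D' : H →L[ℂ] H)
    (hD : FiniteDimensional ℂ (LinearMap.range D.toLinearMap))
    (hD' : FiniteDimensional ℂ (LinearMap.range D'.toLinearMap)) (L : E →ₗ[ℂ] (H →L[ℂ] H))
    (hL : ∀ e, ∃ T : H →L[ℂ] H, L e = D * T * D') : FiniteDimensional ℂ (LinearMap.range L) := by
  let R := LinearMap.range D.toLinearMap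
  let R' := LinearMap.range D'.toLinearMap
  let p : H →L[ℂ] R' := D'.codRestrict R' fun x => ⟨x, rfl⟩
  let Ψ : (R' →ₗ[ℂ] R) →ₗ[ℂ] (H →L[ℂ] H) :=
    { toFun := fun Z => R.subtypeL.comp ((LinearMap.toContinuousLinearMap Z).comp p)
      map_add' := fun Z Z' => by
        ext x
        simp
      map_smul' := fun c Z => by
        ext x
        simp }
  refine Submodule.finiteDimensional_of_le (S₂ := LinearMap.range Ψ) ?_
  rintro _ ⟨e, rfl⟩
  obtain ⟨T, hT⟩ := hL e
  refine ⟨D.toLinearMap.rangeRestrict ∘ₗ T.toLinearMap ∘ₗ R'.subtype, ?_⟩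
  rw [hT]
  rfl

/-! ### Open and closed points of the spectrum; the map S φ stands for a ↦ aλ(φ) -/

section CompactSubgroup

variable {K : Type u} [Group K] [TopologicalSpace K] [CompactSpace K] [IsTopologicalGroup K]
  [MeasurableSpace K] [BorelSpace K] (ν : Measure K) [ν.IsHaarMeasure]
variable {A : Type u} [NonUnitalCStarAlgebra A] (S : C_c(K, ℂ) → A →ₗ[ℂ] A)

/-- Pick a non-zero vector in the range of ρ(b)* and a representative function acting on it
non-trivially; the adjoint of that composite is ρ(b) times the action of a representative function.
-/
theorem IrrRep.exists_isRepresentative_ne_zero (ρ : IrrRep A) (κ : UnitaryRep K ρ.H)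
    (hκ : ∀ φ a, ρ.rep (S φ a) = ρ.rep a * κ.integrated ν φ) {b : A} (hb : ρ.rep b ≠ 0) :
    ∃ φ, IsRepresentative φ ∧ ρ.rep (S φ b) ≠ 0 := by
  have := isInvInvariant_of_compactSpace ν
  obtain ⟨η, hη⟩ := ρ.exists_apply_ne_zero (ρ.apply_star_ne_zero hb)
  obtain ⟨φ, hφ, h⟩ := exists_isRepresentative_apply_ne_zero ν κ hη
  obtain ⟨φ', hφ', hadj⟩ := hφ.exists_adjoint
  refine ⟨φ', hφ', fun h0 => h ?_⟩
  refine ext_inner_right ℂ fun ζ => ?_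
  rw [κ.inner_integrated_left ν φ φ' hadj, ρ.inner_star]
  have h1 : ρ.rep b (κ.integrated ν φ' ζ) = ρ.rep (S φ' b) ζ := by
    rw [hκ]
    rfl
  rw [h1, h0, inner_zero_left]
  exact inner_zero_right _

/-- If `c A λ(φ)` has finite dimension for all representative functions `φ`, and `ρ(c) ≠ 0`, then
representative functions act by operators of finite rank. -/
theorem IrrRep.finiteDimensional_range_of_corner (ρ : IrrRep A) (κ : UnitaryRep K ρ.H)
    (hκ : ∀ φ a, ρ.rep (S φ a) = ρ.rep a * κ.integrated ν φ) {c : A} (hc : ρ.rep c ≠ 0)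
    (hfin : ∀ φ, IsRepresentative φ →
      FiniteDimensional ℂ (LinearMap.range (S φ ∘ₗ LinearMap.mulLeft ℂ c)))
    {φ : C_c(K, ℂ)} (hφ : IsRepresentative φ) :
    FiniteDimensional ℂ (LinearMap.range (κ.integrated ν φ).toLinearMap) := by
  have := isInvInvariant_of_compactSpace ν
  obtain ⟨φ', hφ', hadj⟩ := hφ.exists_adjoint
  obtain ⟨η, hη⟩ := ρ.exists_apply_ne_zero (ρ.apply_star_ne_zero hc)
  refine finiteDimensional_range_of_denseRange (ρ.orbit (ρ.rep (star c) η))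
    (ρ.denseRange_orbit hη) _ ?_
  have := hfin φ' hφ'
  obtain ⟨s, hs⟩ := (Submodule.fg_iff_finiteDimensional _).2 this
  -- The map x ↦ ρ(x*)η is conjugate-linear, so finiteness is transported through a finite spanning
  -- set of cAλ(φ').
  let F : Submodule ℂ ρ.H := Submodule.span ℂ ((fun x => ρ.rep (star x) η) '' (s : Set A))
  have hF : FiniteDimensional ℂ F := FiniteDimensional.span_of_finite ℂ (s.finite_toSet.image _)
  refine Submodule.finiteDimensional_of_le (S₂ := F) ?_
  rintro _ ⟨b, rfl⟩
  -- On the dense orbit of ρ(c*)η, the operator π(φ) gives ρ(x*)η with x = cb*λ(φ'), an element of a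
  -- fixed finite-dimensional space.
  have key : κ.integrated ν φ (ρ.rep b (ρ.rep (star c) η))
      = ρ.rep (star (S φ' (c * star b))) η := by
    refine ext_inner_right ℂ fun ζ => ?_
    rw [κ.inner_integrated_left ν φ φ' hadj, ρ.inner_star, hκ, ← ρ.mul_apply]
    have h1 : b * star c = star (c * star b) := by rw [star_mul, star_star]
    rw [h1, ρ.inner_star]
    rfl
  change κ.integrated ν φ (ρ.rep b (ρ.rep (star c) η)) ∈ F
  rw [key]
  have hmem : S φ' (c * star b) ∈ Submodule.span ℂ (s : Set A) := by
    rw [hs]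
    exact ⟨star b, rfl⟩
  refine Submodule.span_induction (p := fun x _ => ρ.rep (star x) η ∈ F) ?_ ?_ ?_ ?_ hmem
  · exact fun x hx => Submodule.subset_span ⟨x, hx, rfl⟩
  · simp
  · intro x y _ _ hx hy
    rw [star_add, map_add]
    exact F.add_mem hx hy
  · intro r x _ hx
    rw [star_smul, map_smul]
    exact F.smul_mem _ hx

/-- The closure consists of the x whose kernel contains that of ρ. Choose d = bλ(φ) with x(d) ≠ 0:
ρ(d) has finite rank, so ρ(dAd) is finite-dimensional and forces x to be equivalent to ρ. -/
theorem IrrRep.isClosed_singleton_toDual (ρ : IrrRep A) (κ : UnitaryRep K ρ.H)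
    (hκ : ∀ φ a, ρ.rep (S φ a) = ρ.rep a * κ.integrated ν φ)
    (hdis : ∀ x : IrrRep A, ∃ κ : UnitaryRep K x.H,
      ∀ φ a, x.rep (S φ a) = x.rep a * κ.integrated ν φ)
    (hfin : ∀ φ, IsRepresentative φ →
      FiniteDimensional ℂ (LinearMap.range (κ.integrated ν φ).toLinearMap)) :
    IsClosed {ρ.toDual} := by
  refine CStarDual.isClosed_iff.2 ⟨ρ.ker, ?_⟩
  ext x
  induction x using Quotient.inductionOn with
  | h x =>
    change x.toDual = ρ.toDual ↔ ρ.ker ≤ x.ker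
    constructor
    · intro h
      rw [← x.toDual_ker, h, ρ.toDual_ker]
    · intro h
      obtain ⟨b, hb⟩ := x.ne_zero
      obtain ⟨κx, hκx⟩ := hdis x
      obtain ⟨φ, hφ, hd⟩ := x.exists_isRepresentative_ne_zero ν S κx hκx hb
      have hD : FiniteDimensional ℂ (LinearMap.range (ρ.rep (S φ b)).toLinearMap) := by
        have := hfin φ hφ
        rw [hκ]
        change FiniteDimensional ℂ (LinearMap.range
          ((ρ.rep b).toLinearMap ∘ₗ (κ.integrated ν φ).toLinearMap))
        rw [LinearMap.range_comp]
        infer_instance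
      refine (IrrRep.toDual_eq_iff.2 (ρ.equiv_of_ker_le x h (S φ b) (S φ b) hd hd ?_)).symm
      refine finiteDimensional_range_sandwich _ _ hD hD _ fun a => ⟨ρ.rep a, ?_⟩
      rw [cornerMap_apply, map_mul, map_mul]

/-- For d = cλ(φ) with ρ(d) ≠ 0 the corner cAd lies in cAλ(φ), so it contains an element y that is
non-zero only in representations equivalent to ρ. The complement of the point is the hull of the
ideal generated by y. -/
theorem IrrRep.isOpen_singleton_toDual (hS : ∀ φ a b, S φ (a * b) = a * S φ b) (ρ : IrrRep A)
    (κ : UnitaryRep K ρ.H) (hκ : ∀ φ a, ρ.rep (S φ a) = ρ.rep a * κ.integrated ν φ) {c : A}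
    (hc : ρ.rep c ≠ 0) (hfin : ∀ φ, IsRepresentative φ →
      FiniteDimensional ℂ (LinearMap.range (S φ ∘ₗ LinearMap.mulLeft ℂ c))) :
    IsOpen {ρ.toDual} := by
  obtain ⟨φ, hφ, hd⟩ := ρ.exists_isRepresentative_ne_zero ν S κ hκ hc
  obtain ⟨y, hy, hyx⟩ := ρ.exists_isolating_element c (S φ c) hc hd (by
    have := hfin φ hφ
    refine Submodule.finiteDimensional_of_le
      (S₂ := LinearMap.range (S φ ∘ₗ LinearMap.mulLeft ℂ c)) ?_
    rintro _ ⟨a, rfl⟩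
    refine ⟨a * c, ?_⟩
    change S φ (c * (a * c)) = c * a * S φ c
    rw [← mul_assoc, hS])
  rw [← isClosed_compl_iff]
  refine CStarDual.isClosed_iff.2 ⟨TwoSidedIdeal.span {y}, ?_⟩
  ext x
  induction x using Quotient.inductionOn with
  | h x =>
    change ¬ x.toDual = ρ.toDual ↔ TwoSidedIdeal.span {y} ≤ x.ker
    rw [TwoSidedIdeal.span_le, Set.singleton_subset_iff]
    change _ ↔ y ∈ x.ker
    rw [x.mem_ker, IrrRep.toDual_eq_iff]
    constructor
    · intro h
      by_contra h0
      exact h (Setoid.symm (hyx x h0))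
    · exact fun h0 h => IrrRep.apply_ne_zero_of_equiv (Setoid.symm h) hy h0

/-- A point that is open in the spectrum and on which representative functions act by finite rank
operators is detected by elements `c` such that all `c A λ(φ)` have finite dimension. -/
theorem IrrRep.exists_corner_of_isOpen (hS : ∀ φ a b, S φ (a * b) = a * S φ b)
    {H : Type*} [NormedAddCommGroup H] [InnerProductSpace ℂ H] [CompleteSpace H]
    (θ : A →⋆ₙₐ[ℂ] (H →L[ℂ] H)) (hθ : Function.Injective θ) (ρ : IrrRep A)
    (κ : UnitaryRep K ρ.H) (hκ : ∀ φ a, ρ.rep (S φ a) = ρ.rep a * κ.integrated ν φ)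
    (hfin : ∀ φ, IsRepresentative φ →
      FiniteDimensional ℂ (LinearMap.range (κ.integrated ν φ).toLinearMap))
    (hopen : IsOpen {ρ.toDual}) :
    ∃ c, ρ.rep c ≠ 0 ∧ ∀ φ, IsRepresentative φ →
      FiniteDimensional ℂ (LinearMap.range (S φ ∘ₗ LinearMap.mulLeft ℂ c)) := by
  obtain ⟨I, hI⟩ := CStarDual.isClosed_iff.1 hopen.isClosed_compl
  have hIρ : ¬ I ≤ ρ.ker := fun h => by
    have h1 : ρ.toDual ∈ {x : CStarDual A | I ≤ x.ker} := h
    rw [← hI] at h1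
    exact h1 rfl
  -- Every other point of the spectrum vanishes on I, so an element of I killed by ρ is killed by
  -- all irreducible representations.
  have hinj : ∀ z ∈ I, ρ.rep z = 0 → z = 0 := by
    intro z hz h0
    by_contra hz0
    have hθz : θ z ≠ 0 := fun h => hz0 (hθ (by rw [h, map_zero]))
    obtain ⟨x, hx⟩ := exists_irrRep_apply_ne_zero θ hθz
    have h1 : x.toDual ∉ {x : CStarDual A | I ≤ x.ker} := fun h => hx ((x.mem_ker z).1 (h hz))
    rw [← hI, Set.mem_compl_iff, not_not] at h1
    exact IrrRep.apply_ne_zero_of_equiv (IrrRep.toDual_eq_iff.1 h1) hx h0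
  obtain ⟨i, hi, hi0⟩ := Set.not_subset.1 hIρ
  have hi0' : ρ.rep i ≠ 0 := fun h => hi0 ((ρ.mem_ker i).2 h)
  -- Multiplying by λ(φ) need not preserve I, which is not assumed closed. The left factor i keeps
  -- the result in I: (iai)λ(φ) = i·((ai)λ(φ)).
  obtain ⟨a, ha⟩ := ρ.exists_mul_mul_ne_zero hi0' hi0'
  rw [mul_assoc] at ha
  obtain ⟨φ, hφ, hc⟩ := ρ.exists_isRepresentative_ne_zero ν S κ hκ ha
  have hcI : S φ (i * (a * i)) ∈ I := by
    rw [hS]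
    exact I.mul_mem_right _ _ hi
  refine ⟨S φ (i * (a * i)), hc, fun φ' hφ' => ?_⟩
  have hD : FiniteDimensional ℂ (LinearMap.range (ρ.rep (S φ (i * (a * i)))).toLinearMap) := by
    have := hfin φ hφ
    rw [hκ]
    change FiniteDimensional ℂ (LinearMap.range
      ((ρ.rep (i * (a * i))).toLinearMap ∘ₗ (κ.integrated ν φ).toLinearMap))
    rw [LinearMap.range_comp]
    infer_instance
  let R : A →ₗ[ℂ] (ρ.H →L[ℂ] ρ.H) := (starHomCLM ρ.rep).toLinearMap
  refine finiteDimensional_range_of_ker_le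
    (R ∘ₗ S φ' ∘ₗ LinearMap.mulLeft ℂ (S φ (i * (a * i)))) _ (fun b hb => ?_)
    (finiteDimensional_range_sandwich _ _ hD (hfin φ' hφ') _ fun b => ⟨ρ.rep b, ?_⟩)
  · refine hinj _ ?_ hb
    change S φ' (S φ (i * (a * i)) * b) ∈ I
    rw [hS]
    exact I.mul_mem_right _ _ hcI
  · change ρ.rep (S φ' (S φ (i * (a * i)) * b)) = _
    rw [hκ, map_mul]

end CompactSubgroup

section Ideal

variable {A : Type u} [NonUnitalCStarAlgebra A]

/-- An irreducible representation that does not vanish on a closed ideal `J` does not vanish on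
some element that is fixed by an element of `J`. -/
theorem IrrRep.exists_fixed_of_ideal (ρ : IrrRep A) {J : NonUnitalStarSubalgebra ℂ A}
    (hJ : ∀ a : A, ∀ j ∈ J, a * j ∈ J) (h : ∃ j ∈ J, ρ.rep j ≠ 0) :
    ∃ c, ρ.rep c ≠ 0 ∧ ∃ b ∈ J, b * c = c := by
  obtain ⟨j, hj, hj0⟩ := h
  have hjj : ρ.rep (star j * j) ≠ 0 := by
    rw [map_mul, map_star]
    exact fun h => hj0 (CStarRing.star_mul_self_eq_zero_iff _ |>.1 h)
  have hpos := norm_pos_iff.2 hjj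
  -- The truncation c of j*j is within half of ‖ρ(j*j)‖, so ρ(c) ≠ 0. The element fixing c is g j*j,
  -- which lies in J.
  obtain ⟨c, g, hc, hgc, -⟩ := (IsSelfAdjoint.star_mul_self j).exists_truncation (half_pos hpos)
  refine ⟨c, fun h0 => ?_, g * (star j * j), hJ _ _ (hJ _ _ hj), hgc⟩
  have h1 := (NonUnitalStarAlgHom.norm_apply_le ρ.rep (c - star j * j)).trans hc
  rw [map_sub, h0, zero_sub, norm_neg] at h1
  linarith

end Ideal

/-! ### The abstract correspondence -/

section Correspondence

variable {G : Type u} [Group G] [TopologicalSpace G] [IsTopologicalGroup G]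
  [MeasurableSpace G] [BorelSpace G] (μ : Measure G) [μ.IsHaarMeasure]
variable {K : Subgroup G} [CompactSpace K] (ν : Measure K) [ν.IsHaarMeasure]
variable {A : Type u} [NonUnitalCStarAlgebra A]

/-- Let `J` be a closed ideal of a completion `A` of `C_c(G)`, consisting of the `c` for which all
`c A λ(φ)` have finite dimension, up to closure. Then the points of the spectrum of `J` correspond
to the discrete series representations that are `K`-admissible. -/
theorem exists_correspondence {conv : C_c(G, ℂ) → A} (hconv : DenseRange conv)
    (S : C_c(K, ℂ) → A →ₗ[ℂ] A) (hS : ∀ φ a b, S φ (a * b) = a * S φ b)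
    (hdis : ∀ ρ : IrrRep A, ∃ π : UnitaryRep G ρ.H, π.IsIrreducible ∧
      (∀ f, ρ.rep (conv f) = π.integrated μ f) ∧
      ∀ φ a, ρ.rep (S φ a) = ρ.rep a * (π.restrict K).integrated ν φ)
    {H : Type*} [NormedAddCommGroup H] [InnerProductSpace ℂ H] [CompleteSpace H]
    (θ : A →⋆ₙₐ[ℂ] (H →L[ℂ] H)) (hθ : Function.Injective θ)
    (J : NonUnitalStarSubalgebra ℂ A) [IsClosed (J : Set A)] (hJ : ∀ a : A, ∀ j ∈ J, a * j ∈ J)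
    (hJ₁ : ∀ c, (∃ b ∈ J, b * c = c) → ∀ φ, IsRepresentative φ →
      FiniteDimensional ℂ (LinearMap.range (S φ ∘ₗ LinearMap.mulLeft ℂ c)))
    (hJ₂ : ∀ c, (∀ φ, IsRepresentative φ →
      FiniteDimensional ℂ (LinearMap.range (S φ ∘ₗ LinearMap.mulLeft ℂ c))) → c ∈ J) :
    ∃ Φ : CStarDual J → UnitaryDual G,
      (∀ (σ : IrrRep J) (π : IrrUnitaryRep G),
        Φ σ.toDual = ⟦π⟧ ↔ ∃ ρ : IrrRep A, IsExtension J ρ σ ∧ IntegratesTo μ conv ρ π) ∧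
      Function.Injective Φ ∧
      Set.range Φ = {c : UnitaryDual G | ∃ π : IrrUnitaryRep G, ⟦π⟧ = c ∧
        (∃ ρ : IrrRep A, IntegratesTo μ conv ρ π ∧ IsClopen {ρ.toDual}) ∧
        π.rep.IsAdmissible K} := by
  have hdisK : ∀ x : IrrRep A, ∃ κ : UnitaryRep K x.H,
      ∀ φ a, x.rep (S φ a) = x.rep a * κ.integrated ν φ := fun x => by
    obtain ⟨π, -, -, h⟩ := hdis x
    exact ⟨_, h⟩
  have htotal : ∀ σ : IrrRep J, ∃ (ρ : IrrRep A) (π : IrrUnitaryRep G),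
      IsExtension J ρ σ ∧ IntegratesTo μ conv ρ π := by
    intro σ
    obtain ⟨ρ, hρ⟩ := σ.exists_isExtension hJ
    obtain ⟨π, hπ, h, -⟩ := hdis ρ
    refine ⟨ρ, ⟨ρ.H, π, hπ⟩, hρ, LinearIsometryEquiv.refl ℂ ρ.H, fun f ξ => ?_⟩
    rw [h]
    rfl
  -- R chooses an extension to A and P its disintegration to G. The uniqueness statements make the
  -- class of P independent of these choices and of the representative σ.
  choose R P hR hP using htotal
  have hlift : ∀ σ σ' : IrrRep J, σ ≈ σ' →
      (⟦P σ⟧ : UnitaryDual G) = ⟦P σ'⟧ := fun σ σ' h => Quotient.sound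
    ((hP σ).equiv_right hconv ((hP σ').congr_left
      (IsExtension.equiv_left hJ (hR σ') ((hR σ).congr_right h))))
  have hcorr : ∀ (σ : IrrRep J) (π : IrrUnitaryRep G), (⟦P σ⟧ : UnitaryDual G) = ⟦π⟧ ↔
      ∃ ρ : IrrRep A, IsExtension J ρ σ ∧ IntegratesTo μ conv ρ π := by
    intro σ π
    constructor
    · intro h
      exact ⟨R σ, hR σ, (hP σ).congr_right (Setoid.symm (Quotient.exact h))⟩
    · rintro ⟨ρ, hρ, hπ⟩
      exact Quotient.sound ((hP σ).equiv_right hconv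
        (hπ.congr_left (IsExtension.equiv_left hJ hρ (hR σ))))
  refine ⟨Quotient.lift (fun σ => (⟦P σ⟧ : UnitaryDual G)) hlift, hcorr, ?_, ?_⟩
  · intro s s'
    induction s using Quotient.inductionOn with
    | h σ =>
      induction s' using Quotient.inductionOn with
      | h σ' =>
        intro h
        obtain ⟨ρ, hρ, hπ⟩ := (hcorr σ (P σ')).1 h
        exact Quotient.sound ((hρ.congr_left (hπ.equiv_left hconv (hP σ'))).equiv_right (hR σ'))
  · ext p
    constructor
    · rintro ⟨s, rfl⟩
      induction s using Quotient.inductionOn with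
      | h σ =>
        refine ⟨P σ, rfl, ?_⟩
        obtain ⟨c, hc, hcJ⟩ := (R σ).exists_fixed_of_ideal hJ (hR σ).exists_apply_ne_zero
        have hcfin := hJ₁ c hcJ
        obtain ⟨π, hπ, hform, hκ⟩ := hdis (R σ)
        have hfin := fun φ (hφ : IsRepresentative φ) =>
          (R σ).finiteDimensional_range_of_corner ν S _ hκ hc hcfin hφ
        refine ⟨⟨R σ, hP σ, (R σ).isClosed_singleton_toDual ν S _ hκ hdisK hfin,
          (R σ).isOpen_singleton_toDual ν S hS _ hκ hc hcfin⟩, ?_⟩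
        have hπ' : IntegratesTo μ conv (R σ) ⟨(R σ).H, π, hπ⟩ :=
          ⟨LinearIsometryEquiv.refl ℂ (R σ).H, fun f ξ => by rw [hform]; rfl⟩
        obtain ⟨U, hU⟩ := hπ'.equiv_right hconv (hP σ)
        refine UnitaryRep.IsAdmissible.congr (π := π) (fun V _ _ _ τ hτ => ?_) U hU
        exact finiteDimensional_intertwiners_of_irreducible ν (π.restrict K) hfin τ hτ
    · rintro ⟨π, rfl, ⟨ρ, hρ, hclopen⟩, hadm⟩
      obtain ⟨π₀, hπ₀, hform, hκ⟩ := hdis ρ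
      have hπ' : IntegratesTo μ conv ρ ⟨ρ.H, π₀, hπ₀⟩ :=
        ⟨LinearIsometryEquiv.refl ℂ ρ.H, fun f ξ => by rw [hform]; rfl⟩
      obtain ⟨U, hU⟩ := hρ.equiv_right hconv hπ'
      have hadm₀ : π₀.IsAdmissible K := hadm.congr U hU
      -- Only openness of the point is needed in this direction; closedness is a consequence of
      -- admissibility.
      obtain ⟨c, hc, hcfin⟩ := ρ.exists_corner_of_isOpen ν S hS θ hθ _ hκ
        (fun φ hφ => finiteDimensional_range_integrated ν (π₀.restrict K) hadm₀ hφ) hclopen.2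
      have hne : ∃ j ∈ J, ρ.rep j ≠ 0 := ⟨c, hJ₂ c hcfin, hc⟩
      refine ⟨(ρ.restrictIdeal J hJ hne).toDual, ?_⟩
      exact (hcorr _ π).2 ⟨ρ, ρ.isExtension_restrictIdeal J hJ hne, hρ⟩

end Correspondence

/-! ### Slices of tensor products -/

section Slices

variable {E V : Type*} [NormedAddCommGroup E] [InnerProductSpace ℂ E]
  [NormedAddCommGroup V] [InnerProductSpace ℂ V]

/-- The slice map `ξ ⊗ v ↦ ⟨w, v⟩ ξ`. -/
def slice (E : Type*) [NormedAddCommGroup E] [InnerProductSpace ℂ E] (w : V) :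
    E ⊗[ℂ] V →L[ℂ] E :=
  (TensorProduct.ridIsometry ℂ E).toContinuousLinearEquiv.toContinuousLinearMap.comp
    ((innerSL ℂ w).lTensor E)

theorem slice_tmul (w v : V) (ξ : E) : slice E w (ξ ⊗ₜ[ℂ] v) = inner ℂ w v • ξ := by
  simp [slice]

/-- The slice along w is the adjoint of η ↦ η ⊗ w. In particular it is conjugate-linear in w. -/
theorem inner_slice (w : V) (η : E) (x : E ⊗[ℂ] V) :
    inner ℂ η (slice E w x) = inner ℂ (η ⊗ₜ[ℂ] w) x := by
  induction x using TensorProduct.induction_on with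
  | zero => simp
  | add x y hx hy => rw [map_add, inner_add_right, inner_add_right, hx, hy]
  | tmul ξ v => rw [slice_tmul, inner_smul_right, TensorProduct.inner_tmul, mul_comm]

theorem slice_add (w w' : V) (x : E ⊗[ℂ] V) : slice E (w + w') x = slice E w x + slice E w' x :=
  ext_inner_left ℂ fun η => by
    rw [inner_add_right, inner_slice, inner_slice, inner_slice, TensorProduct.tmul_add,
      inner_add_left]

theorem slice_smul (c : ℂ) (w : V) (x : E ⊗[ℂ] V) :
    slice E (c • w) x = starRingEnd ℂ c • slice E w x :=
  ext_inner_left ℂ fun η => by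
    rw [inner_smul_right, inner_slice, inner_slice, TensorProduct.tmul_smul]
    exact inner_smul_left (𝕜 := ℂ) (η ⊗ₜ[ℂ] w) x c

theorem slice_rTensor (T : E →L[ℂ] E) (w : V) (x : E ⊗[ℂ] V) :
    slice E w (T.rTensor V x) = T (slice E w x) := by
  induction x using TensorProduct.induction_on with
  | zero => simp
  | add x y hx hy => rw [map_add, map_add, map_add, map_add, hx, hy]
  | tmul ξ v => rw [ContinuousLinearMap.rTensor_tmul, slice_tmul, slice_tmul, map_smul]

theorem sum_slice_tmul {ι : Type*} [Fintype ι] (b : OrthonormalBasis ι ℂ V) (x : E ⊗[ℂ] V) :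
    ∑ i, slice E (b i) x ⊗ₜ[ℂ] b i = x := by
  induction x using TensorProduct.induction_on with
  | zero => simp
  | add x y hx hy =>
    simp only [map_add, TensorProduct.add_tmul, Finset.sum_add_distrib]
    rw [hx, hy]
  | tmul ξ v =>
    conv_rhs => rw [← b.sum_repr v]
    simp [slice_tmul, TensorProduct.tmul_sum, TensorProduct.smul_tmul, b.repr_apply_apply]

theorem ext_slice [FiniteDimensional ℂ V] {x y : E ⊗[ℂ] V}
    (h : ∀ w, slice E w x = slice E w y) : x = y := by
  rw [← sum_slice_tmul (stdOrthonormalBasis ℂ V) x, ← sum_slice_tmul (stdOrthonormalBasis ℂ V) y]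
  simp only [h]

/-- A crude bound obtained slice by slice. Only its linearity in ‖T‖ matters: it makes the action on
L²(G/K;V) norm continuous, so that the compact ideal is closed. -/
theorem norm_rTensor_apply_le {ι : Type*} [Fintype ι] (b : OrthonormalBasis ι ℂ V)
    (T : E →L[ℂ] E) (x : E ⊗[ℂ] V) :
    ‖T.rTensor V x‖ ≤ ‖T‖ * ((∑ i, ‖slice E (b i)‖) * ‖x‖) := by
  rw [← sum_slice_tmul b (T.rTensor V x), Finset.sum_mul, Finset.mul_sum]
  refine (norm_sum_le _ _).trans (Finset.sum_le_sum fun i _ => ?_)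
  rw [TensorProduct.norm_tmul, b.norm_eq_one, mul_one, slice_rTensor]
  exact (T.le_opNorm _).trans (mul_le_mul_of_nonneg_left ((slice E (b i)).le_opNorm x)
    (norm_nonneg _))

end Slices

/-! ### Invariant tensors and convolution by representative functions -/

section Invariants

variable {K : Type u} [Group K] [TopologicalSpace K]
variable {E : Type*} [NormedAddCommGroup E] [InnerProductSpace ℂ E] (r : UnitaryRep K E)
variable {V : Type u} [NormedAddCommGroup V] [InnerProductSpace ℂ V] (τ : UnitaryRep K V)

/-- The invariant vectors of a tensor product of representations. -/
def tensorInvariants : Submodule ℂ (E ⊗[ℂ] V) where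
  carrier := {x | ∀ k, TensorProduct.map (r.toHom k).toLinearEquiv.toLinearMap
    (τ.toHom k).toLinearEquiv.toLinearMap x = x}
  add_mem' {x y} hx hy k := by rw [map_add, hx k, hy k]
  zero_mem' k := map_zero _
  smul_mem' c x hx k := by rw [map_smul, hx k]

theorem slice_map (k : K) (w : V) (x : E ⊗[ℂ] V) :
    slice E w (TensorProduct.map (r.toHom k).toLinearEquiv.toLinearMap
      (τ.toHom k).toLinearEquiv.toLinearMap x) = r.toHom k (slice E (τ.toHom k⁻¹ w) x) := by
  induction x using TensorProduct.induction_on with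
  | zero => simp
  | add x y hx hy => rw [map_add, map_add, map_add, map_add, hx, hy]
  | tmul ξ v =>
    rw [TensorProduct.map_tmul, slice_tmul, slice_tmul, map_smul, τ.inner_map_left, inv_inv]
    rfl

variable {r τ} in
-- An invariant tensor x is the same as an equivariant conjugate-linear map from V to E, namely w ↦
-- slice of x along w.
theorem map_slice_of_mem {x : E ⊗[ℂ] V} (hx : x ∈ tensorInvariants r τ) (k : K) (w : V) :
    r.toHom k (slice E w x) = slice E (τ.toHom k w) x := by
  have h := slice_map r τ k (τ.toHom k w) x
  rw [hx k, τ.map_inv_map] at h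
  exact h.symm

variable [CompactSpace K] [IsTopologicalGroup K] [MeasurableSpace K] [BorelSpace K]
  (ν : Measure K) [ν.IsHaarMeasure] [CompleteSpace E] [FiniteDimensional ℂ V] [CompleteSpace V]

variable {r τ} in
-- Integrating the equivariance over K; conjugate-linearity in w is why the adjoint function appears
-- on the side of V.
theorem slice_integrated_of_mem {x : E ⊗[ℂ] V} (hx : x ∈ tensorInvariants r τ)
    {φ φ' : C_c(K, ℂ)} (hφ : ∀ k, φ' k = starRingEnd ℂ (φ k⁻¹)) (w : V) :
    slice E (τ.integrated ν φ' w) x = r.integrated ν (invFn φ) (slice E w x) := by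
  refine ext_inner_left ℂ fun η => ?_
  let T : V →ₗ[ℂ] ℂ := (innerSL ℂ x).toLinearMap ∘ₗ TensorProduct.mk ℂ E V η
  have h1 := τ.apply_integrated ν φ' (LinearMap.toContinuousLinearMap T) w
  have h2 := r.apply_integrated ν (invFn φ) (innerSL ℂ η) (slice E w x)
  change inner ℂ x (η ⊗ₜ[ℂ] τ.integrated ν φ' w)
    = ∫ k, φ' k • inner ℂ x (η ⊗ₜ[ℂ] τ.toHom k w) ∂ν at h1
  change inner ℂ η (r.integrated ν (invFn φ) (slice E w x))
    = ∫ k, φ k⁻¹ • inner ℂ η (r.toHom k (slice E w x)) ∂ν at h2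
  rw [h2, inner_slice]
  refine (inner_conj_symm (𝕜 := ℂ) (η ⊗ₜ[ℂ] τ.integrated ν φ' w) x).symm.trans ?_
  rw [h1, ← integral_conj]
  refine integral_congr_ae (Filter.Eventually.of_forall fun k => ?_)
  change starRingEnd ℂ (φ' k • inner ℂ x (η ⊗ₜ[ℂ] τ.toHom k w))
    = φ k⁻¹ • inner ℂ η (r.toHom k (slice E w x))
  rw [map_slice_of_mem hx, inner_slice, hφ, smul_eq_mul, map_mul, Complex.conj_conj,
    smul_eq_mul]
  exact congrArg _ (inner_conj_symm (𝕜 := ℂ) (η ⊗ₜ[ℂ] τ.toHom k w) x)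

/-- The average `∫ r(k) ξ ⊗ τ(k) v dk`, written in an orthonormal basis. -/
def averageTensor (v : V) (ξ : E) : E ⊗[ℂ] V :=
  ∑ i, r.integrated ν (invFn (matrixCoeff τ (stdOrthonormalBasis ℂ V i) v)) ξ
    ⊗ₜ[ℂ] stdOrthonormalBasis ℂ V i

theorem slice_averageTensor (v w : V) (ξ : E) :
    slice E w (averageTensor r τ ν v ξ) = r.integrated ν (invFn (matrixCoeff τ w v)) ξ := by
  have h : invFn (matrixCoeff τ w v) = ∑ i, inner ℂ w (stdOrthonormalBasis ℂ V i) •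
      invFn (matrixCoeff τ (stdOrthonormalBasis ℂ V i) v) := by
    ext k
    rw [CompactlySupportedContinuousMap.sum_apply]
    simp only [CompactlySupportedContinuousMap.smul_apply, invFn_apply, matrixCoeff_apply,
      smul_eq_mul]
    conv_lhs => rw [← (stdOrthonormalBasis ℂ V).sum_repr w]
    simp only [map_sum, map_smul, sum_inner, inner_smul_left,
      OrthonormalBasis.repr_apply_apply, inner_conj_symm]
  rw [h, ← r.integratedₗ_apply ν, map_sum, averageTensor, map_sum]
  simp only [slice_tmul, map_smul]
  rw [sum_apply]
  rfl

theorem averageTensor_mem (v : V) (ξ : E) : averageTensor r τ ν v ξ ∈ tensorInvariants r τ := by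
  intro k
  refine ext_slice fun w => ?_
  rw [slice_map, slice_averageTensor, slice_averageTensor, ← r.integrated_lTrans ν]
  congr 1
  congr 1
  ext h
  simp only [lTrans_apply, invFn_apply, matrixCoeff_apply, ← τ.map_mul_apply, mul_inv_rev, inv_inv,
    mul_inv_cancel_right]

/-- If `c ⊗ 1` has finite rank on the invariants in `E ⊗ V`, then `c r(φ)` has finite rank for the
matrix coefficients `φ` of `V`. -/
theorem finiteDimensional_range_of_invariants (c : E →L[ℂ] E)
    (h : FiniteDimensional ℂ ((tensorInvariants r τ).map (c.rTensor V).toLinearMap)) (w v : V) :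
    FiniteDimensional ℂ
      (LinearMap.range (c * r.integrated ν (invFn (matrixCoeff τ w v))).toLinearMap) := by
  refine Submodule.finiteDimensional_of_le (S₂ :=
    ((tensorInvariants r τ).map (c.rTensor V).toLinearMap).map (slice E w).toLinearMap) ?_
  rintro _ ⟨ξ, rfl⟩
  refine ⟨_, ⟨averageTensor r τ ν v ξ, averageTensor_mem r τ ν v ξ, rfl⟩, ?_⟩
  change slice E w (c.rTensor V (averageTensor r τ ν v ξ)) = _
  rw [slice_rTensor, slice_averageTensor]
  rfl

/-- If `c r(φ)` has finite rank for all representative functions `φ`, then `c ⊗ 1` has finite rank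
on the invariants in `E ⊗ V`. -/
theorem finiteDimensional_invariants_of_range (c : E →L[ℂ] E)
    (h : ∀ φ, IsRepresentative φ →
      FiniteDimensional ℂ (LinearMap.range (c * r.integrated ν (invFn φ)).toLinearMap)) :
    FiniteDimensional ℂ ((tensorInvariants r τ).map (c.rTensor V).toLinearMap) := by
  have := isInvInvariant_of_compactSpace ν
  -- N collects the directions w along which the slices of all invariant tensors are mapped by c
  -- into one finite-dimensional space. By hypothesis it contains every vector τ(φ')w with φ' the
  -- adjoint of a representative function.
  let N : Submodule ℂ V :=
    { carrier := {w | ∃ F : Submodule ℂ E, FiniteDimensional ℂ F ∧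
        ∀ x ∈ tensorInvariants r τ, c (slice E w x) ∈ F}
      add_mem' := by
        rintro w w' ⟨F, hF, hw⟩ ⟨F', hF', hw'⟩
        refine ⟨F ⊔ F', inferInstance, fun x hx => ?_⟩
        rw [slice_add, map_add]
        exact Submodule.add_mem_sup (hw x hx) (hw' x hx)
      zero_mem' := ⟨⊥, inferInstance, fun x _ => by
        have := slice_smul (E := E) 0 (0 : V) x
        rw [zero_smul, map_zero, zero_smul] at this
        rw [this, map_zero]
        exact Submodule.zero_mem _⟩
      smul_mem' := by
        rintro a w ⟨F, hF, hw⟩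
        refine ⟨F, hF, fun x hx => ?_⟩
        rw [slice_smul, map_smul]
        exact F.smul_mem _ (hw x hx) }
  have hN : ∀ φ φ' : C_c(K, ℂ), IsRepresentative φ → (∀ k, φ' k = starRingEnd ℂ (φ k⁻¹)) → ∀ w,
      τ.integrated ν φ' w ∈ N := by
    intro φ φ' hφ hadj w
    refine ⟨_, h φ hφ, fun x hx => ?_⟩
    rw [slice_integrated_of_mem ν hx hadj]
    exact ⟨slice E w x, rfl⟩
  -- For w orthogonal to N with τ(φ)w ≠ 0, the norm squared of τ(φ)w equals ⟨w, τ(φ')τ(φ)w⟩, which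
  -- vanishes because the second vector is in N.
  have htop : N = ⊤ := by
    by_contra hne
    obtain ⟨w, hw, hw0⟩ := (Submodule.ne_bot_iff _).1
      (fun hb => hne (Submodule.orthogonal_eq_bot_iff.1 hb) : Nᗮ ≠ ⊥)
    obtain ⟨φ, hφ, hφw⟩ := exists_isRepresentative_apply_ne_zero ν τ hw0
    obtain ⟨φ', hφ', hadj⟩ := hφ.exists_adjoint
    refine hφw (inner_self_eq_zero (𝕜 := ℂ).1 ?_)
    rw [τ.inner_integrated_left ν φ φ' hadj]
    exact Submodule.inner_left_of_mem_orthogonal (hN φ φ' hφ hadj _) hw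
  let b := stdOrthonormalBasis ℂ V
  have hb : ∀ i, ∃ F : Submodule ℂ E, FiniteDimensional ℂ F ∧
      ∀ x ∈ tensorInvariants r τ, c (slice E (b i) x) ∈ F := fun i => by
    have : b i ∈ N := htop ▸ Submodule.mem_top
    exact this
  choose F hF hcF using hb
  let M := (tensorInvariants r τ).map (c.rTensor V).toLinearMap
  have hM : ∀ (y : M) i, slice E (b i) (y : E ⊗[ℂ] V) ∈ F i := by
    rintro ⟨_, x, hx, rfl⟩ i
    change slice E (b i) (c.rTensor V x) ∈ F i
    rw [slice_rTensor]
    exact hcF i x hx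
  let e : M →ₗ[ℂ] (∀ i, F i) :=
    { toFun := fun y i => ⟨slice E (b i) y, hM y i⟩
      map_add' := fun y y' => by
        ext i
        simp
      map_smul' := fun a y => by
        ext i
        simp }
  refine FiniteDimensional.of_injective e fun y y' hyy => Subtype.ext ?_
  rw [← sum_slice_tmul b (y : E ⊗[ℂ] V), ← sum_slice_tmul b (y' : E ⊗[ℂ] V)]
  refine Finset.sum_congr rfl fun i _ => ?_
  have := congrArg (fun f : ∀ i, F i => (f i : E)) hyy
  rw [show slice E (b i) (y : E ⊗[ℂ] V) = slice E (b i) (y' : E ⊗[ℂ] V) from this]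

end Invariants

/-! ### The compact ideal -/

section CompactIdealTheorems

variable {G : Type u} [Group G] [TopologicalSpace G] [IsTopologicalGroup G]
  [LocallyCompactSpace G] [T2Space G] [MeasurableSpace G] [BorelSpace G]
variable (μ : Measure G) [μ.IsHaarMeasure] [μ.Regular] [μ.IsMulRightInvariant]
variable {K : Subgroup G} {V : Type u} [NormedAddCommGroup V] [InnerProductSpace ℂ V]

theorem finiteDimensional_bundleAction_iff (τ : UnitaryRep K V) (c : reducedCStar μ) :
    FiniteDimensional ℂ (LinearMap.range (bundleAction μ τ c).toLinearMap) ↔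
      FiniteDimensional ℂ ((tensorInvariants ((rightRegular μ).restrict K) τ).map
        ((c : Lp ℂ 2 μ →L[ℂ] Lp ℂ 2 μ).rTensor V).toLinearMap) := by
  have h : (LinearMap.range (bundleAction μ τ c).toLinearMap).map (bundleL2 μ τ).subtype
      = (tensorInvariants ((rightRegular μ).restrict K) τ).map
        ((c : Lp ℂ 2 μ →L[ℂ] Lp ℂ 2 μ).rTensor V).toLinearMap := by
    ext y
    constructor
    · rintro ⟨_, ⟨x, rfl⟩, rfl⟩
      exact ⟨x, x.2, rfl⟩
    · rintro ⟨x, hx, rfl⟩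
      exact ⟨_, ⟨⟨x, hx⟩, rfl⟩, rfl⟩
  rw [← h]
  let e := Submodule.equivMapOfInjective _ (bundleL2 μ τ).injective_subtype
    (LinearMap.range (bundleAction μ τ c).toLinearMap)
  exact ⟨fun _ => Module.Finite.equiv e, fun _ => Module.Finite.equiv e.symm⟩

theorem isClosed_isCompactOperator_of_bound {A F : Type*} [SeminormedAddCommGroup A]
    [NormedAddCommGroup F] [NormedSpace ℂ F] [CompleteSpace F] (f : A → F →L[ℂ] F)
    (hf : ∀ a b, f (a + b) = f a + f b) {C : ℝ} (hC : 0 ≤ C)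
    (h : ∀ a x, ‖f a x‖ ≤ ‖a‖ * (C * ‖x‖)) : IsClosed {a | IsCompactOperator (f a)} := by
  refine isClosed_setOfPred_isCompactOperator.preimage
    (AddMonoidHomClass.continuous_of_bound (AddMonoidHom.mk' f hf) C fun a => ?_)
  refine ContinuousLinearMap.opNorm_le_bound _ (by positivity) fun x => (h a x).trans (le_of_eq ?_)
  ring

instance isClosed_compactIdeal (K : Subgroup G) :
    IsClosed (compactIdeal μ K : Set (reducedCStar μ)) := by
  refine isClosed_of_closure_subset fun a ha V _ _ _ τ => ?_
  have := bundleL2_complete μ τ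
  have hcl : IsClosed {a : reducedCStar μ | IsCompactOperator (bundleAction μ τ a)} :=
    isClosed_isCompactOperator_of_bound (F := bundleL2 μ τ) (bundleAction μ τ)
      (bundleAction_add μ τ)
      (Finset.sum_nonneg fun i _ => norm_nonneg (slice (Lp ℂ 2 μ) (stdOrthonormalBasis ℂ V i)))
      fun a x => norm_rTensor_apply_le (stdOrthonormalBasis ℂ V)
        (a : Lp ℂ 2 μ →L[ℂ] Lp ℂ 2 μ) (x : Lp ℂ 2 μ ⊗[ℂ] V)
  exact closure_minimal (fun b (hb : b ∈ compactIdeal μ K) => hb V τ) hcl ha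

theorem mul_mem_compactIdeal (a b : reducedCStar μ) (hb : b ∈ compactIdeal μ K) :
    a * b ∈ compactIdeal μ K := fun V _ _ _ τ => by
  rw [bundleAction_mul]
  exact (hb V τ).clm_comp (bundleAction μ τ a)

theorem isCompactOperator_of_finiteDimensional_range {E : Type*} [NormedAddCommGroup E]
    [NormedSpace ℂ E] (T : E →L[ℂ] E) (h : FiniteDimensional ℂ (LinearMap.range T.toLinearMap)) :
    IsCompactOperator T := by
  have : ProperSpace (LinearMap.range T.toLinearMap) := FiniteDimensional.proper ℂ _
  have h1 : IsCompactOperator (T.codRestrict (LinearMap.range T.toLinearMap) fun x => ⟨x, rfl⟩) :=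
    isCompactOperator_of_locallyCompactSpace_dom _
  exact h1.clm_comp (Submodule.subtypeL _)

variable [CompactSpace K] (ν : Measure K) [ν.IsHaarMeasure]

theorem subgroupCorner_toLinearMap (c : reducedCStar μ) (φ : C_c(K, ℂ)) :
    (subgroupCorner μ ν c φ).toLinearMap
      = (mulSubgroupConvL μ ν φ).toLinearMap ∘ₗ LinearMap.mulLeft ℂ c := rfl

/-- On L²(G/K;V) the compact operator given by b fixes the range of c, so c acts with finite rank
there. Averaged tensors transfer this to c r(φ), and the exchange between L²(G) and A to cAλ(φ). -/
theorem finiteDimensional_of_mem_compactIdeal_fixing {b c : reducedCStar μ}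
    (hb : b ∈ compactIdeal μ K) (hbc : b * c = c) {φ : C_c(K, ℂ)} (hφ : IsRepresentative φ) :
    FiniteDimensional ℂ (LinearMap.range
      ((mulSubgroupConvL μ ν φ).toLinearMap ∘ₗ LinearMap.mulLeft ℂ c)) := by
  have := isInvInvariant_of_compactSpace ν
  obtain ⟨V, _, _, _, τ, w, v, rfl⟩ := hφ
  have : CompleteSpace V := FiniteDimensional.complete ℂ V
  have h : ∀ x, bundleAction μ τ b (bundleAction μ τ c x) = bundleAction μ τ c x := fun x => by
    have h := congrArg (fun T => T x) (bundleAction_mul μ τ b c)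
    rw [hbc] at h
    exact h.symm
  have h1 := finiteDimensional_range_of_compact_fixing (H := bundleL2 μ τ) (bundleAction μ τ b)
    (hb V τ) (bundleAction μ τ c).toLinearMap h
  have h2 := (finiteDimensional_bundleAction_iff μ τ c).1 h1
  have h3 := finiteDimensional_range_of_invariants _ τ ν _ h2 w v
  rw [← subgroupCorner_toLinearMap]
  exact (finiteDimensional_subgroupCorner_iff μ ν c (matrixCoeff τ w v)).2 h3

theorem finiteDimensional_bundleAction [FiniteDimensional ℂ V] (τ : UnitaryRep K V)
    {c : reducedCStar μ} (h : ∀ φ : C_c(K, ℂ), IsRepresentative φ →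
      FiniteDimensional ℂ (LinearMap.range
        ((mulSubgroupConvL μ ν φ).toLinearMap ∘ₗ LinearMap.mulLeft ℂ c))) :
    FiniteDimensional ℂ (LinearMap.range (bundleAction μ τ c).toLinearMap) := by
  have := isInvInvariant_of_compactSpace ν
  have : CompleteSpace V := FiniteDimensional.complete ℂ V
  have h1 := finiteDimensional_invariants_of_range ((rightRegular μ).restrict K) τ ν
    (c : Lp ℂ 2 μ →L[ℂ] Lp ℂ 2 μ)
    fun φ hφ => by
      have h0 := h φ hφ
      rw [← subgroupCorner_toLinearMap] at h0
      exact (finiteDimensional_subgroupCorner_iff μ ν c φ).1 h0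
  exact (finiteDimensional_bundleAction_iff μ τ c).2 h1

/-- Finite-dimensionality of all cAλ(φ) gives more than compactness: c acts on every L²(G/K;V) with
finite rank. -/
theorem mem_compactIdeal_of_finiteDimensional {c : reducedCStar μ}
    (h : ∀ φ : C_c(K, ℂ), IsRepresentative φ →
      FiniteDimensional ℂ (LinearMap.range
        ((mulSubgroupConvL μ ν φ).toLinearMap ∘ₗ LinearMap.mulLeft ℂ c))) :
    c ∈ compactIdeal μ K := by
  intro V _ _ _ τ
  have h1 := isCompactOperator_of_finiteDimensional_range (E := bundleL2 μ τ) (bundleAction μ τ c)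
  exact h1 (finiteDimensional_bundleAction μ ν τ h)

end CompactIdealTheorems

end

/-- The spectrum of the compact ideal, identified (by extending representations to `C*_r(G)` and
disintegrating them to `G`) with a set of classes of irreducible unitary representations of `G`,
consists exactly of the `K`-admissible topological discrete series representations. -/
theorem mainTheorem3 {G : Type u} [Group G] [TopologicalSpace G] [IsTopologicalGroup G]
    [LocallyCompactSpace G] [T2Space G] [MeasurableSpace G] [BorelSpace G]
    (μ : Measure G) [μ.IsHaarMeasure] [μ.Regular] [μ.IsMulRightInvariant]
    (K : Subgroup G) (hK : IsCompact (K : Set G)) :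
    ∃ Φ : CStarDual (compactIdeal μ K) → UnitaryDual G,
      (∀ (σ : IrrRep (compactIdeal μ K)) (π : IrrUnitaryRep G),
        Φ σ.toDual = ⟦π⟧ ↔ CorrespondsTo μ (compactIdeal μ K) σ π) ∧
      Function.Injective Φ ∧
      Set.range Φ = {c : UnitaryDual G | ∃ π : IrrUnitaryRep G, ⟦π⟧ = c ∧
        IsTopologicalDiscreteSeries μ π ∧ π.rep.IsAdmissible K} := by
  have : CompactSpace K := isCompact_iff_compactSpace.1 hK
  let ν : Measure K := Measure.haar
  have h1 := exists_correspondence μ ν (H := Lp ℂ 2 μ) (denseRange_leftConv μ)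
    (fun φ => (mulSubgroupConvL μ ν φ).toLinearMap)
  have h2 := h1 (fun φ a b => mul_mulSubgroupConv μ ν a b φ)
  have h3 := h2 (exists_integrated_reducedCStar μ ν)
  have h4 := h3 (reducedInclusion μ) Subtype.coe_injective
  have h5 := h4 (compactIdeal μ K) (mul_mem_compactIdeal μ)
  have h6 := h5 fun c hc φ hφ => Exists.elim hc fun b hb =>
    finiteDimensional_of_mem_compactIdeal_fixing μ ν hb.1 hb.2 hφ
  exact h6 fun c hc => mem_compactIdeal_of_finiteDimensional μ ν hc
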